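/- **Setting.** Let $d\ge 1$ and let $\mathcal M\subset\mathbb R^D$ be a compact smooth $d$-dimensional embedded submanifold without boundary (with the induced Riemannian metric), such that $|x_j|\le B$ for all $x\in\mathcal M$ and $j=1,\dots,D$, where $B>0$. Assume that the reach of $\mathcal M$, i.e. the distance from $\mathcal M$ to the set of points of $\mathbb R^D$ having at least two nearest points on $\mathcal M$, is $\tau\in(0,\infty)$. Let $SA(\mathcal M)$ be the $d$-dimensional surface area of $\mathcal M$. Let $\{(U_i,\mathsf P_i)\}_{i=1}^m$ be a finite atlas of $\mathcal M$ whose coordinate maps are orthogonal projections onto tangent spaces: $U_i\subset \mathcal M$ is open, $c_i\in U_i$, $\mathsf P_i(x)=V_i^\top(x-c_i)$ with the columns of $V_i\in\mathbb R^{D\times d}$ an orthonormal basis of $T_{c_i}\mathcal M$, $\mathsf P_i$ maps $U_i$ diffeomorphically onto an open set $\mathsf P_i(U_i)\subset\mathbb R^d$, and $\bigcup_i U_i=\mathcal M$. For an integer $s\ge1$ and $\alpha\in(0,1]$ let $\mathcal H^{s,\alpha}(\mathcal M)$ be the set of all $f:\mathcal M\to\mathbb R$ such that for every $i$ the function $f\circ\mathsf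 P_i^{-1}$ is $C^s$ on $\mathsf P_i(U_i)$, $|D^{\beta}(f\circ\mathsf P_i^{-1})|\le1$ on $\mathsf P_i(U_i)$ for all $|\beta|\le s$, and $|D^{\beta}(f\circ\mathsf P_i^{-1})(y_1)-D^{\beta}(f\circ\mathsf P_i^{-1})(y_2)|\le\|y_1-y_2\|_2^\alpha$ for all $|\beta|=s$ and $y_1,y_2\in\mathsf P_i(U_i)$. Let $\{\rho_i\}_{i=1}^m$ be a $C^\infty$ partition of unity on $\mathcal M$ with $\operatorname{supp}\rho_i\subset U_i$, let $\Lambda_i$ satisfy $|D^\beta(\rho_i\circ\mathsf P_i^{-1})|\le\Lambda_i$ on $\mathsf P_i(U_i)$ for all $|\beta|\le s$, and put $\Lambda=\sum_{i=1}^m\Lambda_i$. For $L,p,K\in\mathbb N$ and $\kappa>0$ let $\mathcal F(\kappa,L,p,K)$ be the class of ReLU networks $x\mapsto W_L\,\mathrm{ReLU}(W_{L-1}\cdots\mathrm{ReLU}(W_1x+b_1)\cdots+b_{L-1})+b_L$ from $\mathbb R^D$ to $\mathbb R$ with $L$ layers, all layer widths at most $p$, all entries of the $W_l,b_l$ bounded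 by $\kappa$ in absolute value, and at most $K$ nonzero entries in total. **Theorem.** There are $c_1,c_2,c_3$, depending only on $d,s,\tau,B,SA(\mathcal M)$ and $\Lambda$, and $c_4$, depending only on $\Lambda$ (in particular, none of them depends on $D$, $\alpha$ or $\varepsilon$), such that the following holds in every setting as above. For every $\varepsilon\in(0,1)$ there are $L,p,K\in\mathbb N$ with $$L\le c_1\Big(\log\tfrac1\varepsilon+\log D\Big),\qquad p\le c_2\Big(\varepsilon^{-\frac d{s+\alpha}}+D\Big),\qquad K\le c_3\Big(\varepsilon^{-\frac d{s+\alpha}}\log\tfrac1\varepsilon+D\log\tfrac1\varepsilon+D\log D\Big),$$ and a choice of hidden layer widths with at most $K$ hidden neurons in total, such that, with $\kappa=c_4\max\{1,B,\tau^2,\sqrt d\}$, for every $f\in\mathcal H^{s,\alpha}(\mathcal M)$ some network $\tilde f\in\mathcal F(\kappa,L,p,K)$ with these hidden layer widths satisfies $\sup_{x\in\mathcal M}|\tilde f(x)-f(x)|\le\varepsilon$. -/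

import Mathlib

open Filter Topology Set MeasureTheory
open scoped ContDiff

namespace ManifoldReLU

/-! ### ReLU networks -/

/-- Fully connected feedforward ReLU networks with real output, indexed by the input dimension.
`output W b` is the last affine layer `x ↦ W x + b`; `layer W b Φ` is the network that first computes
`ReLU (W x + b)` and then applies `Φ`. -/
inductive ReLUNet : ℕ → Type
  | output {m : ℕ} (W : Matrix (Fin 1) (Fin m) ℝ) (b : Fin 1 → ℝ) : ReLUNet m
  | layer {m k : ℕ} (W : Matrix (Fin k) (Fin m) ℝ) (b : Fin k → ℝ) (next : ReLUNet k) : ReLUNet m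

namespace ReLUNet

/-- The function computed by a network,
`W_L ReLU (W_{L-1} ⋯ ReLU (W_1 x + b_1) ⋯ + b_{L-1}) + b_L`. -/
noncomputable def eval : {m : ℕ} → ReLUNet m → (Fin m → ℝ) → ℝ
  | _, output W b, x => (W.mulVec x + b) 0
  | _, layer W b next, x => next.eval (fun i => max 0 ((W.mulVec x + b) i))

/-- The list of the widths of the hidden layers. -/
def hiddenWidths : {m : ℕ} → ReLUNet m → List ℕ
  | _, output _ _ => []
  | _, @layer _ k _ _ next => k :: next.hiddenWidths

/-- The number `L` of layers, i.e. of affine maps. -/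
def depth : {m : ℕ} → ReLUNet m → ℕ
  | _, output _ _ => 1
  | _, layer _ _ next => next.depth + 1

/-- The total number of nonzero entries of the weight matrices and the bias vectors. -/
noncomputable def numNonzero : {m : ℕ} → ReLUNet m → ℕ
  | _, output W b => {p : Fin 1 × Fin _ | W p.1 p.2 ≠ 0}.ncard + {i | b i ≠ 0}.ncard
  | _, layer W b next =>
      {p : Fin _ × Fin _ | W p.1 p.2 ≠ 0}.ncard + {i | b i ≠ 0}.ncard + next.numNonzero

/-- All entries of the weight matrices and of the bias vectors are at most `κ` in absolute value. -/
def WeightsBoundedBy (κ : ℝ) : {m : ℕ} → ReLUNet m → Prop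
  | _, output W b => (∀ i j, |W i j| ≤ κ) ∧ ∀ i, |b i| ≤ κ
  | _, layer W b next => (∀ i j, |W i j| ≤ κ) ∧ (∀ i, |b i| ≤ κ) ∧ next.WeightsBoundedBy κ

/-- Membership in the network class `F(∞, κ, L, p, K)`: `L` layers, width (of the input layer and of
every hidden layer) at most `p`, entries bounded by `κ`, at most `K` nonzero entries; no restriction
on the output range. -/
structure InClass {m : ℕ} (Φ : ReLUNet m) (κ : ℝ) (L p K : ℕ) : Prop where
  depth_eq : Φ.depth = L
  input_width_le : m ≤ p
  width_le : ∀ w ∈ Φ.hiddenWidths, w ≤ p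
  weights_le : Φ.WeightsBoundedBy κ
  numNonzero_le : Φ.numNonzero ≤ K

end ReLUNet

/-! ### Submanifolds of Euclidean space, tangent spaces, reach -/

/-- `M` is an embedded smooth `d`-dimensional submanifold (without boundary) of `ℝ^D`: near each of
its points it is the homeomorphic image of an open subset of `ℝ^d` under a smooth immersion. Such an
`M` carries the Riemannian metric induced from `ℝ^D`. -/
def IsSmoothSubmanifold (d : ℕ) {D : ℕ} (M : Set (EuclideanSpace ℝ (Fin D))) : Prop :=
  ∀ x ∈ M, ∃ (O : Set (EuclideanSpace ℝ (Fin D))) (W : Set (EuclideanSpace ℝ (Fin d)))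
    (ψ : EuclideanSpace ℝ (Fin d) → EuclideanSpace ℝ (Fin D))
    (θ : EuclideanSpace ℝ (Fin D) → EuclideanSpace ℝ (Fin d)),
    IsOpen O ∧ x ∈ O ∧ IsOpen W ∧
    ContDiffOn ℝ ∞ ψ W ∧ (∀ w ∈ W, Function.Injective (fderiv ℝ ψ w)) ∧
    ψ '' W = M ∩ O ∧ ContinuousOn θ (M ∩ O) ∧ ∀ w ∈ W, θ (ψ w) = w

/-- The tangent vectors of `M` at `x`: the velocities of curves in `M` through `x`. -/
def tangentVectors {D : ℕ} (M : Set (EuclideanSpace ℝ (Fin D))) (x : EuclideanSpace ℝ (Fin D)) :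
    Set (EuclideanSpace ℝ (Fin D)) :=
  {v | ∃ γ : ℝ → EuclideanSpace ℝ (Fin D),
    γ 0 = x ∧ (∀ᶠ t in 𝓝 0, γ t ∈ M) ∧ HasDerivAt γ v 0}

/-- The points that have at least two nearest neighbours on `M`. -/
def medialAxis {D : ℕ} (M : Set (EuclideanSpace ℝ (Fin D))) : Set (EuclideanSpace ℝ (Fin D)) :=
  {x | ∃ p ∈ M, ∃ q ∈ M, p ≠ q ∧ dist p x = Metric.infDist x M ∧ dist q x = Metric.infDist x M}

/-- The reach of `M`: the distance between `M` and its medial axis (`∞` if one of them is empty). -/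
noncomputable def reach {D : ℕ} (M : Set (EuclideanSpace ℝ (Fin D))) : ENNReal :=
  ⨅ x ∈ M, ⨅ y ∈ medialAxis M, edist x y

/-- The surface area of a `d`-dimensional `M`: its `d`-dimensional Hausdorff measure, normalised to
agree with Lebesgue measure on `ℝ^d`. -/
noncomputable def surfaceArea (d : ℕ) {D : ℕ} (M : Set (EuclideanSpace ℝ (Fin D))) : ℝ :=
  (μHE[d] M).toReal

/-! ### Atlases of tangent space projections -/

/-- A chart `(U, P)` of `M`, where `P x = Vᵀ (x - c)` is the orthogonal projection to the tangent
space at a point `c ∈ U`, written in an orthonormal basis `V = [v_1, …, v_d]` of that space. The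
field `inv` is the inverse `P⁻¹ : P(U) → U` (its values outside `P(U)` are irrelevant); `P` is a
diffeomorphism from the open subset `U` of `M` onto the open set `P(U)`. -/
structure TangentChart (d : ℕ) {D : ℕ} (M : Set (EuclideanSpace ℝ (Fin D))) where
  /-- the coordinate neighbourhood `U` -/
  dom : Set (EuclideanSpace ℝ (Fin D))
  /-- the base point `c` -/
  center : EuclideanSpace ℝ (Fin D)
  /-- the orthonormal basis of the tangent space at `c` -/
  frame : Fin d → EuclideanSpace ℝ (Fin D)
  /-- the inverse of the projection -/
  inv : EuclideanSpace ℝ (Fin d) → EuclideanSpace ℝ (Fin D)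
  dom_open : ∃ O : Set (EuclideanSpace ℝ (Fin D)), IsOpen O ∧ dom = M ∩ O
  center_mem : center ∈ dom
  frame_orthonormal : Orthonormal ℝ frame
  frame_span : (Submodule.span ℝ (range frame) : Set (EuclideanSpace ℝ (Fin D))) =
    tangentVectors M center
  inv_left : ∀ x ∈ dom, inv (WithLp.toLp 2 fun j => inner ℝ (frame j) (x - center)) = x
  image_open : IsOpen
    ((fun x => (WithLp.toLp 2 fun j => inner ℝ (frame j) (x - center) :
      EuclideanSpace ℝ (Fin d))) '' dom)
  inv_smooth : ContDiffOn ℝ ∞ inv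
    ((fun x => (WithLp.toLp 2 fun j => inner ℝ (frame j) (x - center) :
      EuclideanSpace ℝ (Fin d))) '' dom)

namespace TangentChart

variable {d D : ℕ} {M : Set (EuclideanSpace ℝ (Fin D))}

/-- The projection `P x = Vᵀ (x - c)`. -/
noncomputable def proj (φ : TangentChart d M) (x : EuclideanSpace ℝ (Fin D)) :
    EuclideanSpace ℝ (Fin d) :=
  WithLp.toLp 2 fun j => inner ℝ (φ.frame j) (x - φ.center)

/-- The coordinate domain `P(U) ⊆ ℝ^d`. -/
def target (φ : TangentChart d M) : Set (EuclideanSpace ℝ (Fin d)) := φ.proj '' φ.dom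

end TangentChart

/-- A finite atlas of `M` that consists of `m` tangent space projections. -/
structure TangentAtlas (d : ℕ) {D : ℕ} (M : Set (EuclideanSpace ℝ (Fin D))) (m : ℕ) where
  /-- the charts `(U_i, P_i)` -/
  chart : Fin m → TangentChart d M
  cover : M ⊆ ⋃ i, (chart i).dom

/-- The partial derivative `∂_{J 0} ⋯ ∂_{J (k-1)} g (y)` of order `k`. For a function that is `C^k`
near `y`, the numbers `partialDeriv J g y` with `J : Fin k → Fin d` are exactly the `D^β g (y)` with
multi-indices `β` of length `|β| = k`. -/
noncomputable def partialDeriv {d k : ℕ} (J : Fin k → Fin d) (g : EuclideanSpace ℝ (Fin d) → ℝ)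
    (y : EuclideanSpace ℝ (Fin d)) : ℝ :=
  iteratedFDeriv ℝ k g y fun l => EuclideanSpace.single (J l) 1

variable {d D m : ℕ} {M : Set (EuclideanSpace ℝ (Fin D))}

/-- `f` (only its values on `M` matter) belongs to the Hölder class `H^{s,α}(M)` of the given atlas:
in each chart `f ∘ P_i⁻¹` is `C^s`, its partial derivatives of order at most `s` are bounded by `1`,
and those of order `s` are `α`-Hölder continuous with constant `1`. -/
structure IsHolder (A : TangentAtlas d M m) (s : ℕ) (α : ℝ) (f : EuclideanSpace ℝ (Fin D) → ℝ) :
    Prop where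
  contDiffOn : ∀ i, ContDiffOn ℝ s (f ∘ (A.chart i).inv) (A.chart i).target
  bound : ∀ i, ∀ k ≤ s, ∀ J : Fin k → Fin d, ∀ x ∈ (A.chart i).dom,
    |partialDeriv J (f ∘ (A.chart i).inv) ((A.chart i).proj x)| ≤ 1
  holder : ∀ i, ∀ J : Fin s → Fin d, ∀ x₁ ∈ (A.chart i).dom, ∀ x₂ ∈ (A.chart i).dom,
    |partialDeriv J (f ∘ (A.chart i).inv) ((A.chart i).proj x₁) -
      partialDeriv J (f ∘ (A.chart i).inv) ((A.chart i).proj x₂)| ≤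
      ‖(A.chart i).proj x₁ - (A.chart i).proj x₂‖ ^ α

/-- A `C^∞` partition of unity `(ρ_i)` on `M` with `supp ρ_i ⊆ U_i` for the charts `(U_i, P_i)`
(only the values of `ρ_i` on `M` matter). -/
structure IsPartitionOfUnity (A : TangentAtlas d M m)
    (ρ : Fin m → EuclideanSpace ℝ (Fin D) → ℝ) : Prop where
  nonneg : ∀ i, ∀ x ∈ M, 0 ≤ ρ i x
  sum_eq_one : ∀ x ∈ M, ∑ i, ρ i x = 1
  smooth : ∀ i j, ContDiffOn ℝ ∞ (ρ i ∘ (A.chart j).inv) (A.chart j).target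
  support_subset : ∀ i, closure {x | x ∈ M ∧ ρ i x ≠ 0} ⊆ (A.chart i).dom

/-- For each `i`, all partial derivatives of order at most `s` of `ρ_i ∘ P_i⁻¹` are bounded by
`Λ i` on `P_i(U_i)`. -/
def DerivBound (A : TangentAtlas d M m) (ρ : Fin m → EuclideanSpace ℝ (Fin D) → ℝ) (s : ℕ)
    (Λ : Fin m → ℝ) : Prop :=
  ∀ i, ∀ k ≤ s, ∀ J : Fin k → Fin d, ∀ y ∈ (A.chart i).target,
    |partialDeriv J (ρ i ∘ (A.chart i).inv) y| ≤ Λ i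

end ManifoldReLU

namespace ManifoldReLU

set_option linter.unusedSectionVars false

section Reach

variable {E : Type*} [NormedAddCommGroup E] [InnerProductSpace ℝ E]

/-- Points at distance less than `τ` from `M` have at most one nearest point on `M`. -/
def UniqueNearest (M : Set E) (τ : ℝ) : Prop :=
  ∀ z, Metric.infDist z M < τ → ∀ p ∈ M, ∀ q ∈ M,
    dist p z = Metric.infDist z M → dist q z = Metric.infDist z M → p = q

open Classical in
/-- A nearest point of `M` to `z`, if there is one. -/
noncomputable def nearestPt (M : Set E) (z : E) : E :=
  if h : ∃ p ∈ M, Metric.infDist z M = dist z p then h.choose else 0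

variable {M : Set E} {τ : ℝ}

lemma nearestPt_spec (hM : IsCompact M) (hne : M.Nonempty) (z : E) :
    nearestPt M z ∈ M ∧ Metric.infDist z M = dist z (nearestPt M z) := by
  have h := hM.exists_infDist_eq_dist hne z
  rw [nearestPt, dif_pos h]
  exact h.choose_spec

lemma infDist_eq_norm_sub_nearestPt (hM : IsCompact M) (hne : M.Nonempty) (z : E) :
    Metric.infDist z M = ‖z - nearestPt M z‖ := by
  rw [(nearestPt_spec hM hne z).2, dist_eq_norm]

lemma infDist_le_norm_sub {z p : E} (hp : p ∈ M) : Metric.infDist z M ≤ ‖z - p‖ := by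
  rw [← dist_eq_norm]
  exact Metric.infDist_le_dist_of_mem hp

lemma UniqueNearest.nearestPt_eq (hU : UniqueNearest M τ) (hM : IsCompact M) {z p : E}
    (hp : p ∈ M) (hz : Metric.infDist z M < τ) (h : ‖z - p‖ ≤ Metric.infDist z M) :
    nearestPt M z = p := by
  have hs := nearestPt_spec hM ⟨p, hp⟩ z
  refine hU z hz _ hs.1 p hp (by rw [dist_comm, hs.2]) ?_
  rw [dist_comm, dist_eq_norm]
  exact le_antisymm h (infDist_le_norm_sub hp)

lemma UniqueNearest.continuousAt_nearestPt (hU : UniqueNearest M τ) (hM : IsCompact M)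
    (hne : M.Nonempty) {z : E} (hz : Metric.infDist z M < τ) :
    ContinuousAt (nearestPt M) z := by
  rw [Metric.continuousAt_iff']
  intro ε hε
  set K := M \ Metric.ball (nearestPt M z) ε with hK
  have hKc : IsCompact K := hM.diff Metric.isOpen_ball
  rcases K.eq_empty_or_nonempty with h0 | hKne
  · refine Eventually.of_forall fun y => ?_
    have hy := (nearestPt_spec hM hne y).1
    by_contra hcon
    have : nearestPt M y ∈ K := ⟨hy, hcon⟩
    simp [h0] at this
  · have hlt : Metric.infDist z M < Metric.infDist z K := by
      obtain ⟨k, hk, hke⟩ := hKc.exists_infDist_eq_dist hKne z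
      by_contra hcon
      push Not at hcon
      rw [hke, dist_eq_norm] at hcon
      have := hU.nearestPt_eq hM hk.1 hz hcon
      exact hk.2 (by rw [this]; exact Metric.mem_ball_self hε)
    have hev : ∀ᶠ y in 𝓝 z, Metric.infDist y M < Metric.infDist y K :=
      (Metric.continuous_infDist_pt M).continuousAt.eventually_lt
        (Metric.continuous_infDist_pt K).continuousAt hlt
    filter_upwards [hev] with y hy
    by_contra hcon
    have hs := nearestPt_spec hM hne y
    have : nearestPt M y ∈ K := ⟨hs.1, hcon⟩
    have h2 := Metric.infDist_le_dist_of_mem (x := y) this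
    rw [← hs.2] at h2
    linarith

/-- Moving away from the foot point increases the distance to `M` at unit rate. -/
lemma UniqueNearest.eventually_le_infDist (hU : UniqueNearest M τ) (hM : IsCompact M)
    (hne : M.Nonempty) {z : E} (h0 : 0 < Metric.infDist z M) (hz : Metric.infDist z M < τ)
    {κ : ℝ} (hκ0 : 0 < κ) (hκ : κ < 1) :
    ∀ᶠ t in 𝓝[>] (0 : ℝ), Metric.infDist z M + κ * t ≤
      Metric.infDist (z + t • ((Metric.infDist z M)⁻¹ • (z - nearestPt M z))) M := by
  set δ := Metric.infDist z M with hδ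
  set v := δ⁻¹ • (z - nearestPt M z) with hv
  have hnorm : ‖z - nearestPt M z‖ = δ := (infDist_eq_norm_sub_nearestPt hM hne z).symm
  have hv1 : ‖v‖ = 1 := by
    rw [hv, norm_smul, hnorm, Real.norm_of_nonneg (inv_nonneg.2 h0.le), inv_mul_cancel₀ h0.ne']
  have hin : inner ℝ v (z - nearestPt M z) = δ := by
    rw [hv, real_inner_smul_left, real_inner_self_eq_norm_sq, hnorm]
    field_simp
  have hc : ContinuousAt (fun t : ℝ => inner ℝ v (z - nearestPt M (z + t • v))) 0 := by
    have h1 : ContinuousAt (fun t : ℝ => nearestPt M (z + t • v)) 0 := by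
      refine ContinuousAt.comp (g := nearestPt M) ?_ (by fun_prop)
      simpa using hU.continuousAt_nearestPt hM hne hz
    fun_prop
  have hev : ∀ᶠ t in 𝓝 (0 : ℝ), κ * δ < inner ℝ v (z - nearestPt M (z + t • v)) := by
    refine hc.eventually_const_lt ?_
    simp only [zero_smul, add_zero, hin]
    nlinarith
  filter_upwards [nhdsWithin_le_nhds hev, self_mem_nhdsWithin] with t ht ht0
  have ht0 : 0 < t := ht0
  rw [infDist_eq_norm_sub_nearestPt hM hne (z + t • v)]
  set y := nearestPt M (z + t • v) with hy
  have hyM : y ∈ M := (nearestPt_spec hM hne _).1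
  have h1 : δ ≤ ‖z - y‖ := infDist_le_norm_sub hyM
  have h2 : ‖z + t • v - y‖ ^ 2 = ‖z - y‖ ^ 2 + 2 * (t * inner ℝ v (z - y)) + t ^ 2 := by
    rw [show z + t • v - y = (z - y) + t • v by abel, norm_add_sq_real, real_inner_smul_right,
      norm_smul, hv1, real_inner_comm, mul_one, Real.norm_eq_abs, sq_abs]
  refine (le_abs_self _).trans (abs_le_of_sq_le_sq ?_ (norm_nonneg _))
  rw [h2]
  have h3 : κ ^ 2 ≤ 1 := by nlinarith
  nlinarith [mul_le_mul_of_nonneg_left ht.le ht0.le, mul_nonneg (sq_nonneg t) (sub_nonneg.2 h3)]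

variable [FiniteDimensional ℝ E]

/-- Distance to `M` can be increased by `η` within distance `η`. -/
lemma UniqueNearest.exists_infDist_eq_add (hU : UniqueNearest M τ) (hM : IsCompact M)
    (hne : M.Nonempty) {p : E} {η : ℝ} (hη : 0 < η) (h0 : η < Metric.infDist p M)
    (hp : Metric.infDist p M + η < τ) :
    ∃ q, dist q p ≤ η ∧ Metric.infDist q M = Metric.infDist p M + η := by
  have := FiniteDimensional.proper ℝ E
  have hcb : IsCompact (Metric.closedBall p η) := isCompact_closedBall p η
  have hbne : (Metric.closedBall p η).Nonempty := ⟨p, Metric.mem_closedBall_self hη.le⟩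
  obtain ⟨q, hq, hqmax⟩ := hcb.exists_isMaxOn hbne
    (Metric.continuous_infDist_pt M).continuousOn
  have hlip : ∀ y ∈ Metric.closedBall p η, Metric.infDist y M ≤ Metric.infDist p M + η ∧
      Metric.infDist p M - η ≤ Metric.infDist y M := by
    intro y hy
    have h1 := Metric.infDist_le_infDist_add_dist (s := M) (x := y) (y := p)
    have h2 := Metric.infDist_le_infDist_add_dist (s := M) (x := p) (y := y)
    rw [dist_comm] at h2
    have := Metric.mem_closedBall.1 hy
    constructor <;> linarith
  refine ⟨q, hq, le_antisymm (hlip q hq).1 ?_⟩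
  have key : ∀ κ : ℝ, 0 < κ → κ < 1 → Metric.infDist p M + κ * η ≤ Metric.infDist q M := by
    intro κ hκ0 hκ1
    obtain ⟨y, hy, hymax⟩ := hcb.exists_isMaxOn hbne
      (f := fun y => Metric.infDist y M - κ * dist y p)
      ((Metric.continuous_infDist_pt M).sub
        (continuous_const.mul (continuous_id.dist continuous_const))).continuousOn
    have hyp : Metric.infDist p M ≤ Metric.infDist y M - κ * dist y p := by
      simpa using hymax (Metric.mem_closedBall_self hη.le)
    rcases (Metric.mem_closedBall.1 hy).lt_or_eq with hlt | heq
    · exfalso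
      have hy0 : 0 < Metric.infDist y M := by linarith [(hlip y hy).2]
      have hy1 : Metric.infDist y M < τ := by linarith [(hlip y hy).1]
      set v := (Metric.infDist y M)⁻¹ • (y - nearestPt M y) with hv
      have hv1 : ‖v‖ = 1 := by
        rw [hv, norm_smul, ← infDist_eq_norm_sub_nearestPt hM hne,
          Real.norm_of_nonneg (inv_nonneg.2 hy0.le), inv_mul_cancel₀ hy0.ne']
      have hev := hU.eventually_le_infDist hM hne hy0 hy1 (κ := (1 + κ) / 2) (by linarith)
        (by linarith)
      have hev2 : ∀ᶠ t in 𝓝[>] (0 : ℝ), t < η - dist y p :=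
        nhdsWithin_le_nhds (eventually_lt_nhds (by linarith))
      obtain ⟨t, ht, ht2, ht0⟩ := (hev.and (hev2.and self_mem_nhdsWithin)).exists
      have ht0 : 0 < t := ht0
      have hd : dist (y + t • v) p ≤ dist y p + t := by
        refine (dist_triangle _ y _).trans ?_
        rw [dist_eq_norm, add_sub_cancel_left, norm_smul, hv1, Real.norm_of_nonneg ht0.le]
        linarith
      have hmem : y + t • v ∈ Metric.closedBall p η := Metric.mem_closedBall.2 (by linarith)
      have h1 := hymax hmem
      simp only [mem_ofPred_eq] at h1
      nlinarith
    · have := hqmax hy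
      simp only [mem_ofPred_eq] at this
      rw [heq] at hyp
      linarith
  refine le_of_forall_pos_lt_add fun ε hε => ?_
  have hk := key (1 - min (1 / 2) (ε / (2 * η))) (by linarith [min_le_left (1 / 2 : ℝ) (ε / (2 * η))])
    (by have : 0 < min (1 / 2 : ℝ) (ε / (2 * η)) := by positivity
        linarith)
  have h2 : min (1 / 2 : ℝ) (ε / (2 * η)) * η ≤ ε / 2 := by
    calc _ ≤ ε / (2 * η) * η := by gcongr; exact min_le_right _ _
      _ = ε / 2 := by field_simp
  nlinarith

lemma UniqueNearest.infDist_extend (hU : UniqueNearest M τ) (hM : IsCompact M)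
    {x n : E} (hx : x ∈ M) (hn : ‖n‖ = 1) {t η : ℝ} (hη : 0 < η)
    (hηt : η < t) (htτ : t + η < τ) (ht : Metric.infDist (x + t • n) M = t) :
    Metric.infDist (x + (t + η) • n) M = t + η := by
  obtain ⟨q, hq, hqd⟩ := hU.exists_infDist_eq_add hM ⟨x, hx⟩ (p := x + t • n) hη (by rwa [ht])
    (by rwa [ht])
  rw [ht] at hqd
  have h1 : t + η ≤ ‖q - x‖ := hqd ▸ infDist_le_norm_sub hx
  rw [dist_eq_norm] at hq
  set w := q - (x + t • n) with hw
  have hqx : q - x = w + t • n := by rw [hw]; abel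
  have hin : inner ℝ w n ≤ ‖w‖ := by
    simpa [hn] using real_inner_le_norm w n
  have ht0 : 0 < t := hη.trans hηt
  have h2 : ‖q - x‖ ^ 2 = ‖w‖ ^ 2 + 2 * (t * inner ℝ w n) + t ^ 2 := by
    rw [hqx, norm_add_sq_real, real_inner_smul_right, norm_smul, hn, Real.norm_of_nonneg ht0.le,
      mul_one]
  have hsq : (t + η) ^ 2 ≤ ‖q - x‖ ^ 2 := by gcongr
  have hw2 : ‖w‖ ^ 2 ≤ η ^ 2 := by gcongr
  have hin2 : η ≤ inner ℝ w n := by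
    by_contra hcon
    push Not at hcon
    nlinarith [mul_lt_mul_of_pos_left hcon ht0]
  have hwe : w = η • n := by
    rw [← sub_eq_zero, ← norm_eq_zero, ← sq_eq_zero_iff]
    refine le_antisymm ?_ (sq_nonneg _)
    rw [norm_sub_sq_real, real_inner_smul_right, norm_smul, hn, Real.norm_of_nonneg hη.le]
    nlinarith [mul_le_mul_of_nonneg_left hin2 hη.le]
  have hqe : q = x + (t + η) • n := by
    rw [add_smul, ← hwe, hw]; abel
  rw [← hqe, hqd]

/-- The ball of radius `τ` that touches `M` in the direction of a proximal normal does not meet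
`M`. -/
lemma UniqueNearest.two_mul_inner_le (hU : UniqueNearest M τ) (hM : IsCompact M)
    (hne : M.Nonempty) {z : E} (hz : Metric.infDist z M < τ) {y : E} (hy : y ∈ M) :
    2 * τ * inner ℝ (z - nearestPt M z) (y - nearestPt M z) ≤
      ‖z - nearestPt M z‖ * ‖y - nearestPt M z‖ ^ 2 := by
  set x := nearestPt M z with hxdef
  have hx : x ∈ M := (nearestPt_spec hM hne z).1
  have hnorm : Metric.infDist z M = ‖z - x‖ := infDist_eq_norm_sub_nearestPt hM hne z
  rcases eq_or_ne (z - x) 0 with h0 | h0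
  · simp [h0]
  have hpos : 0 < ‖z - x‖ := norm_pos_iff.2 h0
  set t₀ := ‖z - x‖ with ht₀
  set n := t₀⁻¹ • (z - x) with hn
  have hn1 : ‖n‖ = 1 := by
    rw [hn, norm_smul, ← ht₀, Real.norm_of_nonneg (inv_nonneg.2 hpos.le), inv_mul_cancel₀ hpos.ne']
  have hzx : z - x = t₀ • n := by rw [hn, smul_smul, mul_inv_cancel₀ hpos.ne', one_smul]
  set S := {t ∈ Icc t₀ τ | Metric.infDist (x + t • n) M = t} with hS
  have hcont : Continuous fun t : ℝ => Metric.infDist (x + t • n) M :=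
    (Metric.continuous_infDist_pt M).comp (by fun_prop)
  have hSc : IsCompact S := isCompact_Icc.inter_right (isClosed_eq hcont continuous_id)
  have hSne : S.Nonempty := ⟨t₀, ⟨le_rfl, by linarith⟩, by rw [← hzx, add_sub_cancel, hnorm]⟩
  obtain ⟨T, hT, hTmax⟩ := hSc.exists_isGreatest hSne
  have hTτ : T = τ := by
    by_contra hne'
    have hlt : T < τ := lt_of_le_of_ne hT.1.2 hne'
    have hT0 : 0 < T := hpos.trans_le hT.1.1
    set η := min (T / 2) ((τ - T) / 2) with hη
    have hη0 : 0 < η := lt_min (by linarith) (by linarith)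
    have h1 : η ≤ T / 2 := min_le_left _ _
    have h2 : η ≤ (τ - T) / 2 := min_le_right _ _
    have := hU.infDist_extend hM hx hn1 hη0 (by linarith) (by linarith) hT.2
    have := hTmax ⟨⟨by linarith [hT.1.1], by linarith⟩, this⟩
    linarith
  have hd : τ ≤ ‖x + τ • n - y‖ := by
    have := hT.2
    rw [hTτ] at this
    linarith [infDist_le_norm_sub (z := x + τ • n) hy]
  have hτ : 0 < τ := by linarith
  have hsq : τ ^ 2 ≤ ‖τ • n - (y - x)‖ ^ 2 := by
    rw [show τ • n - (y - x) = x + τ • n - y by abel]; gcongr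
  rw [norm_sub_sq_real, real_inner_smul_left, norm_smul, hn1, Real.norm_of_nonneg hτ.le] at hsq
  rw [hzx, real_inner_smul_left]
  nlinarith

end Reach

section Tangent

variable {E : Type*} [NormedAddCommGroup E] [InnerProductSpace ℝ E] [FiniteDimensional ℝ E]

/-- `T` is the tangent space of `M` at `x`: vectors orthogonal to `T` are normal to `M` to first
order, and `M` is approached to first order in the directions of `T`. -/
structure IsTangentAt (M : Set E) (x : E) (T : Submodule ℝ E) : Prop where
  normal : ∀ n ∈ Tᗮ, ∀ ε > 0, ∀ᶠ y in 𝓝[M] x, |inner ℝ n (y - x)| ≤ ε * ‖y - x‖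
  tangent : ∀ u ∈ T, ∀ ε > 0, ∀ᶠ t in 𝓝[>] (0 : ℝ), Metric.infDist (x + t • u) M ≤ ε * t

variable {M : Set E} {τ : ℝ}

lemma IsTangentAt.two_mul_inner_le (hU : UniqueNearest M τ) (hM : IsCompact M) (hτ : 0 < τ)
    {x : E} {T : Submodule ℝ E} (hT : IsTangentAt M x T) (hx : x ∈ M) {n : E} (hn : n ∈ Tᗮ)
    {y : E} (hy : y ∈ M) :
    2 * τ * inner ℝ n (y - x) ≤ ‖n‖ * ‖y - x‖ ^ 2 := by
  have hne : M.Nonempty := ⟨x, hx⟩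
  have hx0 : Metric.infDist x M = 0 := Metric.infDist_zero_of_mem hx
  have hπx : nearestPt M x = x := hU.nearestPt_eq hM hx (by rwa [hx0]) (by simp [hx0])
  set w : ℝ → E := fun t => nearestPt M (x + t • n) - x with hw
  have hwc : Tendsto w (𝓝[>] 0) (𝓝 0) := by
    have h1 : ContinuousAt (fun t : ℝ => nearestPt M (x + t • n)) 0 := by
      refine ContinuousAt.comp (g := nearestPt M) ?_ (by fun_prop)
      simpa using hU.continuousAt_nearestPt hM hne (z := x) (by rwa [hx0])
    have h2 : ContinuousAt w 0 := h1.sub continuousAt_const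
    have h3 := h2.tendsto
    simp only [hw, zero_smul, add_zero, hπx, sub_self] at h3
    exact h3.mono_left nhdsWithin_le_nhds
  have hu : Tendsto (fun t => t⁻¹ • w t) (𝓝[>] 0) (𝓝 0) := by
    rw [Metric.tendsto_nhds]
    intro ε hε
    have hxy : Tendsto (fun t : ℝ => nearestPt M (x + t • n)) (𝓝[>] 0) (𝓝[M] x) := by
      refine tendsto_nhdsWithin_iff.2 ⟨?_, Eventually.of_forall fun t =>
        (nearestPt_spec hM hne _).1⟩
      have := hwc.add_const x
      simpa [hw] using this
    filter_upwards [hxy.eventually (hT.normal n hn (ε / 4) (by positivity)), self_mem_nhdsWithin]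
      with t ht ht0
    have ht0 : 0 < t := ht0
    have h1 : ‖t • n - w t‖ ≤ ‖t • n‖ := by
      have := infDist_eq_norm_sub_nearestPt hM hne (x + t • n)
      have h2 := infDist_le_norm_sub (z := x + t • n) hx
      rw [this, add_sub_cancel_left] at h2
      convert h2 using 2
      simp only [hw]; abel
    have h2 : ‖w t‖ ^ 2 ≤ 2 * (t * inner ℝ n (w t)) := by
      have h3 : ‖t • n - w t‖ ^ 2 ≤ ‖t • n‖ ^ 2 := by gcongr
      rw [norm_sub_sq_real, real_inner_smul_left] at h3
      linarith
    have h4 : ‖w t‖ ^ 2 ≤ 2 * (t * (ε / 4 * ‖w t‖)) := by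
      refine h2.trans ?_
      gcongr
      exact (le_abs_self _).trans ht
    have h5 : ‖w t‖ ≤ t * (ε / 2) := by
      rcases (norm_nonneg (w t)).eq_or_lt with h0 | h0
      · rw [← h0]; positivity
      · nlinarith
    rw [dist_zero_right, norm_smul, norm_inv, Real.norm_of_nonneg ht0.le, inv_mul_lt_iff₀ ht0]
    nlinarith
  have hlim1 : Tendsto (fun t => 2 * τ * inner ℝ (n - t⁻¹ • w t) (y - x - w t)) (𝓝[>] 0)
      (𝓝 (2 * τ * inner ℝ (n - 0) (y - x - 0))) :=
    ((tendsto_const_nhds.sub hu).inner (tendsto_const_nhds.sub hwc)).const_mul _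
  have hlim2 : Tendsto (fun t => ‖n - t⁻¹ • w t‖ * ‖y - x - w t‖ ^ 2) (𝓝[>] 0)
      (𝓝 (‖n - 0‖ * ‖y - x - 0‖ ^ 2)) :=
    ((tendsto_const_nhds.sub hu).norm).mul (((tendsto_const_nhds.sub hwc).norm).pow 2)
  simp only [sub_zero] at hlim1 hlim2
  refine le_of_tendsto_of_tendsto hlim1 hlim2 ?_
  have hz : ∀ᶠ t in 𝓝[>] (0 : ℝ), Metric.infDist (x + t • n) M < τ := by
    have hc : ContinuousAt (fun t : ℝ => Metric.infDist (x + t • n) M) 0 :=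
      ((Metric.continuous_infDist_pt M).comp (by fun_prop)).continuousAt
    exact nhdsWithin_le_nhds (hc.eventually_lt_const (by simpa [hx0] using hτ))
  filter_upwards [hz, self_mem_nhdsWithin] with t ht ht0
  have ht0 : 0 < t := ht0
  have h := hU.two_mul_inner_le hM hne ht hy
  have e1 : x + t • n - nearestPt M (x + t • n) = t • (n - t⁻¹ • w t) := by
    rw [smul_sub, smul_smul, mul_inv_cancel₀ ht0.ne', one_smul]
    simp only [hw]; abel
  have e2 : y - nearestPt M (x + t • n) = y - x - w t := by simp only [hw]; abel
  rw [e1, e2, real_inner_smul_left, norm_smul, Real.norm_of_nonneg ht0.le] at h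
  have : t * (2 * τ * inner ℝ (n - t⁻¹ • w t) (y - x - w t)) ≤
      t * (‖n - t⁻¹ • w t‖ * ‖y - x - w t‖ ^ 2) := by linarith
  exact le_of_mul_le_mul_left this ht0

lemma IsTangentAt.abs_inner_le (hU : UniqueNearest M τ) (hM : IsCompact M) (hτ : 0 < τ)
    {x : E} {T : Submodule ℝ E} (hT : IsTangentAt M x T) (hx : x ∈ M) {n : E} (hn : n ∈ Tᗮ)
    {y : E} (hy : y ∈ M) :
    2 * τ * |inner ℝ n (y - x)| ≤ ‖n‖ * ‖y - x‖ ^ 2 := by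
  rcases abs_cases (inner ℝ n (y - x)) with ⟨h, _⟩ | ⟨h, _⟩
  · rw [h]; exact hT.two_mul_inner_le hU hM hτ hx hn hy
  · have := hT.two_mul_inner_le hU hM hτ hx (Tᗮ.neg_mem hn) hy
    rwa [inner_neg_left, norm_neg, ← h] at this

/-- First-order optimality: a linear form `⟨w, ·⟩` is orthogonal to the tangent space at `y` if the
points of `M` near `y` do not decrease it to first order. -/
lemma IsTangentAt.mem_orthogonal (hM : IsCompact M) {y : E} {T : Submodule ℝ E}
    (hT : IsTangentAt M y T) (hy : y ∈ M) {w : E} {C : ℝ} {U : Set E} (hUy : U ∈ 𝓝 y)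
    (h : ∀ y' ∈ M, y' ∈ U → -(C * ‖y' - y‖ ^ 2) ≤ inner ℝ w (y' - y)) : w ∈ Tᗮ := by
  have key : ∀ v ∈ T, 0 ≤ inner ℝ w v := by
    intro v hv
    by_contra hcon
    push Not at hcon
    set a := -inner ℝ w v with ha
    have ha0 : 0 < a := by linarith
    set ε := a / (2 * (‖w‖ + 1)) with hε
    have hε0 : 0 < ε := by positivity
    have hεw : ε * ‖w‖ ≤ a / 2 := by
      calc ε * ‖w‖ ≤ ε * (‖w‖ + 1) := by gcongr; linarith
        _ = a / 2 := by rw [hε]; field_simp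
    have hne : M.Nonempty := ⟨y, hy⟩
    obtain ⟨r, hr, hrU⟩ := Metric.mem_nhds_iff.1 hUy
    have hev1 : ∀ᶠ t in 𝓝[>] (0 : ℝ), t * (‖v‖ + ε) < r := by
      have hc : ContinuousAt (fun t : ℝ => t * (‖v‖ + ε)) 0 := by fun_prop
      exact nhdsWithin_le_nhds (hc.eventually_lt_const (by simpa using hr))
    have hev2 : ∀ᶠ t in 𝓝[>] (0 : ℝ), |C| * (t * (‖v‖ + ε) ^ 2) < a / 2 := by
      have hc : ContinuousAt (fun t : ℝ => |C| * (t * (‖v‖ + ε) ^ 2)) 0 := by fun_prop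
      exact nhdsWithin_le_nhds (hc.eventually_lt_const (by simpa using ha0))
    obtain ⟨t, ht, ht1, ht2, ht0⟩ := ((hT.tangent v hv ε hε0).and
      (hev1.and (hev2.and self_mem_nhdsWithin))).exists
    have ht0 : 0 < t := ht0
    have hs := nearestPt_spec hM hne (y + t • v)
    set y' := nearestPt M (y + t • v) with hy'
    rw [infDist_eq_norm_sub_nearestPt hM hne, ← hy'] at ht
    set e := y + t • v - y' with he
    have hyy : y' - y = t • v - e := by rw [he]; abel
    have hn : ‖y' - y‖ ≤ t * (‖v‖ + ε) := by
      rw [hyy]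
      refine (norm_sub_le _ _).trans ?_
      rw [norm_smul, Real.norm_of_nonneg ht0.le]
      linarith
    have h1 := h y' hs.1 (hrU (by rw [Metric.mem_ball, dist_eq_norm]; linarith))
    have h2 : inner ℝ w (y' - y) ≤ -(t * a) + t * (a / 2) := by
      rw [hyy, inner_sub_right, real_inner_smul_right]
      have h3 : |inner ℝ w e| ≤ ‖w‖ * ‖e‖ := abs_real_inner_le_norm w e
      have h4 : ‖w‖ * ‖e‖ ≤ ‖w‖ * (ε * t) := by gcongr
      have := neg_abs_le (inner ℝ w e)
      have h5 : t * (ε * ‖w‖) ≤ t * (a / 2) := by gcongr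
      have h6 : t * inner ℝ w v = -(t * a) := by rw [ha]; ring
      linarith
    have h3 : C * ‖y' - y‖ ^ 2 ≤ t * (|C| * (t * (‖v‖ + ε) ^ 2)) := by
      calc C * ‖y' - y‖ ^ 2 ≤ |C| * (t * (‖v‖ + ε)) ^ 2 := by
            gcongr
            exact le_abs_self C
        _ = _ := by ring
    have h4 : t * (|C| * (t * (‖v‖ + ε) ^ 2)) < t * (a / 2) := by gcongr
    linarith
  rw [Submodule.mem_orthogonal']
  intro v hv
  refine le_antisymm ?_ (key v hv)
  have := key (-v) (T.neg_mem hv)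
  rw [inner_neg_right] at this
  linarith

lemma IsTangentAt.sub_nearestPt_mem_orthogonal (hU : UniqueNearest M τ) (hM : IsCompact M)
    (hne : M.Nonempty) (hτ : 0 < τ) {z : E} (hz : Metric.infDist z M < τ) {T : Submodule ℝ E}
    (hT : IsTangentAt M (nearestPt M z) T) : z - nearestPt M z ∈ Tᗮ := by
  have hx := (nearestPt_spec hM hne z).1
  have : -(z - nearestPt M z) ∈ Tᗮ := by
    refine hT.mem_orthogonal hM hx (C := ‖z - nearestPt M z‖ / (2 * τ)) univ_mem fun y' hy' _ => ?_
    have := hU.two_mul_inner_le hM hne hz hy'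
    rw [inner_neg_left, neg_le_neg_iff, div_mul_eq_mul_div, le_div_iff₀ (by positivity)]
    linarith
  simpa using Tᗮ.neg_mem this

/-- A tangent line stays quadratically close to `M`. -/
lemma IsTangentAt.infDist_le (hU : UniqueNearest M τ) (hM : IsCompact M) (hτ : 0 < τ)
    (htan : ∀ y ∈ M, ∃ T, IsTangentAt M y T) {x u : E} {T : Submodule ℝ E}
    (hT : IsTangentAt M x T) (hx : x ∈ M) (hu : u ∈ T) (hu1 : ‖u‖ = 1) {b : ℝ} (hb0 : 0 < b)
    (hb : b < τ) : Metric.infDist (x + b • u) M ≤ b ^ 2 / (2 * τ) := by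
  have hne : M.Nonempty := ⟨x, hx⟩
  set g : ℝ → ℝ := fun t => Metric.infDist (x + t • u) M with hg
  have hgt : ∀ t, 0 ≤ t → g t ≤ t := fun t ht => by
    have := infDist_le_norm_sub (z := x + t • u) hx
    rwa [add_sub_cancel_left, norm_smul, hu1, Real.norm_of_nonneg ht, mul_one] at this
  have hg0 : ∀ t, 0 ≤ g t := fun t => Metric.infDist_nonneg
  have hgc : Continuous g := (Metric.continuous_infDist_pt M).comp (by fun_prop)
  set c : ℝ → ℝ := fun t => inner ℝ (x + t • u - nearestPt M (x + t • u)) u with hc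
  have hfoot : ∀ t, 0 < t → t < τ →
      2 * (t * c t) * (τ + g t) ≤ g t ^ 3 + g t * t ^ 2 + 2 * τ * g t ^ 2 := by
    intro t ht0 htτ
    have hz : Metric.infDist (x + t • u) M < τ := (hgt t ht0.le).trans_lt htτ
    set y := nearestPt M (x + t • u) with hy
    have hyM : y ∈ M := (nearestPt_spec hM hne _).1
    obtain ⟨T', hT'⟩ := htan y hyM
    have hmem : -(x + t • u - y) ∈ T'ᗮ :=
      T'ᗮ.neg_mem (hT'.sub_nearestPt_mem_orthogonal hU hM hne hτ hz)
    have h1 := hT'.two_mul_inner_le hU hM hτ hyM hmem hx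
    have hgn : ‖x + t • u - y‖ = g t := (infDist_eq_norm_sub_nearestPt hM hne _).symm
    set w := x + t • u - y with hw
    have hxy : x - y = w - t • u := by rw [hw]; abel
    have hcw : inner ℝ w u = c t := rfl
    rw [hxy, norm_neg, hgn, inner_neg_left, inner_sub_right, real_inner_self_eq_norm_sq, hgn,
      real_inner_smul_right, norm_sub_sq_real, real_inner_smul_right, norm_smul, hu1,
      Real.norm_of_nonneg ht0.le, hgn, hcw] at h1
    linarith
  suffices H : ∀ δ > 0, g b ≤ b ^ 2 / (2 * τ) + δ * b by
    refine le_of_forall_pos_le_add fun ε hε => ?_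
    have := H (ε / b) (by positivity)
    rwa [div_mul_cancel₀ _ hb0.ne'] at this
  intro δ hδ
  have hev : ∀ᶠ t in 𝓝[>] (0 : ℝ), t < b := nhdsWithin_le_nhds (eventually_lt_nhds hb0)
  obtain ⟨a, ha, hab, ha0⟩ := ((hT.tangent u hu δ hδ).and
    (hev.and self_mem_nhdsWithin)).exists
  have ha0 : 0 < a := ha0
  have hsq : g b ^ 2 ≤ (b ^ 2 / (2 * τ) + δ * b) ^ 2 := by
    refine image_le_of_liminf_slope_right_lt_deriv_boundary (f := fun t => g t ^ 2)
      (f' := fun t => 2 * c t) (B := fun t => (t ^ 2 / (2 * τ) + δ * t) ^ 2)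
      (B' := fun t => 2 * (t ^ 2 / (2 * τ) + δ * t) * (2 * t / (2 * τ) + δ)) (a := a) (b := b)
      (hgc.pow 2).continuousOn ?_ ?_ ?_ ?_ (right_mem_Icc.2 hab.le)
    · intro t _ r hr
      refine Eventually.frequently ?_
      have hev : ∀ᶠ z in 𝓝[>] t, z < t + (r - 2 * c t) :=
        nhdsWithin_le_nhds (eventually_lt_nhds (by linarith))
      filter_upwards [hev, self_mem_nhdsWithin] with z hz hzt
      have hzt : 0 < z - t := sub_pos.2 hzt
      rw [slope_def_field, div_lt_iff₀ hzt]
      set y := nearestPt M (x + t • u) with hy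
      have h1 : g z ≤ ‖x + z • u - y‖ := infDist_le_norm_sub (nearestPt_spec hM hne _).1
      have h2 : g t = ‖x + t • u - y‖ := infDist_eq_norm_sub_nearestPt hM hne _
      have h3 : ‖x + z • u - y‖ ^ 2 = g t ^ 2 + 2 * ((z - t) * c t) + (z - t) ^ 2 := by
        rw [show x + z • u - y = (x + t • u - y) + (z - t) • u by rw [sub_smul]; abel,
          norm_add_sq_real, real_inner_smul_right, norm_smul, hu1, h2, Real.norm_eq_abs, mul_one,
          sq_abs]
      have h4 : g z ^ 2 ≤ ‖x + z • u - y‖ ^ 2 := by have := hg0 z; gcongr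
      nlinarith
    · have h1 : g a ≤ a ^ 2 / (2 * τ) + δ * a := by
        have : 0 ≤ a ^ 2 / (2 * τ) := by positivity
        exact le_trans ha (by linarith)
      have := hg0 a
      gcongr
    · intro t
      have := ((((hasDerivAt_id t).pow 2).div_const (2 * τ)).add
        ((hasDerivAt_id t).const_mul δ)).pow 2
      convert! this using 1
      simp
    · intro t ht heq
      have ht0 : 0 < t := ha0.trans_le ht.1
      have hpos : 0 < t ^ 2 / (2 * τ) + δ * t := by positivity
      have hge : g t = t ^ 2 / (2 * τ) + δ * t := by
        exact (pow_left_inj₀ (hg0 t) hpos.le two_ne_zero).1 heq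
      have hf := hfoot t ht0 (ht.2.trans hb)
      rw [← hge]
      have hgp : 0 < g t := hge ▸ hpos
      have e1 : δ * t = g t - t ^ 2 / (2 * τ) := by linarith
      have e2 : t * (2 * g t * (2 * t / (2 * τ) + δ)) = 2 * g t ^ 2 + g t * t ^ 2 / τ := by
        have : t * (2 * g t * (2 * t / (2 * τ) + δ)) =
          2 * g t * (t ^ 2 / τ + δ * t) := by field_simp
        rw [this, e1]; field_simp; ring
      have hmul : t * (2 * c t) * (τ + g t) <
          t * (2 * g t * (2 * t / (2 * τ) + δ)) * (τ + g t) := by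
        rw [e2]
        have e3 : (2 * g t ^ 2 + g t * t ^ 2 / τ) * (τ + g t) =
          2 * τ * g t ^ 2 + 2 * g t ^ 3 + g t * t ^ 2 + g t ^ 2 * t ^ 2 / τ := by
          field_simp
          ring
        rw [e3]
        have : 0 < g t ^ 2 * t ^ 2 / τ := by positivity
        have : 0 < g t ^ 3 := by positivity
        linarith
      have h5 := lt_of_mul_lt_mul_right hmul (by linarith)
      exact lt_of_mul_lt_mul_left h5 ht0.le
  have hpos : 0 ≤ b ^ 2 / (2 * τ) + δ * b := by positivity
  exact (le_abs_self _).trans (abs_le_of_sq_le_sq hsq hpos)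

/-- Nearby tangent and normal spaces intersect trivially. -/
lemma IsTangentAt.eq_zero_of_mem_orthogonal (hU : UniqueNearest M τ) (hM : IsCompact M)
    (hτ : 0 < τ) (htan : ∀ y ∈ M, ∃ T, IsTangentAt M y T) {x y : E} {T T' : Submodule ℝ E}
    (hT : IsTangentAt M x T) (hx : x ∈ M) (hT' : IsTangentAt M y T') (hy : y ∈ M)
    (hxy : ‖x - y‖ ≤ τ / 8) {w : E} (hw : w ∈ T) (hw' : w ∈ T'ᗮ) : w = 0 := by
  by_contra hne0
  have hwpos : 0 < ‖w‖ := norm_pos_iff.2 hne0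
  set u := ‖w‖⁻¹ • w with hu
  have hu1 : ‖u‖ = 1 := norm_smul_inv_norm hne0
  have huT : u ∈ T := T.smul_mem _ hw
  have huT' : u ∈ T'ᗮ := T'ᗮ.smul_mem _ hw'
  have hne : M.Nonempty := ⟨x, hx⟩
  have key : ∀ v ∈ T, ‖v‖ = 1 → v ∈ T'ᗮ →
      ∃ p ∈ M, ‖x + (τ / 8) • v - p‖ ≤ τ / 128 ∧ |inner ℝ v (p - y)| ≤ τ / 28 := by
    intro v hv hv1 hv'
    have h1 := hT.infDist_le hU hM hτ htan hx hv hv1 (b := τ / 8) (by linarith) (by linarith)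
    rw [infDist_eq_norm_sub_nearestPt hM hne] at h1
    have hpM := (nearestPt_spec hM hne (x + (τ / 8) • v)).1
    set p := nearestPt M (x + (τ / 8) • v) with hp
    have h2 : (τ / 8) ^ 2 / (2 * τ) = τ / 128 := by field_simp; norm_num
    rw [h2] at h1
    refine ⟨p, hpM, h1, ?_⟩
    have h3 : ‖p - y‖ ≤ τ * (33 / 128) := by
      have : p - y = (x - y) + (τ / 8) • v - (x + (τ / 8) • v - p) := by abel
      rw [this]
      refine (norm_sub_le _ _).trans ?_
      have := norm_add_le (x - y) ((τ / 8) • v)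
      rw [norm_smul, hv1, Real.norm_of_nonneg (by positivity)] at this
      linarith
    have h4 := hT'.abs_inner_le hU hM hτ hy hv' hpM
    rw [hv1, one_mul] at h4
    have h5 : ‖p - y‖ ^ 2 ≤ (τ * (33 / 128)) ^ 2 := by gcongr
    have h6 : τ * |inner ℝ v (p - y)| ≤ τ * (τ / 28) := by nlinarith
    exact le_of_mul_le_mul_left h6 hτ
  obtain ⟨p, -, hp1, hp2⟩ := key u huT hu1 huT'
  obtain ⟨q, -, hq1, hq2⟩ := key (-u) (T.neg_mem huT) (by rwa [norm_neg]) (T'ᗮ.neg_mem huT')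
  rw [inner_neg_left, abs_neg] at hq2
  have h1 : p - y - (q - y) = (2 * (τ / 8)) • u - (x + (τ / 8) • u - p)
      + (x + (τ / 8) • (-u) - q) := by
    rw [two_mul, add_smul, smul_neg]; abel
  have h2 : inner ℝ u (p - y - (q - y)) = 2 * (τ / 8) - inner ℝ u (x + (τ / 8) • u - p)
      + inner ℝ u (x + (τ / 8) • (-u) - q) := by
    rw [h1, inner_add_right, inner_sub_right, real_inner_smul_right, real_inner_self_eq_norm_sq,
      hu1]
    ring
  rw [inner_sub_right] at h2
  have h3 := real_inner_le_norm u (x + (τ / 8) • u - p)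
  have h4 := abs_real_inner_le_norm u (x + (τ / 8) • (-u) - q)
  rw [hu1, one_mul] at h3 h4
  have := abs_le.1 h4
  have := abs_le.1 hp2
  have := abs_le.1 hq2
  linarith

/-- The orthogonal projection of `M ∩ B(x, ρ)` to the tangent space at `x` covers a ball. -/
lemma IsTangentAt.exists_starProjection_eq (hU : UniqueNearest M τ) (hM : IsCompact M)
    (hτ : 0 < τ) (htan : ∀ y ∈ M, ∃ T, IsTangentAt M y T) {x : E} {T : Submodule ℝ E}
    (hT : IsTangentAt M x T) (hx : x ∈ M) {ρ : ℝ} (hρ0 : 0 < ρ) (hρ : ρ ≤ τ / 8) {z : E}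
    (hz : z ∈ T) (hzρ : ‖z‖ ≤ ρ / 4) :
    ∃ y ∈ M, ‖y - x‖ ≤ ρ ∧ T.starProjection (y - x) = z := by
  have := FiniteDimensional.proper ℝ E
  have hKc : IsCompact (M ∩ Metric.closedBall x ρ) := hM.inter_right Metric.isClosed_closedBall
  have hxK : x ∈ M ∩ Metric.closedBall x ρ := ⟨hx, Metric.mem_closedBall_self hρ0.le⟩
  obtain ⟨y, hy, hymin⟩ := hKc.exists_isMinOn ⟨x, hxK⟩
    (f := fun y => ‖T.starProjection (y - x) - z‖) (by fun_prop)
  have hyρ : ‖y - x‖ ≤ ρ := by simpa [dist_eq_norm] using hy.2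
  refine ⟨y, hy.1, hyρ, ?_⟩
  set w := T.starProjection (y - x) - z with hw
  have hwT : w ∈ T := T.sub_mem (T.starProjection_apply_mem _) hz
  have hwz : ‖w‖ ≤ ρ / 4 := by
    have : ‖w‖ ≤ ‖T.starProjection (x - x) - z‖ := hymin hxK
    rw [sub_self, map_zero, zero_sub, norm_neg] at this
    exact this.trans hzρ
  have hn : ‖y - x - T.starProjection (y - x)‖ ≤ ρ / 8 := by
    set n := y - x - T.starProjection (y - x) with hn
    have hnT : n ∈ Tᗮ := T.sub_starProjection_mem_orthogonal (y - x)
    have h1 := hT.two_mul_inner_le hU hM hτ hx hnT hy.1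
    have h2 : inner ℝ n (y - x) = ‖n‖ ^ 2 := by
      have : y - x = n + T.starProjection (y - x) := by rw [hn]; abel
      conv_lhs => rw [this]
      rw [inner_add_right, real_inner_self_eq_norm_sq, real_inner_comm,
        (Submodule.mem_orthogonal T n).1 hnT _ (T.starProjection_apply_mem _), add_zero]
    rw [h2] at h1
    rcases (norm_nonneg n).eq_or_lt with h0 | h0
    · rw [← h0]; positivity
    · have h3 : 2 * τ * ‖n‖ ≤ ‖y - x‖ ^ 2 := by nlinarith
      have h4 : ‖y - x‖ ^ 2 ≤ ρ ^ 2 := by gcongr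
      have h5 : ρ ^ 2 ≤ ρ * (τ / 8) := by nlinarith
      have h6 : τ * (2 * ‖n‖) ≤ τ * (ρ / 8) := by linarith
      have := le_of_mul_le_mul_left h6 hτ
      linarith
  have hlt : ‖y - x‖ < ρ := by
    have : y - x = (y - x - T.starProjection (y - x)) + (w + z) := by rw [hw]; abel
    rw [this]
    refine (norm_add_le _ _).trans_lt ?_
    have := norm_add_le w z
    linarith
  obtain ⟨T', hT'⟩ := htan y hy.1
  have hwT' : w ∈ T'ᗮ := by
    refine hT'.mem_orthogonal hM hy.1 (C := 1 / 2) (U := Metric.ball x ρ)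
      (Metric.isOpen_ball.mem_nhds (by rwa [Metric.mem_ball, dist_eq_norm])) fun y' hy' hyU => ?_
    have h1 : ‖w‖ ≤ ‖T.starProjection (y' - x) - z‖ :=
      hymin ⟨hy', Metric.ball_subset_closedBall hyU⟩
    have h2 : T.starProjection (y' - x) - z = w + T.starProjection (y' - y) := by
      rw [hw, show y' - x = (y' - y) + (y - x) by abel, map_add]; abel
    have h3 : ‖w‖ ^ 2 ≤ ‖w + T.starProjection (y' - y)‖ ^ 2 := by rw [← h2]; gcongr
    have h4 : inner ℝ w (T.starProjection (y' - y)) = inner ℝ w (y' - y) := by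
      rw [← Submodule.inner_starProjection_left_eq_right, Submodule.starProjection_eq_self_iff.2 hwT]
    have h5 : ‖T.starProjection (y' - y)‖ ≤ ‖y' - y‖ := T.norm_starProjection_apply_le _
    have h6 : ‖T.starProjection (y' - y)‖ ^ 2 ≤ ‖y' - y‖ ^ 2 := by gcongr
    rw [norm_add_sq_real, h4] at h3
    linarith
  have := hT.eq_zero_of_mem_orthogonal hU hM hτ htan hx hT' hy.1
    (by rw [norm_sub_rev]; linarith) hwT hwT'
  rwa [hw, sub_eq_zero] at this

end Tangent

lemma uniqueNearest_of_reach {D : ℕ} {M : Set (EuclideanSpace ℝ (Fin D))} {τ : ℝ}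
    (hτ : reach M = ENNReal.ofReal τ) : UniqueNearest M τ := by
  intro z hz p hp q hq hpz hqz
  by_contra hne
  have hmem : z ∈ medialAxis M := ⟨p, hp, q, hq, hne, hpz, hqz⟩
  have h1 : reach M ≤ edist p z := (iInf₂_le p hp).trans (iInf₂_le z hmem)
  rw [hτ, edist_dist, hpz] at h1
  have h0 := Metric.infDist_nonneg (s := M) (x := z)
  rw [ENNReal.ofReal_le_ofReal_iff h0] at h1
  linarith

lemma nonempty_of_reach {D : ℕ} {M : Set (EuclideanSpace ℝ (Fin D))} {τ : ℝ}
    (hτ : reach M = ENNReal.ofReal τ) : M.Nonempty := by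
  by_contra h
  rw [not_nonempty_iff_eq_empty] at h
  subst h
  simp [reach] at hτ

namespace TangentChart

variable {d D : ℕ} {M : Set (EuclideanSpace ℝ (Fin D))} (φ : TangentChart d M)

/-- The linear part of the projection `φ.proj`. -/
noncomputable def projL : EuclideanSpace ℝ (Fin D) →L[ℝ] EuclideanSpace ℝ (Fin d) :=
  LinearMap.toContinuousLinearMap
    { toFun := fun x => WithLp.toLp 2 fun j => inner ℝ (φ.frame j) x
      map_add' := fun x y => by ext j; simp [inner_add_right]
      map_smul' := fun c x => by ext j; simp [inner_smul_right] }

lemma projL_apply (x : EuclideanSpace ℝ (Fin D)) (j : Fin d) :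
    φ.projL x j = inner ℝ (φ.frame j) x := rfl

lemma norm_projL_le (x : EuclideanSpace ℝ (Fin D)) : ‖φ.projL x‖ ≤ ‖x‖ := by
  refine (le_abs_self _).trans (abs_le_of_sq_le_sq ?_ (norm_nonneg _))
  rw [EuclideanSpace.norm_sq_eq]
  simpa [projL_apply] using φ.frame_orthonormal.sum_inner_products_le x (s := Finset.univ)

lemma proj_sub_proj (x y : EuclideanSpace ℝ (Fin D)) :
    φ.proj x - φ.proj y = φ.projL (x - y) := by
  ext j
  simp [proj, projL_apply, inner_sub_right]

lemma norm_proj_sub_proj_le (x y : EuclideanSpace ℝ (Fin D)) :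
    ‖φ.proj x - φ.proj y‖ ≤ ‖x - y‖ := by
  rw [proj_sub_proj]; exact φ.norm_projL_le _

lemma continuous_proj : Continuous φ.proj := by
  have : φ.proj = fun x => φ.projL x + (φ.proj 0) := by
    ext1 x
    have := φ.proj_sub_proj x 0
    rw [sub_zero] at this
    rw [← this]; abel
  rw [this]
  fun_prop

lemma isOpen_target : IsOpen φ.target := φ.image_open

lemma contDiffOn_inv : ContDiffOn ℝ ∞ φ.inv φ.target := φ.inv_smooth

lemma inv_proj {x : EuclideanSpace ℝ (Fin D)} (hx : x ∈ φ.dom) : φ.inv (φ.proj x) = x :=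
  φ.inv_left x hx

lemma proj_mem_target {x : EuclideanSpace ℝ (Fin D)} (hx : x ∈ φ.dom) : φ.proj x ∈ φ.target :=
  mem_image_of_mem _ hx

lemma dom_subset : φ.dom ⊆ M := by
  obtain ⟨O, -, h⟩ := φ.dom_open
  rw [h]; exact inter_subset_left

lemma inv_mem_dom {y : EuclideanSpace ℝ (Fin d)} (hy : y ∈ φ.target) : φ.inv y ∈ φ.dom := by
  obtain ⟨x, hx, rfl⟩ := hy
  rwa [φ.inv_proj hx]

lemma proj_inv {y : EuclideanSpace ℝ (Fin d)} (hy : y ∈ φ.target) : φ.proj (φ.inv y) = y := by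
  obtain ⟨x, hx, rfl⟩ := hy
  rw [φ.inv_proj hx]

lemma hasFDerivAt_inv {y : EuclideanSpace ℝ (Fin d)} (hy : y ∈ φ.target) :
    HasFDerivAt φ.inv (fderiv ℝ φ.inv y) y :=
  ((φ.contDiffOn_inv.contDiffAt (φ.isOpen_target.mem_nhds hy)).differentiableAt
    (by simp)).hasFDerivAt

lemma projL_fderiv_inv {y : EuclideanSpace ℝ (Fin d)} (hy : y ∈ φ.target)
    (v : EuclideanSpace ℝ (Fin d)) : φ.projL (fderiv ℝ φ.inv y v) = v := by
  have h1 : HasFDerivAt (fun z => φ.projL (φ.inv z - φ.inv y))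
      (φ.projL.comp (fderiv ℝ φ.inv y)) y :=
    φ.projL.hasFDerivAt.comp y ((φ.hasFDerivAt_inv hy).sub_const _)
  have h2 : (fun z => φ.projL (φ.inv z - φ.inv y)) =ᶠ[𝓝 y] fun z => z - y := by
    filter_upwards [φ.isOpen_target.mem_nhds hy] with z hz
    rw [← φ.proj_sub_proj, φ.proj_inv hz, φ.proj_inv hy]
  have h3 := (h1.congr_of_eventuallyEq h2.symm).unique ((hasFDerivAt_id y).sub_const y)
  exact congrArg (fun L => L v) h3

/-- The tangent space of `M` at the point with coordinates `y`. -/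
noncomputable def tangentSpace (y : EuclideanSpace ℝ (Fin d)) :
    Submodule ℝ (EuclideanSpace ℝ (Fin D)) :=
  (fderiv ℝ φ.inv y).toLinearMap.range

lemma finrank_tangentSpace {y : EuclideanSpace ℝ (Fin d)} (hy : y ∈ φ.target) :
    Module.finrank ℝ (φ.tangentSpace y) = d := by
  have hinj : Function.Injective (fderiv ℝ φ.inv y).toLinearMap :=
    Function.LeftInverse.injective (g := φ.projL) (φ.projL_fderiv_inv hy)
  rw [tangentSpace, LinearMap.finrank_range_of_inj hinj, finrank_euclideanSpace_fin]

lemma isTangentAt {x : EuclideanSpace ℝ (Fin D)} (hx : x ∈ φ.dom) :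
    IsTangentAt M x (φ.tangentSpace (φ.proj x)) := by
  have hy := φ.proj_mem_target hx
  set L := fderiv ℝ φ.inv (φ.proj x) with hL
  have hlo := hasFDerivAt_iff_isLittleO.1 (φ.hasFDerivAt_inv hy)
  rw [φ.inv_proj hx] at hlo
  constructor
  · intro n hn ε hε
    have h1 := hlo.def (c := ε / (‖n‖ + 1)) (by positivity)
    have h2 : ∀ᶠ y in 𝓝[M] x, y ∈ φ.dom := by
      obtain ⟨O, hO, hdom⟩ := φ.dom_open
      rw [hdom]
      exact inter_mem self_mem_nhdsWithin (nhdsWithin_le_nhds (hO.mem_nhds (hdom ▸ hx).2))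
    have h3 := (φ.continuous_proj.tendsto x).eventually h1
    filter_upwards [h2, nhdsWithin_le_nhds h3] with y hyd h
    rw [φ.inv_proj hyd, φ.proj_sub_proj] at h
    set e := y - x - L (φ.projL (y - x)) with he
    have hin : inner ℝ n (y - x) = inner ℝ n e := by
      have h0 : inner ℝ n (L (φ.projL (y - x))) = 0 :=
        (Submodule.mem_orthogonal' _ n).1 hn _ (LinearMap.mem_range_self _ (φ.projL (y - x)))
      rw [he, inner_sub_right _ (y - x), h0, sub_zero]
    rw [hin]
    calc |inner ℝ n e| ≤ ‖n‖ * ‖e‖ := abs_real_inner_le_norm n e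
      _ ≤ (‖n‖ + 1) * (ε / (‖n‖ + 1) * ‖y - x‖) := by
          gcongr
          · linarith
          · exact h.trans (by gcongr; exact φ.norm_projL_le _)
      _ = ε * ‖y - x‖ := by field_simp
  · rintro u ⟨v, rfl⟩ ε hε
    have h1 := hlo.def (c := ε / (‖v‖ + 1)) (by positivity)
    have hc : ContinuousAt (fun t : ℝ => φ.proj x + t • v) 0 := by fun_prop
    have ht : Tendsto (fun t : ℝ => φ.proj x + t • v) (𝓝 0) (𝓝 (φ.proj x)) := by
      simpa using hc.tendsto
    filter_upwards [nhdsWithin_le_nhds (ht.eventually h1), nhdsWithin_le_nhds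
      (ht.eventually (φ.isOpen_target.mem_nhds hy)), self_mem_nhdsWithin] with t h2 h3 ht0
    have ht0 : 0 < t := ht0
    have hm : φ.inv (φ.proj x + t • v) ∈ M := φ.dom_subset (φ.inv_mem_dom h3)
    refine (infDist_le_norm_sub hm).trans ?_
    rw [add_sub_cancel_left, map_smul, norm_smul, Real.norm_of_nonneg ht0.le] at h2
    rw [norm_sub_rev]
    calc _ = ‖φ.inv (φ.proj x + t • v) - x - t • L v‖ := by congr 1; simp [L]; abel
      _ ≤ ε / (‖v‖ + 1) * (t * ‖v‖) := h2
      _ ≤ ε / (‖v‖ + 1) * (t * (‖v‖ + 1)) := by gcongr; linarith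
      _ = ε * t := by field_simp

/-- Points of `M` close to `x` lie in a chart whose range contains a ball around the image
of `x`. -/
lemma mem_dom_of_norm_sub_le {τ : ℝ} (hU : UniqueNearest M τ) (hM : IsCompact M)
    {x y : EuclideanSpace ℝ (Fin D)} (hx : x ∈ φ.dom) (hy : y ∈ M) {r : ℝ} (hyx : ‖y - x‖ ≤ r)
    (hr : r < τ) (hball : Metric.closedBall (φ.proj x) (2 * r) ⊆ φ.target) : y ∈ φ.dom := by
  have hxM := φ.dom_subset hx
  have hne : M.Nonempty := ⟨x, hxM⟩
  have hz : ∀ z ∈ segment ℝ x y, ‖z - x‖ ≤ r := by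
    intro z hz
    rw [segment_eq_image'] at hz
    obtain ⟨t, ht, rfl⟩ := hz
    simp only [add_sub_cancel_left, norm_smul, Real.norm_of_nonneg ht.1]
    nlinarith [norm_nonneg (y - x), ht.2]
  have hzτ : ∀ z ∈ segment ℝ x y, Metric.infDist z M < τ := fun z hzs =>
    ((infDist_le_norm_sub hxM).trans (hz z hzs)).trans_lt hr
  set S := nearestPt M '' segment ℝ x y with hS
  have hSpre : IsPreconnected S :=
    (convex_segment x y).isPreconnected.image _ fun z hzs =>
      (hU.continuousAt_nearestPt hM hne (hzτ z hzs)).continuousWithinAt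
  have hSM : ∀ p ∈ S, p ∈ M := by
    rintro p ⟨z, -, rfl⟩
    exact (nearestPt_spec hM hne z).1
  have hSr : ∀ p ∈ S, ‖p - x‖ ≤ 2 * r := by
    rintro p ⟨z, hzs, rfl⟩
    have h1 := infDist_le_norm_sub (z := z) hxM
    rw [infDist_eq_norm_sub_nearestPt hM hne z, norm_sub_rev] at h1
    have h2 := hz z hzs
    calc _ = ‖(nearestPt M z - z) + (z - x)‖ := by congr 1; abel
      _ ≤ _ := norm_add_le _ _
      _ ≤ 2 * r := by linarith
  have hfix : ∀ p ∈ M, Metric.infDist p M < τ → nearestPt M p = p := fun p hp h =>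
    hU.nearestPt_eq hM hp h (by simp [Metric.infDist_zero_of_mem hp])
  have hxS : x ∈ S := ⟨x, left_mem_segment ℝ x y, hfix x hxM (hzτ x (left_mem_segment ℝ x y))⟩
  have hyS : y ∈ S := ⟨y, right_mem_segment ℝ x y, hfix y hy (hzτ y (right_mem_segment ℝ x y))⟩
  obtain ⟨O, hO, hdom⟩ := φ.dom_open
  set K := φ.inv '' Metric.closedBall (φ.proj x) (2 * r) with hK
  have hKc : IsCompact K :=
    (isCompact_closedBall _ _).image_of_continuousOn (φ.contDiffOn_inv.continuousOn.mono hball)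
  have hKd : K ⊆ φ.dom := by
    rintro _ ⟨z, hz, rfl⟩
    exact φ.inv_mem_dom (hball hz)
  have hSO : ∀ p ∈ S, p ∈ O → p ∈ K := by
    intro p hp hpO
    have hpd : p ∈ φ.dom := hdom ▸ ⟨hSM p hp, hpO⟩
    refine ⟨φ.proj p, ?_, φ.inv_proj hpd⟩
    rw [Metric.mem_closedBall, dist_eq_norm]
    exact (φ.norm_proj_sub_proj_le p x).trans (hSr p hp)
  by_contra hyd
  obtain ⟨p, hp, hpO, hpK⟩ := hSpre O Kᶜ hO hKc.isClosed.isOpen_compl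
    (fun p hp => by
      by_cases h : p ∈ O
      · exact Or.inl h
      · exact Or.inr fun hpK => h (hdom ▸ hKd hpK).2)
    ⟨x, hxS, (hdom ▸ hx).2⟩ ⟨y, hyS, fun h => hyd (hKd h)⟩
  exact hpK (hSO p hp hpO)

end TangentChart

section Measure

variable {d D m : ℕ} {M : Set (EuclideanSpace ℝ (Fin D))}

lemma euclideanHausdorffMeasure_image_le {X Y : Type*} [MetricSpace X] [MeasurableSpace X]
    [BorelSpace X] [MetricSpace Y] [MeasurableSpace Y] [BorelSpace Y] {K : NNReal} {f : X → Y}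
    {s : Set X} (hf : LipschitzOnWith K f s) (d : ℕ) :
    μHE[d] (f '' s) ≤ (K : ENNReal) ^ (d : ℝ) * μHE[d] s := by
  simp only [Measure.euclideanHausdorffMeasure_def, Measure.smul_apply, ENNReal.smul_def,
    smul_eq_mul]
  rw [mul_left_comm]
  gcongr
  exact hf.hausdorffMeasure_image_le (by positivity)

lemma TangentAtlas.exists_isTangentAt (A : TangentAtlas d M m) {x : EuclideanSpace ℝ (Fin D)}
    (hx : x ∈ M) : ∃ T, IsTangentAt M x T ∧ Module.finrank ℝ T = d := by
  obtain ⟨i, hi⟩ := mem_iUnion.1 (A.cover hx)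
  exact ⟨_, (A.chart i).isTangentAt hi,
    (A.chart i).finrank_tangentSpace ((A.chart i).proj_mem_target hi)⟩

lemma TangentAtlas.volume_ball_le (A : TangentAtlas d M m) {τ : ℝ} (hU : UniqueNearest M τ)
    (hM : IsCompact M) (hτ : 0 < τ) {x : EuclideanSpace ℝ (Fin D)} (hx : x ∈ M) {ρ : ℝ}
    (hρ0 : 0 < ρ) (hρ : ρ ≤ τ / 8) :
    volume (Metric.closedBall (0 : EuclideanSpace ℝ (Fin d)) (ρ / 4)) ≤
      μHE[d] (M ∩ Metric.closedBall x ρ) := by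
  obtain ⟨T, hT, hfin⟩ := A.exists_isTangentAt hx
  have htan : ∀ y ∈ M, ∃ T, IsTangentAt M y T := fun y hy =>
    let ⟨T, hT, _⟩ := A.exists_isTangentAt hy; ⟨T, hT⟩
  let e : T ≃ₗᵢ[ℝ] EuclideanSpace ℝ (Fin d) :=
    (stdOrthonormalBasis ℝ T).repr.trans
      (LinearIsometryEquiv.piLpCongrLeft 2 ℝ ℝ (finCongr hfin))
  set f : EuclideanSpace ℝ (Fin D) → EuclideanSpace ℝ (Fin d) :=
    fun y => e (T.orthogonalProjectionOnto (y - x)) with hf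
  have hlip : LipschitzOnWith 1 f (M ∩ Metric.closedBall x ρ) := by
    refine LipschitzWith.lipschitzOnWith (LipschitzWith.of_dist_le_mul fun y z => ?_)
    simp only [hf]
    rw [LinearIsometryEquiv.dist_map, dist_eq_norm, ← map_sub, dist_eq_norm, NNReal.coe_one,
      one_mul, sub_sub_sub_cancel_right]
    exact T.norm_orthogonalProjectionOnto_apply_le _
  have hsub : Metric.closedBall (0 : EuclideanSpace ℝ (Fin d)) (ρ / 4) ⊆
      f '' (M ∩ Metric.closedBall x ρ) := by
    intro z hz
    have hz' : ‖(e.symm z : EuclideanSpace ℝ (Fin D))‖ ≤ ρ / 4 := by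
      have : ‖e.symm z‖ ≤ ρ / 4 := by
        rw [e.symm.norm_map]
        simpa using hz
      exact this
    obtain ⟨y, hyM, hy, hyz⟩ := hT.exists_starProjection_eq hU hM hτ htan hx hρ0 hρ
      (e.symm z).2 hz'
    refine ⟨y, ⟨hyM, by rwa [Metric.mem_closedBall, dist_eq_norm]⟩, ?_⟩
    have : T.orthogonalProjectionOnto (y - x) = e.symm z := Subtype.ext hyz
    simp only [hf, this, e.apply_symm_apply]
  calc _ ≤ volume (f '' (M ∩ Metric.closedBall x ρ)) := measure_mono hsub
    _ = μHE[d] (f '' (M ∩ Metric.closedBall x ρ)) := by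
        rw [EuclideanSpace.euclideanHausdorffMeasure_eq_volume]
    _ ≤ _ := by
        refine (euclideanHausdorffMeasure_image_le hlip d).trans ?_
        simp

lemma TangentAtlas.euclideanHausdorffMeasure_ne_top (A : TangentAtlas d M m) (hM : IsCompact M) :
    μHE[d] M ≠ ⊤ := by
  refine ne_of_lt (hM.measure_lt_top_of_nhdsWithin fun x hx => ?_)
  obtain ⟨i, hi⟩ := mem_iUnion.1 (A.cover hx)
  set φ := A.chart i
  have hy := φ.proj_mem_target hi
  obtain ⟨K, t, ht, hlip⟩ := ((φ.contDiffOn_inv.contDiffAt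
    (φ.isOpen_target.mem_nhds hy)).of_le (m := 1) (by simp)).exists_lipschitzOnWith
  obtain ⟨R, hR, hRt⟩ := Metric.mem_nhds_iff.1 (inter_mem ht (φ.isOpen_target.mem_nhds hy))
  refine ⟨φ.inv '' Metric.ball (φ.proj x) R, ?_, ?_⟩
  · obtain ⟨O, hO, hdom⟩ := φ.dom_open
    have h1 : ∀ᶠ y in 𝓝[M] x, y ∈ φ.dom := by
      rw [hdom]
      exact inter_mem self_mem_nhdsWithin (nhdsWithin_le_nhds (hO.mem_nhds (hdom ▸ hi).2))
    have h2 := (φ.continuous_proj.tendsto x).eventually (Metric.ball_mem_nhds _ hR)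
    filter_upwards [h1, nhdsWithin_le_nhds h2] with y hyd hyb
    exact ⟨φ.proj y, hyb, φ.inv_proj hyd⟩
  · refine (euclideanHausdorffMeasure_image_le
      (hlip.mono fun z hz => (hRt hz).1) d).trans_lt ?_
    rw [EuclideanSpace.euclideanHausdorffMeasure_eq_volume]
    exact ENNReal.mul_lt_top (by simp) measure_ball_lt_top

end Measure

section Cover

variable {d D m : ℕ} {M : Set (EuclideanSpace ℝ (Fin D))}

lemma norm_le_of_abs_apply_single_le {L : EuclideanSpace ℝ (Fin d) →L[ℝ] ℝ} {C : ℝ}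
    (hC : 0 ≤ C) (h : ∀ j, |L (EuclideanSpace.single j 1)| ≤ C) : ‖L‖ ≤ C * d := by
  refine L.opNorm_le_bound (by positivity) fun v => ?_
  have hv : v = ∑ j, v j • EuclideanSpace.single j (1 : ℝ) := by
    have := (EuclideanSpace.basisFun (Fin d) ℝ).sum_repr v
    simpa using this.symm
  calc ‖L v‖ = ‖∑ j, v j * L (EuclideanSpace.single j 1)‖ := by
        conv_lhs => rw [hv]
        simp
    _ ≤ ∑ j, ‖v j * L (EuclideanSpace.single j 1)‖ := norm_sum_le _ _
    _ ≤ ∑ _j : Fin d, ‖v‖ * C := by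
        refine Finset.sum_le_sum fun j _ => ?_
        rw [norm_mul]
        gcongr
        · exact PiLp.norm_apply_le v j
        · exact h j
    _ = C * d * ‖v‖ := by simp; ring

lemma partialDeriv_one (g : EuclideanSpace ℝ (Fin d) → ℝ) (y : EuclideanSpace ℝ (Fin d))
    (j : Fin d) :
    partialDeriv (fun _ : Fin 1 => j) g y = fderiv ℝ g y (EuclideanSpace.single j 1) := by
  simp [partialDeriv, iteratedFDeriv_one_apply]

/-- Around every point of `M` some chart has a range of controlled size. -/
lemma TangentAtlas.exists_ball_subset_target (A : TangentAtlas d M m) (hM : IsCompact M)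
    {ρ : Fin m → EuclideanSpace ℝ (Fin D) → ℝ} (hρ : IsPartitionOfUnity A ρ) {s : ℕ} (hs : 1 ≤ s)
    {Λ : Fin m → ℝ} (hΛ : DerivBound A ρ s Λ) {x : EuclideanSpace ℝ (Fin D)}
    (hx : x ∈ M) (hd : 1 ≤ d) :
    0 < ∑ i, Λ i ∧ ∃ i, x ∈ (A.chart i).dom ∧
      Metric.ball ((A.chart i).proj x) (1 / ((∑ i, Λ i) * d)) ⊆ (A.chart i).target := by
  have hΛ0 : ∀ i, 0 ≤ Λ i := fun i => (abs_nonneg _).trans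
    (hΛ i 0 (Nat.zero_le _) (fun l => l.elim0) _ ((A.chart i).proj_mem_target
      (A.chart i).center_mem))
  have hsupp : ∀ i, 0 < ρ i x → x ∈ (A.chart i).dom := fun i hi =>
    hρ.support_subset i (subset_closure ⟨hx, hi.ne'⟩)
  have hΛpos : ∀ i, 0 < ρ i x → 0 < Λ i := fun i hi => by
    have h := hΛ i 0 (Nat.zero_le _) (fun l => l.elim0) _
      ((A.chart i).proj_mem_target (hsupp i hi))
    rw [partialDeriv, iteratedFDeriv_zero_apply, Function.comp, (A.chart i).inv_proj (hsupp i hi)]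
      at h
    exact hi.trans_le ((le_abs_self _).trans h)
  have hex : ∃ i, 0 < ρ i x := by
    by_contra hcon
    push Not at hcon
    have := Finset.sum_nonpos fun i (_ : i ∈ Finset.univ) => hcon i
    rw [hρ.sum_eq_one x hx] at this
    linarith
  have hS : 0 < ∑ i, Λ i := by
    obtain ⟨i, hi⟩ := hex
    exact Finset.sum_pos' (fun i _ => hΛ0 i) ⟨i, Finset.mem_univ i, hΛpos i hi⟩
  refine ⟨hS, ?_⟩
  obtain ⟨i, hi, hge⟩ : ∃ i, 0 < ρ i x ∧ Λ i / (∑ i, Λ i) ≤ ρ i x := by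
    by_contra hcon
    push Not at hcon
    have h1 : ∑ i, ρ i x < ∑ i, Λ i / (∑ i, Λ i) := by
      obtain ⟨i₀, hi₀⟩ := hex
      refine Finset.sum_lt_sum (fun i _ => ?_) ⟨i₀, Finset.mem_univ _, hcon i₀ hi₀⟩
      rcases (hρ.nonneg i x hx).eq_or_lt with h | h
      · rw [← h]; exact div_nonneg (hΛ0 i) hS.le
      · exact (hcon i h).le
    rw [hρ.sum_eq_one x hx, ← Finset.sum_div, div_self hS.ne'] at h1
    exact lt_irrefl _ h1
  have hxd := hsupp i hi
  refine ⟨i, hxd, ?_⟩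
  set φ := A.chart i with hφ
  set g : EuclideanSpace ℝ (Fin d) → ℝ := ρ i ∘ φ.inv with hg
  set σ : EuclideanSpace ℝ (Fin d) → ℝ := φ.target.indicator g with hσ
  set K := φ.proj '' closure {x | x ∈ M ∧ ρ i x ≠ 0} with hK
  have hKc : IsCompact K := by
    refine (hM.of_isClosed_subset isClosed_closure ?_).image φ.continuous_proj
    exact (hρ.support_subset i).trans φ.dom_subset
  have hKt : K ⊆ φ.target := image_mono (hρ.support_subset i)
  have hσ0 : ∀ z ∉ K, σ z = 0 := by
    intro z hz
    by_contra hne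
    have hzt : z ∈ φ.target := mem_of_indicator_ne_zero hne
    rw [hσ, indicator_of_mem hzt] at hne
    exact hz ⟨φ.inv z, subset_closure ⟨φ.dom_subset (φ.inv_mem_dom hzt), hne⟩, φ.proj_inv hzt⟩
  have hderiv : ∀ z, DifferentiableAt ℝ σ z ∧ ‖fderiv ℝ σ z‖ ≤ Λ i * d := by
    intro z
    by_cases hz : z ∈ φ.target
    · have heq : σ =ᶠ[𝓝 z] g := by
        filter_upwards [φ.isOpen_target.mem_nhds hz] with w hw
        rw [hσ, indicator_of_mem hw]
      have hdiff : DifferentiableAt ℝ g z :=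
        ((hρ.smooth i i).contDiffAt (φ.isOpen_target.mem_nhds hz)).differentiableAt (by simp)
      refine ⟨hdiff.congr_of_eventuallyEq heq, ?_⟩
      rw [heq.fderiv_eq]
      refine norm_le_of_abs_apply_single_le (hΛ0 i) fun j => ?_
      rw [← partialDeriv_one]
      exact hΛ i 1 hs _ z hz
    · have heq : σ =ᶠ[𝓝 z] fun _ => 0 := by
        filter_upwards [hKc.isClosed.isOpen_compl.mem_nhds fun h => hz (hKt h)] with w hw
        exact hσ0 w hw
      refine ⟨(differentiableAt_const 0).congr_of_eventuallyEq heq, ?_⟩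
      rw [heq.fderiv_eq]
      simpa using mul_nonneg (hΛ0 i) (Nat.cast_nonneg d)
  intro y hy
  have hlip := convex_univ.norm_image_sub_le_of_norm_fderiv_le (𝕜 := ℝ)
    (fun z _ => (hderiv z).1) (fun z _ => (hderiv z).2) (mem_univ (φ.proj x)) (mem_univ y)
  have hσx : σ (φ.proj x) = ρ i x := by
    rw [hσ, indicator_of_mem (φ.proj_mem_target hxd), hg, Function.comp, φ.inv_proj hxd]
  by_contra hyt
  have hσy : σ y = 0 := indicator_of_notMem hyt _
  rw [hσx, hσy, zero_sub, norm_neg, Real.norm_of_nonneg hi.le] at hlip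
  rw [Metric.mem_ball, dist_eq_norm] at hy
  have hd0 : (0 : ℝ) < d := by exact_mod_cast hd
  have hLd : 0 < Λ i * d := mul_pos (hΛpos i hi) hd0
  have h1 : Λ i * d * ‖y - φ.proj x‖ < Λ i * d * (1 / ((∑ i, Λ i) * d)) := by gcongr
  have h2 : Λ i * d * (1 / ((∑ i, Λ i) * d)) = Λ i / ∑ i, Λ i := by field_simp
  linarith

/-- A bound for the size of separated subsets gives a covering by as many balls. -/
lemma exists_cover_of_card_le {E : Type*} [PseudoMetricSpace E] {M : Set E} (hne : M.Nonempty)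
    {r : ℝ} (hr : 0 ≤ r) {N : ℕ}
    (h : ∀ P : Finset E, ↑P ⊆ M → (∀ p ∈ P, ∀ q ∈ P, p ≠ q → r < dist p q) → P.card ≤ N) :
    ∃ c : Fin N → E, (∀ k, c k ∈ M) ∧ ∀ x ∈ M, ∃ k, dist x (c k) ≤ r := by
  classical
  set Q : ℕ → Prop := fun n => ∃ P : Finset E, ↑P ⊆ M ∧
    (∀ p ∈ P, ∀ q ∈ P, p ≠ q → r < dist p q) ∧ P.card = n with hQ
  have hQ0 : Q 0 := ⟨∅, by simp, by simp, rfl⟩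
  obtain ⟨P, hPM, hPsep, hPc⟩ := Nat.findGreatest_spec (P := Q) (Nat.zero_le N) hQ0
  have hcov : ∀ x ∈ M, ∃ p ∈ P, dist x p ≤ r := by
    intro x hx
    by_contra hcon
    push Not at hcon
    have hxP : x ∉ P := fun hxP => by
      have := hcon x hxP
      rw [dist_self] at this
      linarith
    have hQ' : Q (P.card + 1) := by
      refine ⟨insert x P, ?_, ?_, Finset.card_insert_of_notMem hxP⟩
      · rw [Finset.coe_insert, insert_subset_iff]
        exact ⟨hx, hPM⟩
      · intro p hp q hq hpq
        rcases Finset.mem_insert.1 hp with rfl | hp <;> rcases Finset.mem_insert.1 hq with rfl | hq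
        · exact absurd rfl hpq
        · exact hcon q hq
        · rw [dist_comm]; exact hcon p (by assumption)
        · exact hPsep p hp q hq hpq
    obtain ⟨R, hR1, hR2, hR3⟩ := hQ'
    have hle : P.card + 1 ≤ N := hR3 ▸ h R hR1 hR2
    have := Nat.le_findGreatest (P := Q) hle ⟨R, hR1, hR2, hR3⟩
    omega
  have hPN : P.card ≤ N := hPc ▸ Nat.findGreatest_le N
  obtain ⟨x₀, hx₀⟩ := hne
  obtain ⟨p₀, hp₀, -⟩ := hcov x₀ hx₀
  refine ⟨fun k => if hk : (k : ℕ) < P.card then P.equivFin.symm ⟨k, hk⟩ else p₀, ?_, ?_⟩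
  · intro k
    dsimp only
    split_ifs with hk
    · exact hPM (P.equivFin.symm ⟨k, hk⟩).2
    · exact hPM hp₀
  · intro x hx
    obtain ⟨p, hp, hpx⟩ := hcov x hx
    have hlt := (P.equivFin ⟨p, hp⟩).2
    refine ⟨⟨P.equivFin ⟨p, hp⟩, hlt.trans_le hPN⟩, ?_⟩
    simpa [hlt] using hpx

lemma TangentAtlas.card_mul_volume_le (A : TangentAtlas d M m) {τ : ℝ}
    (hU : UniqueNearest M τ) (hM : IsCompact M) (hτ : 0 < τ) {ρ : ℝ} (hρ0 : 0 < ρ)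
    (hρ : ρ ≤ τ / 8) {P : Finset (EuclideanSpace ℝ (Fin D))} (hP : ↑P ⊆ M)
    (hsep : ∀ p ∈ P, ∀ q ∈ P, p ≠ q → 2 * ρ < dist p q) :
    P.card * (volume (Metric.closedBall (0 : EuclideanSpace ℝ (Fin d)) (ρ / 4))).toReal ≤
      surfaceArea d M := by
  have hdisj : (P : Set (EuclideanSpace ℝ (Fin D))).PairwiseDisjoint
      fun p => M ∩ Metric.closedBall p ρ := by
    intro p hp q hq hpq
    refine Disjoint.mono inter_subset_right inter_subset_right
      (Metric.closedBall_disjoint_closedBall ?_)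
    have := hsep p hp q hq hpq
    linarith
  have h1 : ∑ p ∈ P, μHE[d] (M ∩ Metric.closedBall p ρ) ≤ μHE[d] M := by
    rw [← measure_biUnion_finset hdisj fun p _ =>
      (hM.isClosed.inter Metric.isClosed_closedBall).measurableSet]
    exact measure_mono (iUnion₂_subset fun p _ => inter_subset_left)
  have h2 : P.card * volume (Metric.closedBall (0 : EuclideanSpace ℝ (Fin d)) (ρ / 4)) ≤
      μHE[d] M := by
    refine le_trans ?_ h1
    rw [← nsmul_eq_mul]
    exact Finset.card_nsmul_le_sum _ _ _ fun p hp => A.volume_ball_le hU hM hτ (hP hp) hρ0 hρ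
  have h3 := ENNReal.toReal_mono (A.euclideanHausdorffMeasure_ne_top hM) h2
  simpa [surfaceArea] using h3

/-- Centres of balls of a controlled size and number that cover `M` and lie well inside charts. -/
structure GoodCover (A : TangentAtlas d M m) (N : ℕ) (r δ : ℝ) where
  pt : Fin N → EuclideanSpace ℝ (Fin D)
  idx : Fin N → Fin m
  pt_mem : ∀ k, pt k ∈ M
  cover : ∀ x ∈ M, ∃ k, ‖x - pt k‖ ≤ r / 2
  ball_subset : ∀ k, Metric.ball ((A.chart (idx k)).proj (pt k)) δ ⊆ (A.chart (idx k)).target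
  mem_dom : ∀ k, ∀ x ∈ M, ‖x - pt k‖ ≤ r → x ∈ (A.chart (idx k)).dom

theorem exists_goodCover (d : ℕ) (hd : 1 ≤ d) (τ S Λ₀ : ℝ) (hτ : 0 < τ) :
    ∃ (N a : ℕ) (δ : ℝ), 0 < δ ∧ 4 * (1 / 2 : ℝ) ^ a ≤ δ ∧
      ∀ (D m : ℕ) (M : Set (EuclideanSpace ℝ (Fin D))) (A : TangentAtlas d M m)
        (ρ : Fin m → EuclideanSpace ℝ (Fin D) → ℝ) (s : ℕ) (Λ : Fin m → ℝ),
        IsCompact M → reach M = ENNReal.ofReal τ → IsPartitionOfUnity A ρ → 1 ≤ s →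
        DerivBound A ρ s Λ → surfaceArea d M = S → ∑ i, Λ i = Λ₀ →
        Nonempty (GoodCover A N ((1 / 2 : ℝ) ^ a) δ) := by
  rcases le_or_gt Λ₀ 0 with hΛ₀ | hΛ₀
  · refine ⟨0, 2, 1, one_pos, by norm_num, ?_⟩
    intro D m M A ρ s Λ hM hr hρ hs hΛ _ hsum
    obtain ⟨x, hx⟩ := nonempty_of_reach hr
    have := (A.exists_ball_subset_target hM hρ hs hΛ hx hd).1
    linarith
  have hd0 : (0 : ℝ) < d := by exact_mod_cast hd
  set δ : ℝ := 1 / (Λ₀ * d) with hδ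
  have hδ0 : 0 < δ := by positivity
  obtain ⟨a, ha⟩ := exists_pow_lt_of_lt_one (show (0 : ℝ) < min (δ / 4) (τ / 8) by positivity)
    (show (1 / 2 : ℝ) < 1 by norm_num)
  set r : ℝ := (1 / 2 : ℝ) ^ a with hr
  have hr0 : 0 < r := by positivity
  have hrδ : r < δ / 4 := ha.trans_le (min_le_left _ _)
  have hrτ : r < τ / 8 := ha.trans_le (min_le_right _ _)
  set v := (volume (Metric.closedBall (0 : EuclideanSpace ℝ (Fin d)) (r / 4 / 4))).toReal with hv
  have hv0 : 0 < v := ENNReal.toReal_pos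
    (Metric.measure_closedBall_pos _ _ (by positivity)).ne' measure_closedBall_lt_top.ne
  refine ⟨⌊S / v⌋₊, a, δ, hδ0, by linarith, ?_⟩
  intro D m M A ρ s Λ hM hreach hρ hs hΛ hS hsum
  have hU := uniqueNearest_of_reach hreach
  obtain ⟨c, hcM, hcov⟩ := exists_cover_of_card_le (nonempty_of_reach hreach) (r := r / 2)
    (by positivity)
    (N := ⌊S / v⌋₊) fun P hP hsep => by
      refine Nat.le_floor ?_
      rw [le_div_iff₀ hv0, ← hS]
      exact A.card_mul_volume_le hU hM hτ (by positivity) (by linarith) hP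
        fun p hp q hq hpq => by linarith [hsep p hp q hq hpq]
  have hch : ∀ k, ∃ i, c k ∈ (A.chart i).dom ∧
      Metric.ball ((A.chart i).proj (c k)) δ ⊆ (A.chart i).target := fun k => by
    have := (A.exists_ball_subset_target hM hρ hs hΛ (hcM k) hd).2
    rwa [hsum] at this
  choose i hid hib using hch
  exact ⟨{
    pt := c
    idx := i
    pt_mem := hcM
    cover := fun x hx => by simpa only [dist_eq_norm] using hcov x hx
    ball_subset := hib
    mem_dom := fun k x hx hxk => (A.chart (i k)).mem_dom_of_norm_sub_le hU hM (hid k) hx hxk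
      (by linarith) ((Metric.closedBall_subset_ball (by linarith)).trans (hib k)) }⟩

end Cover

section Chains

variable {X : Type*} {c : ℝ}

/-- `h` is a neuron applied to the family `G`, with at most `k - 1` nonzero weights. -/
def Neuron (c : ℝ) (k : ℕ) {ι : Type} [Fintype ι] (G : ι → X → ℝ) (h : X → ℝ) : Prop :=
  ∃ (w : ι → ℝ) (b : ℝ), (∀ j, |w j| ≤ c) ∧ |b| ≤ c ∧ {j | w j ≠ 0}.ncard + 1 ≤ k ∧
    ∀ x, h x = max 0 (∑ j, w j * G j x + b)

/-- The family `H` is a layer of neurons applied to the family `G`, of total cost at most `w`. -/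
def Step (c : ℝ) (w : ℕ) {ι κ : Type} [Fintype ι] [Fintype κ] (G : ι → X → ℝ) (H : κ → X → ℝ) :
    Prop :=
  ∃ k : κ → ℕ, ∑ i, k i ≤ w ∧ ∀ i, Neuron c (k i) G (H i)

/-- The family `H` is obtained from `G` by `L + 1` layers, each of cost at most `w`. -/
def Chain (c : ℝ) (w : ℕ) : ℕ → ∀ {ι κ : Type} [Fintype ι] [Fintype κ],
    (ι → X → ℝ) → (κ → X → ℝ) → Prop
  | 0, _, _, _, _, G, H => Step c w G H
  | L + 1, _, _, _, _, G, H => ∃ (μ : Type) (_ : Fintype μ) (F : μ → X → ℝ),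
      Step c w G F ∧ Chain c w L F H

variable {ι κ μ : Type} [Fintype ι] [Fintype κ] [Fintype μ]
  {G : ι → X → ℝ} {H : κ → X → ℝ} {F : μ → X → ℝ}

lemma Neuron.embed {k : ℕ} {h : X → ℝ} (hn : Neuron c k G h) (hc : 0 ≤ c) {G' : κ → X → ℝ}
    {e : ι → κ} (he : Function.Injective e) (hG : ∀ j x, G' (e j) x = G j x) :
    Neuron c k G' h := by
  obtain ⟨w, b, hw, hb, hk, hh⟩ := hn
  refine ⟨Function.extend e w 0, b, fun i => ?_, hb, ?_, fun x => ?_⟩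
  · by_cases hi : ∃ j, e j = i
    · obtain ⟨j, rfl⟩ := hi
      rw [he.extend_apply]; exact hw j
    · rw [Function.extend_apply' _ _ _ hi]; simpa using hc
  · refine le_trans (Nat.add_le_add_right ?_ 1) hk
    refine (ncard_le_ncard (t := e '' {j | w j ≠ 0}) ?_ (toFinite _)).trans
      (ncard_image_le (toFinite _))
    intro i hi
    by_cases hex : ∃ j, e j = i
    · obtain ⟨j, rfl⟩ := hex
      refine ⟨j, ?_, rfl⟩
      simpa [he.extend_apply] using hi
    · exact absurd (Function.extend_apply' _ _ _ hex) hi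
  · rw [hh x]
    congr 2
    refine Fintype.sum_of_injective e he _ _ (fun i hi => ?_) fun j => ?_
    · rw [Function.extend_apply' _ _ _ (by simpa using hi)]; simp
    · rw [he.extend_apply, hG]

lemma Neuron.one_le {k : ℕ} {h : X → ℝ} (hn : Neuron c k G h) : 1 ≤ k := by
  obtain ⟨w, b, hw, hb, h1, hh⟩ := hn
  omega

lemma Step.mono {w w' : ℕ} (h : Step c w G H) (hw : w ≤ w') : Step c w' G H :=
  let ⟨k, hk, hn⟩ := h
  ⟨k, hk.trans hw, hn⟩

lemma Step.card_le {w : ℕ} (h : Step c w G H) : Fintype.card κ ≤ w := by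
  obtain ⟨k, hk, hn⟩ := h
  refine le_trans ?_ hk
  rw [Fintype.card_eq_sum_ones]
  exact Finset.sum_le_sum fun i _ => (hn i).one_le

lemma Step.embed {w : ℕ} (h : Step c w G H) (hc : 0 ≤ c) {G' : μ → X → ℝ}
    {e : ι → μ} (he : Function.Injective e) (hG : ∀ j x, G' (e j) x = G j x) : Step c w G' H :=
  let ⟨k, hk, hn⟩ := h
  ⟨k, hk, fun i => (hn i).embed hc he hG⟩

lemma Step.reindex {w : ℕ} (h : Step c w G H) (e : μ ≃ κ) : Step c w G (H ∘ e) := by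
  obtain ⟨k, hk, hn⟩ := h
  refine ⟨k ∘ e, ?_, fun i => hn (e i)⟩
  rwa [Function.comp_def, e.sum_comp]

lemma Step.dense (h : ∀ i, ∃ (w : ι → ℝ) (b : ℝ), (∀ j, |w j| ≤ c) ∧ |b| ≤ c ∧
    ∀ x, H i x = max 0 (∑ j, w j * G j x + b)) :
    Step c (Fintype.card κ * (Fintype.card ι + 1)) G H := by
  refine ⟨fun _ => Fintype.card ι + 1, by simp, fun i => ?_⟩
  obtain ⟨w, b, hw, hb, hh⟩ := h i
  refine ⟨w, b, hw, hb, Nat.add_le_add_right ?_ 1, hh⟩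
  exact (ncard_le_ncard (subset_univ _) (toFinite _)).trans
    (by rw [ncard_univ, Nat.card_eq_fintype_card])

lemma Chain.mono {w w' : ℕ} (hw : w ≤ w') : ∀ {L : ℕ} {ι κ : Type} [Fintype ι] [Fintype κ]
    {G : ι → X → ℝ} {H : κ → X → ℝ}, Chain c w L G H → Chain c w' L G H
  | 0, _, _, _, _, _, _, h => Step.mono h hw
  | _ + 1, _, _, _, _, _, _, ⟨μ, hμ, F, h1, h2⟩ => ⟨μ, hμ, F, h1.mono hw, Chain.mono hw h2⟩

lemma Chain.embed (hc : 0 ≤ c) {w : ℕ} {L : ℕ} (h : Chain c w L G H) {G' : μ → X → ℝ}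
    {e : ι → μ} (he : Function.Injective e) (hG : ∀ j x, G' (e j) x = G j x) :
    Chain c w L G' H := by
  cases L with
  | zero => exact Step.embed h hc he hG
  | succ L =>
    obtain ⟨ν, hν, F, h1, h2⟩ := h
    exact ⟨ν, hν, F, h1.embed hc he hG, h2⟩

lemma Chain.trans {w : ℕ} {L₂ : ℕ} (h₂ : Chain c w L₂ F H) :
    ∀ {L₁ : ℕ} {ι : Type} [Fintype ι] {G : ι → X → ℝ}, Chain c w L₁ G F →
      Chain c w (L₁ + L₂ + 1) G H
  | 0, _, _, _, h => by
    rw [zero_add]; exact ⟨μ, _, F, h, h₂⟩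
  | L₁ + 1, _, _, _, ⟨ν, hν, F', h1, h2⟩ => by
    rw [show L₁ + 1 + L₂ + 1 = (L₁ + L₂ + 1) + 1 by ring]
    exact ⟨ν, hν, F', h1, h₂.trans h2⟩

lemma Chain.snoc {w w' : ℕ} {L : ℕ} (h : Chain c w L G F) (h' : Step c w' F H) :
    Chain c (max w w') (L + 1) G H :=
  Chain.trans (L₂ := 0) (h'.mono (le_max_right _ _)) (h.mono (le_max_left _ _))

section Sigma

variable {T : Type} [Fintype T] {α β : T → Type} [∀ t, Fintype (α t)] [∀ t, Fintype (β t)]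

lemma Step.sigma_shared {w : T → ℕ} {H : ∀ t, β t → X → ℝ} (h : ∀ t, Step c (w t) G (H t)) :
    Step c (∑ t, w t) G (fun p : Σ t, β t => H p.1 p.2) := by
  choose k hk hn using h
  refine ⟨fun p => k p.1 p.2, ?_, fun p => hn p.1 p.2⟩
  rw [Fintype.sum_sigma]
  exact Finset.sum_le_sum fun t _ => hk t

lemma Step.sigma (hc : 0 ≤ c) {w : T → ℕ} {G : ∀ t, α t → X → ℝ} {H : ∀ t, β t → X → ℝ}
    (h : ∀ t, Step c (w t) (G t) (H t)) :
    Step c (∑ t, w t) (fun p : Σ t, α t => G p.1 p.2) (fun p : Σ t, β t => H p.1 p.2) :=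
  Step.sigma_shared fun t => (h t).embed hc (e := Sigma.mk t) sigma_mk_injective fun _ _ => rfl

end Sigma

lemma Chain.sigma (hc : 0 ≤ c) {T : Type} [Fintype T] {w : T → ℕ} :
    ∀ {L : ℕ} {α β : T → Type} [∀ t, Fintype (α t)] [∀ t, Fintype (β t)]
      {G : ∀ t, α t → X → ℝ} {H : ∀ t, β t → X → ℝ}, (∀ t, Chain c (w t) L (G t) (H t)) →
      Chain c (∑ t, w t) L (fun p : Σ t, α t => G p.1 p.2) (fun p : Σ t, β t => H p.1 p.2)
  | 0, _, _, _, _, _, _, h => Step.sigma hc h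
  | L + 1, _, _, _, _, _, _, h => by
    choose μ hμ F h1 h2 using h
    exact ⟨Σ t, μ t, inferInstance, fun p => F p.1 p.2, Step.sigma hc h1, Chain.sigma hc h2⟩

lemma Chain.sigma_shared (hc : 0 ≤ c) {T : Type} [Fintype T] {w : T → ℕ} {L : ℕ} {β : T → Type}
    [∀ t, Fintype (β t)] {H : ∀ t, β t → X → ℝ} (h : ∀ t, Chain c (w t) L G (H t)) :
    Chain c (∑ t, w t) L G (fun p : Σ t, β t => H p.1 p.2) := by
  cases L with
  | zero => exact Step.sigma_shared h
  | succ L =>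
    choose μ hμ F h1 h2 using h
    exact ⟨Σ t, μ t, inferInstance, fun p => F p.1 p.2, Step.sigma_shared h1, Chain.sigma hc h2⟩

/-- A chain followed by a linear output layer is a network whose architecture does not depend on
the output weights. -/
lemma Chain.exists_net {w : ℕ} : ∀ {L n : ℕ} {κ : Type} [Fintype κ]
    {G : Fin n → X → ℝ} {H : κ → X → ℝ}, 0 ≤ c → Chain c w L G H →
    ∃ hidden : List ℕ, hidden.length = L + 1 ∧ (∀ a ∈ hidden, a ≤ w) ∧
      ∀ a : κ → ℝ, (∀ i, |a i| ≤ c) → ∃ Φ : ReLUNet n, Φ.hiddenWidths = hidden ∧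
        Φ.depth = L + 2 ∧ Φ.WeightsBoundedBy c ∧ Φ.numNonzero ≤ (L + 2) * w ∧
        ∀ x, Φ.eval (fun j => G j x) = ∑ i, a i * H i x := by
  have layer : ∀ {n m : ℕ} {G : Fin n → X → ℝ} {F : Fin m → X → ℝ}, Step c w G F →
      ∃ (W : Matrix (Fin m) (Fin n) ℝ) (b : Fin m → ℝ), (∀ i j, |W i j| ≤ c) ∧
        (∀ i, |b i| ≤ c) ∧
        {p : Fin m × Fin n | W p.1 p.2 ≠ 0}.ncard + {i | b i ≠ 0}.ncard ≤ w ∧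
        ∀ x, (fun i => max 0 ((W.mulVec (fun j => G j x) + b) i)) = fun i => F i x := by
    intro n m G F ⟨k, hk, hn⟩
    choose W b hW hb hcard hF using hn
    refine ⟨W, b, hW, hb, ?_, fun x => ?_⟩
    · have h1 : {p : Fin m × Fin n | W p.1 p.2 ≠ 0} ⊆
          ⋃ i, (fun j => (i, j)) '' {j | W i j ≠ 0} := by
        rintro ⟨i, j⟩ hp
        exact mem_iUnion.2 ⟨i, j, hp, rfl⟩
      have h2 : {p : Fin m × Fin n | W p.1 p.2 ≠ 0}.ncard ≤ ∑ i, {j | W i j ≠ 0}.ncard := by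
        refine (ncard_le_ncard h1 (toFinite _)).trans ?_
        refine (ncard_iUnion_le_of_fintype _).trans (Finset.sum_le_sum fun i _ => ?_)
        exact ncard_image_le (toFinite _)
      have h3 : {i | b i ≠ 0}.ncard ≤ ∑ _i : Fin m, 1 := by
        refine (ncard_le_ncard (subset_univ _) (toFinite _)).trans ?_
        simp [ncard_univ]
      refine le_trans (Nat.add_le_add h2 h3) ?_
      rw [← Finset.sum_add_distrib]
      exact (Finset.sum_le_sum fun i _ => hcard i).trans hk
    · ext i
      rw [hF i x]
      rfl
  have out : ∀ {m : ℕ} {κ : Type} [Fintype κ] {H : κ → X → ℝ} (e : κ ≃ Fin m),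
      Fintype.card κ ≤ w → 0 ≤ c → ∀ a : κ → ℝ, (∀ i, |a i| ≤ c) →
      ∃ Φ : ReLUNet m, Φ.hiddenWidths = [] ∧ Φ.depth = 1 ∧ Φ.WeightsBoundedBy c ∧
        Φ.numNonzero ≤ w ∧ ∀ x, Φ.eval (fun j => H (e.symm j) x) = ∑ i, a i * H i x := by
    intro m κ _ H e hcard hc a ha
    refine ⟨.output (fun _ j => a (e.symm j)) 0, rfl, rfl,
      ⟨fun _ j => ha _, by simpa using hc⟩, ?_, fun x => ?_⟩
    · have h1 : {p : Fin 1 × Fin m | a (e.symm p.2) ≠ 0}.ncard ≤ m := by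
        refine (ncard_le_ncard (subset_univ _) (toFinite _)).trans ?_
        simp [ncard_univ]
      have h2 : {i : Fin 1 | (0 : Fin 1 → ℝ) i ≠ 0} = ∅ := by simp
      have h3 : m = Fintype.card κ := by simpa using (Fintype.card_congr e).symm
      simp only [ReLUNet.numNonzero, h2, ncard_empty]
      omega
    · simp only [ReLUNet.eval, Matrix.mulVec, dotProduct, Pi.add_apply, Pi.zero_apply, add_zero]
      rw [← e.sum_comp]
      simp
  intro L
  induction L with
  | zero =>
    intro n κ _ G H hc h
    have h : Step c w G H := h
    set e := Fintype.equivFin κ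
    obtain ⟨W, b, hW, hb, hcard, hF⟩ := layer (h.reindex e.symm)
    refine ⟨[Fintype.card κ], rfl, by simpa using h.card_le, fun a ha => ?_⟩
    obtain ⟨Φ, h1, h2, h3, h4, h5⟩ := out (H := H) e h.card_le hc a ha
    refine ⟨.layer W b Φ, ?_, ?_, ⟨hW, hb, h3⟩, ?_, fun x => ?_⟩
    · simp [ReLUNet.hiddenWidths, h1]
    · simp [ReLUNet.depth, h2]
    · simp only [ReLUNet.numNonzero]; omega
    · simp only [ReLUNet.eval, hF x]
      exact h5 x
  | succ L ih =>
    intro n κ _ G H hc h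
    obtain ⟨μ, _, F, h1, h2⟩ := h
    set e := Fintype.equivFin μ
    obtain ⟨W, b, hW, hb, hcard, hF⟩ := layer (h1.reindex e.symm)
    obtain ⟨hidden, hl, hw, hnet⟩ := ih (G := F ∘ e.symm) hc
      (h2.embed hc e.injective fun j x => by simp)
    refine ⟨Fintype.card μ :: hidden, by simp [hl], ?_, fun a ha => ?_⟩
    · intro k hk
      rcases List.mem_cons.1 hk with rfl | hk
      · exact h1.card_le
      · exact hw k hk
    obtain ⟨Φ, g1, g2, g3, g4, g5⟩ := hnet a ha
    refine ⟨.layer W b Φ, ?_, ?_, ⟨hW, hb, g3⟩, ?_, fun x => ?_⟩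
    · simp [ReLUNet.hiddenWidths, g1]
    · simp [ReLUNet.depth, g2]
    · simp only [ReLUNet.numNonzero]
      have : (L + 1 + 2) * w = w + (L + 2) * w := by ring
      omega
    · simp only [ReLUNet.eval, hF x]
      exact g5 x

end Chains

/-! ### Approximate squares and products -/

/-- The iterates of `u ↦ |2 u - 1|`. -/
noncomputable def foldIter (i : ℕ) (u : ℝ) : ℝ := (fun t : ℝ => |2 * t - 1|)^[i] u

/-- The piecewise linear interpolation of `u ↦ u ^ 2` at the dyadic points of level `m`. -/
noncomputable def sqApprox (m : ℕ) (u : ℝ) : ℝ :=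
  u + ∑ i ∈ Finset.range m, (1 / 4) ^ (i + 1) * (foldIter (i + 1) u - 1)

lemma foldIter_succ (i : ℕ) (u : ℝ) : foldIter (i + 1) u = |2 * foldIter i u - 1| := by
  simp only [foldIter, Function.iterate_succ_apply']

lemma foldIter_succ_left (i : ℕ) (u : ℝ) : foldIter (i + 1) u = foldIter i |2 * u - 1| := by
  simp only [foldIter, Function.iterate_succ_apply]

lemma sqApprox_succ (m : ℕ) (u : ℝ) :
    sqApprox (m + 1) u = u - 1 / 4 + sqApprox m |2 * u - 1| / 4 := by
  simp only [sqApprox, Finset.sum_range_succ', add_div, Finset.sum_div]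
  simp only [foldIter_succ_left]
  have h : ∀ i ∈ Finset.range m, (1 / 4 : ℝ) ^ (i + 1 + 1) * (foldIter i |2 * |2 * u - 1| - 1| - 1) =
      (1 / 4) ^ (i + 1) * (foldIter i |2 * |2 * u - 1| - 1| - 1) / 4 := fun i _ => by ring
  rw [Finset.sum_congr rfl h]
  simp only [foldIter, Function.iterate_zero, id]
  ring

lemma sqApprox_bounds (m : ℕ) {u : ℝ} (h0 : 0 ≤ u) (h1 : u ≤ 1) :
    u ^ 2 ≤ sqApprox m u ∧ sqApprox m u ≤ u ∧ sqApprox m u ≤ u ^ 2 + (1 / 4) ^ m := by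
  induction m generalizing u with
  | zero =>
    simp only [sqApprox, Finset.range_zero, Finset.sum_empty, add_zero, pow_zero]
    refine ⟨by nlinarith, le_rfl, by nlinarith⟩
  | succ m ih =>
    rw [sqApprox_succ]
    have hv0 : 0 ≤ |2 * u - 1| := abs_nonneg _
    have hv1 : |2 * u - 1| ≤ 1 := abs_le.2 ⟨by linarith, by linarith⟩
    obtain ⟨a, b, e⟩ := ih hv0 hv1
    rw [sq_abs] at a e
    rw [pow_succ (1 / 4 : ℝ) m]
    refine ⟨by nlinarith, by linarith, by nlinarith⟩

/-- An approximation of the product by piecewise linear functions. -/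
noncomputable def mulApprox (m : ℕ) (u v : ℝ) : ℝ :=
  sqApprox m |1 / 2 * u + 1 / 2 * v| - sqApprox m |1 / 2 * u - 1 / 2 * v|

lemma mulApprox_bounds (m : ℕ) {u v : ℝ} (hu : |u| ≤ 1) (hv : |v| ≤ 1) :
    |mulApprox m u v| ≤ 1 ∧ |mulApprox m u v - u * v| ≤ (1 / 4) ^ m := by
  rw [abs_le] at hu hv
  have h1 : |1 / 2 * u + 1 / 2 * v| ≤ 1 := abs_le.2 ⟨by linarith, by linarith⟩
  have h2 : |1 / 2 * u - 1 / 2 * v| ≤ 1 := abs_le.2 ⟨by linarith, by linarith⟩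
  obtain ⟨a1, b1, e1⟩ := sqApprox_bounds m (abs_nonneg _) h1
  obtain ⟨a2, b2, e2⟩ := sqApprox_bounds m (abs_nonneg _) h2
  rw [sq_abs] at a1 e1 a2 e2
  have p1 := sq_nonneg (1 / 2 * u + 1 / 2 * v)
  have p2 := sq_nonneg (1 / 2 * u - 1 / 2 * v)
  have h4 : (0 : ℝ) ≤ (1 / 4) ^ m := by positivity
  unfold mulApprox
  constructor <;> rw [abs_le] <;> constructor <;> nlinarith

/-- An approximation of the product of a list by piecewise linear functions. -/
noncomputable def prodApprox (m : ℕ) : List ℝ → ℝ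
  | [] => 1
  | a :: l => mulApprox m a (prodApprox m l)

lemma prodApprox_bounds (m : ℕ) : ∀ l : List ℝ, (∀ a ∈ l, |a| ≤ 1) →
    |prodApprox m l| ≤ 1 ∧ |prodApprox m l - l.prod| ≤ l.length * (1 / 4) ^ m
  | [], _ => by simp [prodApprox]
  | a :: l, h => by
    obtain ⟨h1, h2⟩ := prodApprox_bounds m l fun b hb => h b (List.mem_cons_of_mem a hb)
    have ha := h a List.mem_cons_self
    obtain ⟨h3, h4⟩ := mulApprox_bounds m ha h1
    refine ⟨h3, ?_⟩
    rw [prodApprox, List.prod_cons, List.length_cons]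
    have e : mulApprox m a (prodApprox m l) - a * l.prod =
        (mulApprox m a (prodApprox m l) - a * prodApprox m l) + a * (prodApprox m l - l.prod) := by
      ring
    rw [e]
    refine (abs_add_le _ _).trans ?_
    rw [abs_mul]
    have h5 : |a| * |prodApprox m l - l.prod| ≤ 1 * (l.length * (1 / 4) ^ m) := by gcongr
    push_cast
    linarith

/-! ### Computation of scalar functions -/

section Comp

variable {X : Type*} {c : ℝ} {ι : Type} [Fintype ι] {G : ι → X → ℝ}

/-- The pair of the positive and the negative part. -/
def signPair (u : X → ℝ) (b : Bool) (x : X) : ℝ := max 0 (cond b (u x) (-u x))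

lemma signPair_sub (u : X → ℝ) (x : X) : signPair u true x - signPair u false x = u x := by
  simp only [signPair, cond_true, cond_false]
  rcases le_total 0 (u x) with h | h
  · rw [max_eq_right h, max_eq_left (by linarith)]; ring
  · rw [max_eq_left h, max_eq_right (by linarith)]; ring

/-- The scalar function `u` is computed from the family `G` by `L + 1` layers of cost at most `w`;
its positive and negative part are the result. -/
def Comp (c : ℝ) (w L : ℕ) (G : ι → X → ℝ) (u : X → ℝ) : Prop :=
  Chain c w L G (signPair u)

lemma Comp.mono {w w' L : ℕ} {u : X → ℝ} (h : Comp c w L G u) (hw : w ≤ w') : Comp c w' L G u :=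
  Chain.mono hw h

lemma Comp.congr {w w' L L' : ℕ} {u v : X → ℝ} (h : Comp c w L G u) (hw : w ≤ w') (hL : L = L')
    (huv : ∀ x, v x = u x) : Comp c w' L' G v := by
  obtain rfl : v = u := funext huv
  subst hL
  exact h.mono hw

/-- A function that is affine in the family `G` is computed by one layer. -/
lemma step_signPair {u : X → ℝ} (a : ι → ℝ) (e : ℝ) (ha : ∀ j, |a j| ≤ c) (he : |e| ≤ c)
    (hu : ∀ x, u x = ∑ j, a j * G j x + e) :
    Step c (2 * (Fintype.card ι + 1)) G (signPair u) := by
  refine Step.dense fun b => ?_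
  cases b with
  | true => exact ⟨a, e, ha, he, fun x => by simp [signPair, hu]⟩
  | false =>
    refine ⟨fun j => -a j, -e, fun j => by simpa using ha j, by simpa using he, fun x => ?_⟩
    simp only [signPair, hu, cond_false, neg_mul, Finset.sum_neg_distrib, neg_add]

lemma Comp.unary {w L : ℕ} {u v : X → ℝ} (h : Comp c w L G u) (a b e : ℝ) (ha : |a| ≤ c)
    (hb : |b| ≤ c) (he : |e| ≤ c)
    (hv : ∀ x, v x = a * max 0 (u x) + b * max 0 (-u x) + e) :
    Comp c (max w 6) (L + 1) G v := by
  refine Chain.snoc h (step_signPair (c := c) (fun i : Bool => cond i a b) e ?_ he fun x => ?_)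
  · intro i; cases i <;> simpa
  · simp [hv, signPair]

lemma Comp.affine {w L : ℕ} {u : X → ℝ} (h : Comp c w L G u) (a e : ℝ) (ha : |a| ≤ c)
    (he : |e| ≤ c) : Comp c (max w 6) (L + 1) G (fun x => a * u x + e) := by
  refine h.unary a (-a) e ha (by simpa using ha) he fun x => ?_
  rw [← signPair_sub u x]
  simp only [signPair, cond_true, cond_false]
  rcases le_total 0 (u x) with h | h
  · rw [max_eq_right h, max_eq_left (by linarith : -u x ≤ 0)]; simp [h]
  · rw [max_eq_left h, max_eq_right (by linarith : 0 ≤ -u x)]; simp [h]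

lemma Comp.pad (hc : 1 ≤ c) {w L L' : ℕ} {u : X → ℝ} (h : Comp c w L G u) (hL : L ≤ L') :
    Comp c (max w 6) L' G u := by
  induction L', hL using Nat.le_induction with
  | base => exact h.mono (le_max_left _ _)
  | succ n hn ih =>
    have := ih.affine (u := u) 1 0 (by simpa using hc) (by simp; linarith)
    simpa using this

lemma Comp.const (hc : 0 ≤ c) (e : ℝ) (he : |e| ≤ c) : Comp c 2 0 G (fun _ => e) := by
  refine ⟨fun _ => 1, by simp, fun b => ⟨fun _ => 0, cond b e (-e), fun _ => by simpa using hc, ?_, ?_, ?_⟩⟩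
  · cases b <;> simpa using he
  · simp
  · intro x; cases b <;> simp [signPair]

lemma Comp.abs (hc : 1 ≤ c) {w L : ℕ} {u : X → ℝ} (h : Comp c w L G u) :
    Comp c (max w 6) (L + 1) G (fun x => |u x|) := by
  refine h.unary 1 1 0 (by simpa using hc) (by simpa using hc) (by simp; linarith) fun x => ?_
  rcases le_total 0 (u x) with h | h
  · rw [abs_of_nonneg h, max_eq_right h, max_eq_left (by linarith)]; ring
  · rw [abs_of_nonpos h, max_eq_left h, max_eq_right (by linarith)]; ring

lemma Comp.relu (hc : 1 ≤ c) {w L : ℕ} {u : X → ℝ} (h : Comp c w L G u) :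
    Comp c (max w 6) (L + 1) G (fun x => max 0 (u x)) := by
  refine h.unary 1 0 0 (by simpa using hc) (by simp; linarith) (by simp; linarith) fun x => ?_
  ring

lemma Comp.two_pow_mul (hc : 2 ≤ c) {w L : ℕ} {u : X → ℝ} (h : Comp c w L G u) (q : ℕ) :
    Comp c (max w 6) (L + q) G (fun x => 2 ^ q * u x) := by
  induction q with
  | zero => simpa using h.mono (le_max_left _ _)
  | succ q ih =>
    have := ih.affine 2 0 (by simpa using hc) (by simp; linarith)
    rw [max_assoc, max_self] at this
    rw [← add_assoc]
    convert! this using 2 with x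
    ring

lemma Comp.lin (hc : 0 ≤ c) {w₁ w₂ L : ℕ} {u v : X → ℝ} (hu : Comp c w₁ L G u)
    (hv : Comp c w₂ L G v) (a b e : ℝ) (ha : |a| ≤ c) (hb : |b| ≤ c) (he : |e| ≤ c) :
    Comp c (max (w₁ + w₂) 10) (L + 1) G (fun x => a * u x + b * v x + e) := by
  have h := Chain.sigma_shared hc (T := Bool) (w := fun t => cond t w₁ w₂) (β := fun _ => Bool)
    (H := fun t => signPair (cond t u v)) (L := L) (G := G)
    fun t => by cases t; exacts [hv, hu]
  have h2 := Chain.snoc h (step_signPair (c := c) (u := fun x => a * u x + b * v x + e)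
    (fun p : Σ _ : Bool, Bool => cond p.1 (cond p.2 a (-a)) (cond p.2 b (-b))) e ?_ he ?_)
  · simpa [Comp] using h2
  · rintro ⟨i, j⟩; cases i <;> cases j <;> simpa
  · intro x
    rw [Fintype.sum_sigma]
    simp only [Fintype.sum_bool, cond_true, cond_false]
    conv_lhs => rw [← signPair_sub u x, ← signPair_sub v x]
    ring

/-- The three registers of the network that computes `sqApprox`. -/
noncomputable def sqState (u : X → ℝ) (i : ℕ) : Fin 3 → X → ℝ :=
  ![fun x => max 0 (2 * foldIter i (u x) - 1), fun x => max 0 (1 - 2 * foldIter i (u x)),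
    fun x => max 0 (sqApprox i (u x))]

lemma Comp.sq (hc : 2 ≤ c) {w L : ℕ} {u : X → ℝ} (h : Comp c w L G u) (h0 : ∀ x, 0 ≤ u x)
    (h1 : ∀ x, u x ≤ 1) (m : ℕ) :
    Comp c (max w 12) (L + m + 2) G (fun x => sqApprox m (u x)) := by
  have hpair : ∀ x, signPair u true x = u x := fun x => by simp [signPair, h0 x]
  have hstate : ∀ i, Chain c (max w 12) (L + i + 1) G (sqState u i) := by
    intro i
    induction i with
    | zero =>
      have hs : Step c 9 (signPair u) (sqState u 0) := by
        refine Step.dense (κ := Fin 3) (ι := Bool) fun k => ?_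
        have c1 : |(1 : ℝ)| ≤ c := by simp; linarith
        have c2 : |(2 : ℝ)| ≤ c := by simpa using hc
        fin_cases k
        · refine ⟨fun b => cond b 2 0, -1, fun b => ?_, by simpa using c1, fun x => ?_⟩
          · cases b <;> simp <;> linarith
          · simp [sqState, hpair, foldIter, sub_eq_add_neg]
        · refine ⟨fun b => cond b (-2) 0, 1, fun b => ?_, by simpa using c1, fun x => ?_⟩
          · cases b <;> simp <;> linarith
          · simp [sqState, hpair, foldIter, sub_eq_add_neg, add_comm]
        · refine ⟨fun b => cond b 1 0, 0, fun b => ?_, by simp; linarith, fun x => ?_⟩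
          · cases b <;> simp <;> linarith
          · simp [sqState, hpair, sqApprox]
      exact (Chain.snoc h hs).mono (by omega)
    | succ i ih =>
      have hs : Step c 12 (sqState u i) (sqState u (i + 1)) := by
        have hfold : ∀ x, sqState u i 0 x + sqState u i 1 x = foldIter (i + 1) (u x) := by
          intro x
          rw [foldIter_succ]
          simp only [sqState, Matrix.cons_val_zero, Matrix.cons_val_one]
          rcases le_total 0 (2 * foldIter i (u x) - 1) with h | h
          · rw [abs_of_nonneg h, max_eq_right h, max_eq_left (by linarith)]; ring
          · rw [abs_of_nonpos h, max_eq_left h, max_eq_right (by linarith)]; ring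
        have hsq : ∀ x, sqState u i 2 x = sqApprox i (u x) := fun x =>
          max_eq_right ((sq_nonneg _).trans (sqApprox_bounds i (h0 x) (h1 x)).1)
        refine Step.dense (κ := Fin 3) (ι := Fin 3) fun k => ?_
        fin_cases k
        · refine ⟨![2, 2, 0], -1, fun b => ?_, by simp; linarith, fun x => ?_⟩
          · fin_cases b <;> simp <;> linarith
          · simp only [Fin.sum_univ_three]
            simp only [Matrix.cons_val_zero, Matrix.cons_val_one, Matrix.cons_val]
            change max 0 (2 * foldIter (i + 1) (u x) - 1) = _
            rw [← hfold x]
            congr 1; ring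
        · refine ⟨![-2, -2, 0], 1, fun b => ?_, by simp; linarith, fun x => ?_⟩
          · fin_cases b <;> simp <;> linarith
          · simp only [Fin.sum_univ_three]
            simp only [Matrix.cons_val_zero, Matrix.cons_val_one, Matrix.cons_val]
            change max 0 (1 - 2 * foldIter (i + 1) (u x)) = _
            rw [← hfold x]
            congr 1; ring
        · have hp : |(1 / 4 : ℝ) ^ (i + 1)| ≤ c := by
            rw [abs_of_nonneg (by positivity)]
            have : (1 / 4 : ℝ) ^ (i + 1) ≤ 1 := pow_le_one₀ (by norm_num) (by norm_num)
            linarith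
          refine ⟨![(1 / 4) ^ (i + 1), (1 / 4) ^ (i + 1), 1], -(1 / 4) ^ (i + 1), fun b => ?_,
            by rwa [abs_neg], fun x => ?_⟩
          · fin_cases b
            · exact hp
            · exact hp
            · simp; linarith
          · simp only [Fin.sum_univ_three]
            simp only [Matrix.cons_val_zero, Matrix.cons_val_one, Matrix.cons_val]
            change max 0 (sqApprox (i + 1) (u x)) = _
            rw [hsq x]
            have : sqApprox (i + 1) (u x) = sqApprox i (u x) +
                (1 / 4) ^ (i + 1) * (foldIter (i + 1) (u x) - 1) := by
              simp only [sqApprox, Finset.sum_range_succ]; ring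
            rw [this, ← hfold x]
            congr 1; ring
      exact (Chain.snoc ih hs).mono (by omega)
  have hs : Step c 8 (sqState u m) (signPair fun x => sqApprox m (u x)) := by
    refine step_signPair (ι := Fin 3) ![0, 0, 1] 0 (fun b => ?_) (by simp; linarith) fun x => ?_
    · fin_cases b <;> simp <;> linarith
    · simp only [Fin.sum_univ_three]
      simp only [Matrix.cons_val_zero, Matrix.cons_val_one, Matrix.cons_val]
      have : sqState u m 2 x = sqApprox m (u x) :=
        max_eq_right ((sq_nonneg _).trans (sqApprox_bounds m (h0 x) (h1 x)).1)
      rw [this]; ring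
  exact (Chain.snoc (hstate m) hs).mono (by omega)

lemma Comp.mul (hc : 2 ≤ c) {w₁ w₂ L : ℕ} {u v : X → ℝ} (hu : Comp c w₁ L G u)
    (hv : Comp c w₂ L G v) (hu1 : ∀ x, |u x| ≤ 1) (hv1 : ∀ x, |v x| ≤ 1) (m : ℕ) :
    Comp c (2 * (w₁ + w₂) + 24) (L + (m + 5)) G (fun x => mulApprox m (u x) (v x)) := by
  have c0 : |(0 : ℝ)| ≤ c := by simp; linarith
  have c1 : |(1 : ℝ)| ≤ c := by simp; linarith
  have ch : |(1 / 2 : ℝ)| ≤ c := by rw [abs_of_pos (by norm_num)]; linarith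
  have hb := fun x => abs_le.1 (hu1 x)
  have hb' := fun x => abs_le.1 (hv1 x)
  have s1 := ((Comp.lin (by linarith) hu hv (1 / 2) (1 / 2) 0 ch ch c0).abs (by linarith)).sq hc
    (fun x => abs_nonneg _) (fun x => abs_le.2
      ⟨by linarith [hb x, hb' x], by linarith [hb x, hb' x]⟩) m
  have s2 := ((Comp.lin (by linarith) hu hv (1 / 2) (-(1 / 2)) 0 ch (by rwa [abs_neg]) c0).abs
    (by linarith)).sq hc (fun x => abs_nonneg _) (fun x => abs_le.2
      ⟨by linarith [hb x, hb' x], by linarith [hb x, hb' x]⟩) m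
  have s3 := Comp.lin (by linarith) s1 s2 1 (-1) 0 c1 (by rwa [abs_neg]) c0
  have e : L + 1 + 1 + m + 2 + 1 = L + (m + 5) := by ring
  rw [e] at s3
  convert! s3.mono (w' := 2 * (w₁ + w₂) + 24) (by omega) using 2 with x
  simp only [mulApprox]
  ring_nf

/-- The cost of a layer in the computation of a product of `n` factors of cost `w`. -/
def prodCost (w : ℕ) : ℕ → ℕ
  | 0 => 6
  | n + 1 => 2 * (max w 6 + prodCost w n) + 24

lemma Comp.prod (hc : 2 ≤ c) {w L : ℕ} (m : ℕ) : ∀ l : List (X → ℝ),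
    (∀ u ∈ l, Comp c w L G u ∧ ∀ x, |u x| ≤ 1) →
    Comp c (prodCost w l.length) (L + l.length * (m + 5)) G
      (fun x => prodApprox m (l.map fun u => u x))
  | [], _ => by
    have h := (Comp.const (G := G) (by linarith) 1 (by simp; linarith : |(1 : ℝ)| ≤ c)).pad
      (by linarith) (Nat.zero_le L)
    simpa [prodApprox, prodCost] using h
  | u :: l, h => by
    have h1 := Comp.prod hc m l fun v hv => h v (List.mem_cons_of_mem u hv)
    obtain ⟨h2, h3⟩ := h u List.mem_cons_self
    have h4 := (h2.pad (by linarith) (Nat.le_add_right L (l.length * (m + 5)))).mul hc h1 h3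
      (fun x => (prodApprox_bounds m _ fun a ha => by
        obtain ⟨v, hv, rfl⟩ := List.mem_map.1 ha
        exact (h v (List.mem_cons_of_mem u hv)).2 x).1) m
    rw [List.length_cons, show L + (l.length + 1) * (m + 5) = L + l.length * (m + 5) + (m + 5) by
      ring]
    exact h4

end Comp

section Front

variable {X : Type*} {c : ℝ} {ι κ : Type} [Fintype ι] [Fintype κ] {G : ι → X → ℝ}

/-- The family of the positive and negative parts of a family of scalar functions. -/
def signPairs (u : κ → X → ℝ) (p : Σ _ : κ, Bool) : X → ℝ := signPair (u p.1) p.2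

lemma step_signPairs {u : κ → X → ℝ} (h : ∀ i, ∃ (a : ι → ℝ) (e : ℝ), (∀ j, |a j| ≤ c) ∧ |e| ≤ c ∧
    ∀ x, u i x = ∑ j, a j * G j x + e) :
    Step c (Fintype.card κ * (2 * (Fintype.card ι + 1))) G (signPairs u) := by
  have := Step.sigma_shared (c := c) (G := G) (β := fun _ : κ => Bool) (H := fun i => signPair (u i))
    (w := fun _ => 2 * (Fintype.card ι + 1))
    fun i => let ⟨a, e, ha, he, hu⟩ := h i; step_signPair a e ha he hu
  rw [Finset.sum_const, Finset.card_univ, smul_eq_mul] at this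
  exact this

lemma sum_signPairs (u : κ → X → ℝ) (a : κ → ℝ) (x : X) :
    ∑ p : Σ _ : κ, Bool, (cond p.2 (a p.1) (-a p.1)) * signPairs u p x = ∑ i, a i * u i x := by
  rw [Fintype.sum_sigma]
  refine Finset.sum_congr rfl fun i _ => ?_
  simp only [Fintype.sum_bool, cond_true, cond_false, signPairs]
  conv_rhs => rw [← signPair_sub (u i) x]
  ring

lemma chain_signPairs (hc : 0 ≤ c) {w : κ → ℕ} {L : ℕ} {u : κ → X → ℝ}
    (h : ∀ i, Comp c (w i) L G (u i)) : Chain c (∑ i, w i) L G (signPairs u) :=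
  Chain.sigma_shared hc h

lemma comp_of_signPairs (hc : 1 ≤ c) (u : κ → X → ℝ) (i : κ) :
    Comp c (2 * (2 * Fintype.card κ + 1)) 0 (signPairs u) (u i) := by
  classical
  have h := step_signPair (c := c) (G := signPairs u) (u := u i)
    (fun p => cond p.2 (if p.1 = i then 1 else 0) (-(if p.1 = i then 1 else 0))) 0 (fun p => ?_)
    (by simp; linarith) (fun x => ?_)
  · refine Step.mono h (le_of_eq ?_)
    rw [Fintype.card_sigma]
    simp [mul_comm]
  · obtain ⟨j, b⟩ := p
    by_cases hj : j = i <;> cases b <;> simp [hj] <;> linarith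
  · rw [sum_signPairs u (fun j => if j = i then 1 else 0)]
    simp

variable {D N d : ℕ}

/-- The features computed first: the coordinates of the projections of `x - p k`, and
approximations of the scaled squared distances to the centres `p k`. -/
noncomputable def frontFun (xc : Fin D → X → ℝ) (p : Fin N → Fin D → ℝ)
    (V : Fin N → Fin d → Fin D → ℝ) (β m : ℕ) : (Fin N × Fin d) ⊕ Fin N → X → ℝ
  | .inl (k, i), x => ∑ j, V k i j * (xc j x - p k j)
  | .inr k, x => ∑ j, sqApprox m |(1 / 2) ^ β * (xc j x - p k j)|

/-- The cost per input dimension of a layer of the network that computes the features. -/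
def frontCost (N d : ℕ) : ℕ := 48 * N + (N * d + N) * (2 * (N * 4 + 1))

lemma chain_front (hc : 2 ≤ c) (hD : 1 ≤ D) (xc : Fin D → X → ℝ) (p : Fin N → Fin D → ℝ)
    (V : Fin N → Fin d → Fin D → ℝ) (β m : ℕ) (hp : ∀ k j, |p k j| ≤ c)
    (hV : ∀ k i j, |V k i j| ≤ 1) (hx : ∀ k j x, |xc j x - p k j| ≤ 2 ^ β) :
    Chain c (frontCost N d * D) (m + 6) xc (signPairs (frontFun xc p V β m)) := by
  classical
  set y : Fin N × Fin D → X → ℝ := fun t x => xc t.2 x - p t.1 t.2 with hy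
  have c0 : |(0 : ℝ)| ≤ c := by simp; linarith
  have c1 : |(1 : ℝ)| ≤ c := by simp; linarith
  have h1 : ∀ t, Step c 4 xc (signPair (y t)) := by
    intro t
    refine ⟨fun _ => 2, by simp, fun b => ⟨fun j => if j = t.2 then cond b 1 (-1) else 0,
      cond b (-p t.1 t.2) (p t.1 t.2), fun j => ?_, ?_, ?_, fun x => ?_⟩⟩
    · by_cases hj : j = t.2 <;> cases b <;> simp [hj] <;> linarith
    · cases b
      · exact hp _ _
      · simpa using hp _ _
    · refine Nat.add_le_add_right (m := 1) ?_ 1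
      refine (ncard_le_ncard (t := {t.2}) (fun j hj => ?_) (toFinite _)).trans (by simp)
      by_contra hne
      exact hj (if_neg hne)
    · cases b <;> simp [signPair, hy] <;> ring_nf
  have h1' : Chain c (N * D * 4) 0 xc (fun q : Σ _ : Fin N × Fin D, Bool => signPair (y q.1) q.2) := by
    have := Step.sigma_shared h1
    rw [Finset.sum_const, Finset.card_univ, smul_eq_mul, Fintype.card_prod, Fintype.card_fin,
      Fintype.card_fin] at this
    exact this
  set z : Fin N × Fin D → Bool → X → ℝ := fun t s =>
    cond s (y t) (fun x => sqApprox m |(1 / 2) ^ β * y t x|) with hz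
  have h2 : ∀ t, Chain c 48 (m + 4) (signPair (y t)) (signPairs (z t)) := by
    intro t
    have b0 : Comp c 6 0 (signPair (y t)) (y t) :=
      step_signPair (ι := Bool) (fun b => cond b 1 (-1)) 0 (fun b => by cases b <;> simp <;> linarith)
        c0 (fun x => by rw [← signPair_sub (y t) x]; simp; ring)
    have hpow : ((1 : ℝ) / 2) ^ β ≤ 1 := pow_le_one₀ (by norm_num) (by norm_num)
    have b1 := ((b0.affine ((1 / 2) ^ β) 0 (by rw [abs_of_pos (by positivity)]; linarith) c0).abs
      (by linarith)).sq hc (fun x => abs_nonneg _) (fun x => by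
        rw [add_zero, abs_mul, abs_of_pos (by positivity)]
        calc ((1 : ℝ) / 2) ^ β * |y t x| ≤ (1 / 2) ^ β * 2 ^ β := by
              gcongr; exact hx t.1 t.2 x
          _ = 1 := by rw [← mul_pow]; norm_num) m
    have b2 := b0.pad (by linarith) (Nat.zero_le (m + 4))
    have b3 : ∀ s, Comp c 24 (m + 4) (signPair (y t)) (z t s) := by
      intro s
      cases s
      · have : 0 + 1 + 1 + m + 2 = m + 4 := by ring
        rw [this] at b1
        simp only [add_zero] at b1
        exact b1.mono (by norm_num)
      · exact b2.mono (by norm_num)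
    have := chain_signPairs (by linarith) b3
    simpa using this
  have h2' : Chain c (N * D * 48) (m + 4)
      (fun q : Σ _ : Fin N × Fin D, Bool => signPair (y q.1) q.2)
      (fun q : Σ _ : Fin N × Fin D, Σ _ : Bool, Bool => signPairs (z q.1) q.2) := by
    have := Chain.sigma (c := c) (by linarith) h2
    simpa using this
  have h3 : Step c ((N * d + N) * (2 * (N * D * 4 + 1)))
      (fun q : Σ _ : Fin N × Fin D, Σ _ : Bool, Bool => signPairs (z q.1) q.2)
      (signPairs (frontFun xc p V β m)) := by
    have key : ∀ (α γ : Fin N × Fin D → ℝ) (x : X),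
        ∑ q : Σ _ : Fin N × Fin D, Σ _ : Bool, Bool,
          cond q.2.2 (cond q.2.1 (α q.1) (γ q.1)) (-cond q.2.1 (α q.1) (γ q.1)) *
            signPairs (z q.1) q.2 x = ∑ t, (α t * y t x + γ t * z t false x) := by
      intro α γ x
      rw [Fintype.sum_sigma]
      refine Finset.sum_congr rfl fun t _ => ?_
      rw [sum_signPairs (z t) (fun s => cond s (α t) (γ t)) x]
      simp [hz]
    have h := step_signPairs (c := c) (u := frontFun xc p V β m)
      (G := fun q : Σ _ : Fin N × Fin D, Σ _ : Bool, Bool => signPairs (z q.1) q.2) (fun i => ?_)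
    · refine h.mono (le_of_eq ?_)
      simp [Fintype.card_sigma]
      try ring
    · rcases i with ⟨k, i⟩ | k
      · refine ⟨fun q => cond q.2.2
          (cond q.2.1 (if q.1.1 = k then V k i q.1.2 else 0) 0)
          (-cond q.2.1 (if q.1.1 = k then V k i q.1.2 else 0) 0), 0, ?_, c0, fun x => ?_⟩
        rotate_left
        · rw [key (fun t => if t.1 = k then V k i t.2 else 0) (fun _ => 0) x]
          simp only [frontFun, Fintype.sum_prod_type, zero_mul, add_zero, hy, ite_mul]
          rw [Finset.sum_comm]
          simp
        · rintro ⟨t, s, b⟩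
          have := hV k i t.2
          by_cases ht : t.1 = k <;> cases b <;> cases s <;> simp [ht] <;> linarith
      · refine ⟨fun q => cond q.2.2 (cond q.2.1 0 (if q.1.1 = k then 1 else 0))
          (-cond q.2.1 0 (if q.1.1 = k then 1 else 0)), 0, ?_, c0, fun x => ?_⟩
        rotate_left
        · rw [key (fun _ => 0) (fun t => if t.1 = k then 1 else 0) x]
          simp only [frontFun, Fintype.sum_prod_type, zero_mul, zero_add, add_zero, hz, hy, ite_mul,
            one_mul, cond_false]
          rw [Finset.sum_comm]
          simp
        · rintro ⟨t, s, b⟩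
          by_cases ht : t.1 = k <;> cases b <;> cases s <;> simp [ht] <;> linarith
  have h4 := Chain.snoc (Chain.trans (h2'.mono (w' := frontCost N d * D) ?_)
    (h1'.mono (w' := frontCost N d * D) ?_)) (h3.mono (w' := frontCost N d * D) ?_)
  · rw [max_self] at h4
    convert h4 using 1
    ring
  · unfold frontCost; nlinarith [Nat.zero_le ((N * d + N) * (2 * (N * 4 + 1)) * D)]
  · unfold frontCost; nlinarith [Nat.zero_le ((N * d + N) * (2 * (N * 4 + 1)) * D)]
  · unfold frontCost
    calc (N * d + N) * (2 * (N * D * 4 + 1)) ≤ (N * d + N) * (2 * ((N * 4 + 1) * D)) := by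
          gcongr; nlinarith
      _ ≤ _ := by nlinarith [Nat.zero_le (48 * N * D)]

end Front

section Terms

variable {X : Type*} {c : ℝ} {N d s : ℕ}

/-- `1` minus the bump function: `0` for `u ≤ 1 / 2`, and `1` for `u ≥ 3 / 4`. -/
noncomputable def coBump (u : ℝ) : ℝ := max 0 (1 - max 0 (3 - 4 * u))

/-- The hat function. -/
noncomputable def hat (t : ℝ) : ℝ := max 0 (1 - |t|)

/-- The truncation to `[-1, 1]`. -/
noncomputable def clamp (t : ℝ) : ℝ := max 0 (1 - max 0 (-t)) - max 0 (1 - max 0 t)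

/-- The index set of the local monomials: a centre, a grid cell, and a list of coordinates. -/
abbrev TermIdx (N d s R : ℕ) : Type :=
  Fin N × (Fin d → Fin (2 * R + 1)) × (Σ κ : Fin (s + 1), Fin κ → Fin d)

/-- The coordinates of a grid point. -/
noncomputable def gridPt {q : ℕ} (z : Fin d → Fin (2 * 2 ^ q + 1)) (i : Fin d) : ℝ :=
  (z i : ℝ) * (1 / 2) ^ q - 1

/-- The factors of the local monomial with a given index, as functions of the features `u`. -/
noncomputable def termFactors (q e : ℕ) (u : (Fin N × Fin d) ⊕ Fin N → X → ℝ) :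
    TermIdx N d s (2 ^ q) → List (X → ℝ)
  | (k, z, ⟨_, J⟩) =>
    ((Finset.univ.filter (· < k)).toList.map fun l x => coBump (2 ^ e * u (.inr l) x)) ++
    ((fun x => 1 - coBump (2 ^ e * u (.inr k) x)) ::
    ((Finset.univ.toList.map fun i x => hat (2 ^ q * (u (.inl (k, i)) x - gridPt z i))) ++
    (Finset.univ.toList.map fun l x => clamp (2 ^ q * (u (.inl (k, J l)) x - gridPt z (J l))))))

lemma length_termFactors_le (q e : ℕ) (u : (Fin N × Fin d) ⊕ Fin N → X → ℝ)
    (T : TermIdx N d s (2 ^ q)) : (termFactors q e u T).length ≤ N + 1 + d + s := by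
  obtain ⟨k, z, κ, J⟩ := T
  simp only [termFactors, List.length_append, List.length_map, Finset.length_toList,
    List.length_cons, Finset.card_univ, Fintype.card_fin]
  have h1 : (Finset.univ.filter (· < k)).card ≤ N := by
    simpa using Finset.card_filter_le (Finset.univ : Finset (Fin N)) (· < k)
  have h2 := κ.2
  omega

lemma coBump_mem (u : ℝ) : 0 ≤ coBump u ∧ coBump u ≤ 1 := by
  refine ⟨le_max_left _ _, max_le zero_le_one ?_⟩
  linarith [le_max_left 0 (3 - 4 * u)]

lemma hat_mem (t : ℝ) : 0 ≤ hat t ∧ hat t ≤ 1 := by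
  refine ⟨le_max_left _ _, max_le zero_le_one ?_⟩
  linarith [abs_nonneg t]

lemma abs_clamp_le (t : ℝ) : |clamp t| ≤ 1 := by
  unfold clamp
  have h1 : max 0 (1 - max 0 (-t)) ≤ 1 := max_le zero_le_one (by linarith [le_max_left 0 (-t)])
  have h2 : max 0 (1 - max 0 t) ≤ 1 := max_le zero_le_one (by linarith [le_max_left 0 t])
  have h3 := le_max_left 0 (1 - max 0 (-t))
  have h4 := le_max_left 0 (1 - max 0 t)
  exact abs_le.2 ⟨by linarith, by linarith⟩

lemma clamp_eq_self {t : ℝ} (ht : |t| ≤ 1) : clamp t = t := by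
  rw [abs_le] at ht
  unfold clamp
  rcases le_total 0 t with h | h
  · rw [max_eq_left (by linarith : -t ≤ 0), max_eq_right h, max_eq_right (by linarith),
      max_eq_right (by linarith)]
    ring
  · rw [max_eq_right (by linarith : 0 ≤ -t), max_eq_left h, max_eq_right (by linarith),
      max_eq_right (by linarith)]
    ring

/-- The cost of a layer in the computation of one factor. -/
def factorCost (N d : ℕ) : ℕ := 4 * (2 * (N * d + N) + 1) + 12

lemma abs_gridPt_le {q : ℕ} (z : Fin d → Fin (2 * 2 ^ q + 1)) (i : Fin d) : |gridPt z i| ≤ 1 := by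
  have h1 : ((z i : ℕ) : ℝ) ≤ 2 * 2 ^ q := by
    have := (z i).2
    exact_mod_cast Nat.lt_succ_iff.1 this
  have h2 : (2 : ℝ) ^ q * (1 / 2) ^ q = 1 := by rw [← mul_pow]; norm_num
  have h3 : ((z i : ℕ) : ℝ) * (1 / 2) ^ q ≤ 2 * 2 ^ q * (1 / 2) ^ q := by gcongr
  have h4 : 0 ≤ ((z i : ℕ) : ℝ) * (1 / 2) ^ q := by positivity
  unfold gridPt
  rw [abs_le]
  constructor <;> linarith

lemma comp_termFactors (hc : 4 ≤ c) (q e : ℕ) (u : (Fin N × Fin d) ⊕ Fin N → X → ℝ)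
    (T : TermIdx N d s (2 ^ q)) : ∀ f ∈ termFactors q e u T,
      Comp c (factorCost N d) (q + e + 5) (signPairs u) f ∧ ∀ x, |f x| ≤ 1 := by
  obtain ⟨k, z, κ, J⟩ := T
  have c0 : |(0 : ℝ)| ≤ c := by simp; linarith
  have c1 : |(1 : ℝ)| ≤ c := by simp; linarith
  have c1' : |(-1 : ℝ)| ≤ c := by simp; linarith
  have c3 : |(3 : ℝ)| ≤ c := by rw [abs_of_pos (by norm_num)]; linarith
  have c4 : |(-4 : ℝ)| ≤ c := by rw [abs_neg, abs_of_pos (by norm_num)]; linarith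
  have hbase : ∀ i, Comp c (2 * (2 * (N * d + N) + 1)) 0 (signPairs u) (u i) := fun i => by
    simpa using comp_of_signPairs (c := c) (by linarith) u i
  have hco : ∀ l, Comp c (factorCost N d) (e + 4) (signPairs u)
      (fun x => coBump (2 ^ e * u (.inr l) x)) := by
    intro l
    have h := (((((hbase (.inr l)).two_pow_mul (by linarith) e).affine (-4) 3 c4 c3).relu
      (by linarith)).affine (-1) 1 c1' c1).relu (by linarith)
    refine h.congr (by unfold factorCost; omega) (by omega) fun x => ?_
    simp only [coBump]
    ring_nf
  have ht : ∀ i, Comp c (max (2 * (2 * (N * d + N) + 1)) 6) (1 + q) (signPairs u)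
      (fun x => 2 ^ q * (u (.inl (k, i)) x - gridPt z i)) := by
    intro i
    have h := ((hbase (.inl (k, i))).affine 1 (-gridPt z i) c1
      (by rw [abs_neg]; exact (abs_gridPt_le z i).trans (by linarith))).two_pow_mul (by linarith) q
    exact h.congr (by omega) (by omega) fun x => by ring
  have hpad : ∀ {L : ℕ} {f : X → ℝ}, Comp c (factorCost N d) L (signPairs u) f → L ≤ q + e + 5 →
      Comp c (factorCost N d) (q + e + 5) (signPairs u) f := by
    intro L f h hL
    exact (h.pad (by linarith) hL).mono (by unfold factorCost; omega)
  intro f hf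
  simp only [termFactors, List.mem_append, List.mem_cons, List.mem_map, Finset.mem_toList] at hf
  rcases hf with ⟨l, -, rfl⟩ | rfl | ⟨i, -, rfl⟩ | ⟨l, -, rfl⟩
  · refine ⟨hpad (hco l) (by omega), fun x => ?_⟩
    have := coBump_mem (2 ^ e * u (.inr l) x)
    exact abs_le.2 ⟨by linarith, this.2⟩
  · have h := (hco k).affine (-1) 1 c1' c1
    refine ⟨hpad ?_ (by omega : e + 5 ≤ q + e + 5), fun x => ?_⟩
    · exact h.congr (by unfold factorCost; omega) rfl fun x => by ring
    · have := coBump_mem (2 ^ e * u (.inr k) x)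
      exact abs_le.2 ⟨by linarith, by linarith⟩
  · have h := (((ht i).abs (by linarith)).affine (-1) 1 c1' c1).relu (by linarith)
    refine ⟨hpad ?_ (by omega : q + 4 ≤ q + e + 5), fun x => ?_⟩
    · exact h.congr (by unfold factorCost; omega) (by omega) fun x => by simp only [hat]; ring_nf
    · have := hat_mem (2 ^ q * (u (.inl (k, i)) x - gridPt z i))
      exact abs_le.2 ⟨by linarith, this.2⟩
  · have hA := ((ht (J l)).unary (v := fun x =>
      1 - max 0 (-(2 ^ q * (u (.inl (k, J l)) x - gridPt z (J l))))) 0 (-1) 1 c0 c1' c1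
      (fun x => by ring)).relu (by linarith)
    have hB := ((ht (J l)).unary (v := fun x =>
      1 - max 0 (2 ^ q * (u (.inl (k, J l)) x - gridPt z (J l)))) (-1) 0 1 c1' c0 c1
      (fun x => by ring)).relu (by linarith)
    have h := Comp.lin (by linarith) hA hB 1 (-1) 0 c1 c1' c0
    refine ⟨hpad ?_ (by omega : q + 4 ≤ q + e + 5), fun x => abs_clamp_le _⟩
    exact h.congr (by unfold factorCost; omega) (by omega) fun x => by simp only [clamp]; ring

lemma prodCost_mono (w : ℕ) : Monotone (prodCost w) :=
  monotone_nat_of_le_succ fun n => by simp only [prodCost]; omega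

lemma six_le_prodCost (w n : ℕ) : 6 ≤ prodCost w n := prodCost_mono w (Nat.zero_le n)

/-- A network that computes all approximate local monomials, followed by an arbitrary linear
combination. -/
theorem exists_net_terms {D : ℕ} (hc : 4 ≤ c) (hD : 1 ≤ D) (xc : Fin D → X → ℝ)
    (p : Fin N → Fin D → ℝ) (V : Fin N → Fin d → Fin D → ℝ) (s β m e q m' w : ℕ)
    (hp : ∀ k j, |p k j| ≤ c) (hV : ∀ k i j, |V k i j| ≤ 1)
    (hx : ∀ k j x, |xc j x - p k j| ≤ 2 ^ β) (hw1 : frontCost N d * D ≤ w)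
    (hw2 : Fintype.card (TermIdx N d s (2 ^ q)) *
      prodCost (factorCost N d) (N + 1 + d + s) ≤ w) :
    ∃ hidden : List ℕ, hidden.length = m + q + e + (N + 1 + d + s) * (m' + 5) + 13 ∧
      (∀ a ∈ hidden, a ≤ w) ∧
      ∀ a : TermIdx N d s (2 ^ q) → ℝ, (∀ T, |a T| ≤ 1) → ∃ Φ : ReLUNet D,
        Φ.hiddenWidths = hidden ∧ Φ.depth = m + q + e + (N + 1 + d + s) * (m' + 5) + 14 ∧
        Φ.WeightsBoundedBy c ∧
        Φ.numNonzero ≤ (m + q + e + (N + 1 + d + s) * (m' + 5) + 14) * w ∧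
        ∀ x, Φ.eval (fun j => xc j x) = ∑ T, a T * prodApprox m'
          ((termFactors q e (frontFun xc p V β m) T).map fun f => f x) := by
  set u := frontFun xc p V β m with hu
  set n := N + 1 + d + s with hn
  set P : TermIdx N d s (2 ^ q) → X → ℝ := fun T x =>
    prodApprox m' ((termFactors q e u T).map fun f => f x) with hP
  have h1 := chain_front (by linarith) hD xc p V β m hp hV hx
  have h2 : ∀ T, Comp c (prodCost (factorCost N d) n) (q + e + 5 + n * (m' + 5)) (signPairs u)
      (P T) := by
    intro T
    have hlen := length_termFactors_le q e u T
    have h := Comp.prod (by linarith) m' (termFactors q e u T) (comp_termFactors hc q e u T)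
    have h' := h.pad (L' := q + e + 5 + n * (m' + 5)) (by linarith) (by gcongr)
    exact h'.mono (max_le (prodCost_mono _ hlen) (six_le_prodCost _ _))
  have h3 := chain_signPairs (by linarith) h2
  have h4 := Chain.trans (h3.mono (w' := w) (by simpa using hw2)) (h1.mono (w' := w) hw1)
  obtain ⟨hidden, hl, hle, hnet⟩ := h4.exists_net (by linarith)
  refine ⟨hidden, by rw [hl]; ring, hle, fun a ha => ?_⟩
  have hab : ∀ p : Σ _ : TermIdx N d s (2 ^ q), Bool, |cond p.2 (a p.1) (-a p.1)| ≤ c := by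
    rintro ⟨T, b⟩
    have := ha T
    cases b <;> simp <;> linarith
  obtain ⟨Φ, e1, e2, e3, e4, e5⟩ := hnet _ hab
  refine ⟨Φ, e1, by rw [e2]; ring, e3, ?_, fun x => ?_⟩
  · convert e4 using 2; ring
  · rw [e5 x, sum_signPairs]

end Terms

section Taylor

lemma abs_sub_taylor_le_of_hasDerivAt {η : ℝ} : ∀ {s : ℕ} {φ : ℕ → ℝ → ℝ},
    (∀ k < s, ∀ t ∈ Icc (0 : ℝ) 1, HasDerivAt (φ k) (φ (k + 1) t) t) →
    (∀ t ∈ Icc (0 : ℝ) 1, |φ s t - φ s 0| ≤ η) →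
    ∀ t ∈ Icc (0 : ℝ) 1,
      |φ 0 t - ∑ k ∈ Finset.range (s + 1), φ k 0 * t ^ k / (k.factorial : ℝ)| ≤ η
  | 0, φ, _, h, t, ht => by simpa using h t ht
  | s + 1, φ, hd, h, t, ht => by
    have hη : 0 ≤ η := (abs_nonneg _).trans (h 0 ⟨le_rfl, zero_le_one⟩)
    have ih := abs_sub_taylor_le_of_hasDerivAt (s := s) (φ := fun k => φ (k + 1))
      (fun k hk => hd (k + 1) (by omega)) h
    set R : ℝ → ℝ := fun t => φ 0 t - ∑ k ∈ Finset.range (s + 1 + 1),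
      φ k 0 * t ^ k / (k.factorial : ℝ) with hR
    set R' : ℝ → ℝ := fun t => φ 1 t - ∑ k ∈ Finset.range (s + 1),
      φ (k + 1) 0 * t ^ k / (k.factorial : ℝ) with hR'
    have hderiv : ∀ t ∈ Icc (0 : ℝ) 1, HasDerivAt R (R' t) t := by
      intro t ht
      have h1 : HasDerivAt (fun t : ℝ => ∑ k ∈ Finset.range (s + 1 + 1),
          φ k 0 * t ^ k / (k.factorial : ℝ))
          (∑ k ∈ Finset.range (s + 1 + 1), φ k 0 * (k * t ^ (k - 1)) / (k.factorial : ℝ)) t :=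
        HasDerivAt.fun_sum fun k _ => ((hasDerivAt_pow k t).const_mul _).div_const _
      have h2 : ∑ k ∈ Finset.range (s + 1 + 1), φ k 0 * (k * t ^ (k - 1)) / (k.factorial : ℝ) =
          ∑ k ∈ Finset.range (s + 1), φ (k + 1) 0 * t ^ k / (k.factorial : ℝ) := by
        rw [Finset.sum_range_succ']
        simp only [Nat.cast_zero, zero_mul, mul_zero, zero_div, add_zero, Nat.add_sub_cancel]
        refine Finset.sum_congr rfl fun k _ => ?_
        rw [Nat.factorial_succ]
        push_cast
        have : (k : ℝ) + 1 ≠ 0 := by positivity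
        field_simp
      rw [h2] at h1
      exact (hd 0 (by omega) t ht).sub h1
    have hR0 : R 0 = 0 := by
      simp only [hR]
      rw [Finset.sum_range_succ']
      simp
    have hmv := (convex_Icc (0 : ℝ) 1).norm_image_sub_le_of_norm_hasDerivWithin_le
      (fun t ht => (hderiv t ht).hasDerivWithinAt) (fun t ht => ih t ht)
      (left_mem_Icc.2 zero_le_one) ht
    rw [hR0, sub_zero, sub_zero, Real.norm_eq_abs, Real.norm_of_nonneg ht.1] at hmv
    exact hmv.trans (by nlinarith [ht.2])

variable {d : ℕ}

lemma iteratedFDeriv_apply_eq_sum (g : EuclideanSpace ℝ (Fin d) → ℝ)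
    (θ v : EuclideanSpace ℝ (Fin d)) (k : ℕ) :
    iteratedFDeriv ℝ k g θ (fun _ => v) =
      ∑ J : Fin k → Fin d, partialDeriv J g θ * ∏ l, v (J l) := by
  have hv : v = ∑ j, v j • EuclideanSpace.single j (1 : ℝ) := by
    have := (EuclideanSpace.basisFun (Fin d) ℝ).sum_repr v
    simpa using this.symm
  conv_lhs => rw [hv]
  have h1 := (iteratedFDeriv ℝ k g θ).toMultilinearMap.map_sum
    (fun (_ : Fin k) (j : Fin d) => v j • EuclideanSpace.single j (1 : ℝ))
  simp only [ContinuousMultilinearMap.coe_coe] at h1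
  rw [h1]
  refine Finset.sum_congr rfl fun J _ => ?_
  rw [ContinuousMultilinearMap.map_smul_univ, smul_eq_mul, mul_comm]
  rfl

lemma prod_abs_le_pow {h : ℝ} {v : EuclideanSpace ℝ (Fin d)} (hv : ∀ i, |v i| ≤ h) {k : ℕ}
    (J : Fin k → Fin d) : ∏ l, |v (J l)| ≤ h ^ k := by
  calc ∏ l, |v (J l)| ≤ ∏ _l : Fin k, h :=
        Finset.prod_le_prod (fun _ _ => abs_nonneg _) fun l _ => hv (J l)
    _ = h ^ k := by simp

/-- Multivariate Taylor expansion with a remainder controlled by the oscillation of the derivatives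
of the highest order. -/
lemma abs_sub_taylor_le {g : EuclideanSpace ℝ (Fin d) → ℝ} {U : Set (EuclideanSpace ℝ (Fin d))}
    (hU : IsOpen U) {s : ℕ} (hg : ContDiffOn ℝ s g U) {θ v : EuclideanSpace ℝ (Fin d)}
    (hseg : ∀ t ∈ Icc (0 : ℝ) 1, θ + t • v ∈ U) {η h : ℝ} (hv : ∀ i, |v i| ≤ h) (hh : 0 ≤ h)
    (hη : ∀ J : Fin s → Fin d, ∀ t ∈ Icc (0 : ℝ) 1,
      |partialDeriv J g (θ + t • v) - partialDeriv J g θ| ≤ η) :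
    |g (θ + v) - ∑ k ∈ Finset.range (s + 1), (∑ J : Fin k → Fin d,
      partialDeriv J g θ * ∏ l, v (J l)) / (k.factorial : ℝ)| ≤ d ^ s * (h ^ s * η) := by
  set φ : ℕ → ℝ → ℝ := fun k t => iteratedFDeriv ℝ k g (θ + t • v) (fun _ => v) with hφ
  have hderiv : ∀ k < s, ∀ t ∈ Icc (0 : ℝ) 1, HasDerivAt (φ k) (φ (k + 1) t) t := by
    intro k hk t ht
    have hcd : ContDiffAt ℝ s g (θ + t • v) := hg.contDiffAt (hU.mem_nhds (hseg t ht))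
    have h1 : DifferentiableAt ℝ (iteratedFDeriv ℝ k g) (θ + t • v) :=
      hcd.differentiableAt_iteratedFDeriv (by exact_mod_cast hk)
    have h2 : HasDerivAt (fun t : ℝ => θ + t • v) v t := by
      simpa using ((hasDerivAt_id t).smul_const v).const_add θ
    have h3 := h1.hasFDerivAt.comp_hasDerivAt t h2
    have h4 := (ContinuousMultilinearMap.apply ℝ (fun _ : Fin k => EuclideanSpace ℝ (Fin d)) ℝ
      (fun _ => v)).hasFDerivAt.comp_hasDerivAt t h3
    exact h4
  have hosc : ∀ t ∈ Icc (0 : ℝ) 1, |φ s t - φ s 0| ≤ d ^ s * (h ^ s * η) := by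
    intro t ht
    simp only [hφ, zero_smul, add_zero, iteratedFDeriv_apply_eq_sum]
    rw [← Finset.sum_sub_distrib]
    calc _ ≤ ∑ J : Fin s → Fin d, |partialDeriv J g (θ + t • v) * ∏ l, v (J l) -
          partialDeriv J g θ * ∏ l, v (J l)| := Finset.abs_sum_le_sum_abs _ _
      _ ≤ ∑ _J : Fin s → Fin d, h ^ s * η := by
          refine Finset.sum_le_sum fun J _ => ?_
          rw [← sub_mul, abs_mul, mul_comm, Finset.abs_prod]
          have := hη J t ht
          gcongr
          exact prod_abs_le_pow hv J
      _ = _ := by simp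
  have := abs_sub_taylor_le_of_hasDerivAt hderiv hosc 1 ⟨zero_le_one, le_rfl⟩
  simp only [hφ, zero_smul, one_smul, add_zero, one_pow, mul_one,
    iteratedFDeriv_apply_eq_sum] at this
  simpa [iteratedFDeriv_zero_apply, partialDeriv] using this

end Taylor

section Partition

lemma sum_prod_mul_one_sub {N : ℕ} (b : Fin N → ℝ) :
    ∑ k, (∏ l ∈ Finset.univ.filter (· < k), b l) * (1 - b k) = 1 - ∏ k, b k := by
  have h := Finset.prod_one_sub_ordered Finset.univ fun k => 1 - b k
  simp only [sub_sub_cancel] at h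
  rw [h, sub_sub_cancel]
  exact Finset.sum_congr rfl fun k _ => mul_comm _ _

lemma hat_eq (t : ℝ) :
    hat t = (max 0 (t + 1) - max 0 t) - (max 0 t - max 0 (t - 1)) := by
  unfold hat
  rcases le_total t 0 with h | h
  · rw [abs_of_nonpos h, max_eq_left h, max_eq_left (by linarith : t - 1 ≤ 0)]
    ring_nf
  · rw [abs_of_nonneg h, max_eq_right h, max_eq_right (by linarith : 0 ≤ t + 1)]
    rcases le_total t 1 with h1 | h1
    · rw [max_eq_right (by linarith), max_eq_left (by linarith)]; ring
    · rw [max_eq_left (by linarith), max_eq_right (by linarith)]; ring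

lemma sum_hat {n : ℕ} {y : ℝ} (h0 : 0 ≤ y) (h1 : y ≤ n) :
    ∑ z ∈ Finset.range (n + 1), hat (y - z) = 1 := by
  have h : ∀ n : ℕ, ∑ z ∈ Finset.range n, hat (y - z) =
      (max 0 (y + 1) - max 0 y) - (max 0 (y - n + 1) - max 0 (y - n)) := by
    intro n
    induction n with
    | zero => simp
    | succ n ih =>
      rw [Finset.sum_range_succ, ih, hat_eq]
      push_cast
      have e1 : y - (n + 1) + 1 = y - n := by ring
      have e2 : y - n - 1 = y - (n + 1) := by ring
      rw [e1, e2]; ring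
  rw [h]
  push_cast
  rw [max_eq_right (by linarith), max_eq_right h0, max_eq_left (by linarith),
    max_eq_left (by linarith)]
  ring

variable {d : ℕ}

lemma sum_prod_hat (q : ℕ) {u : Fin d → ℝ} (hu : ∀ i, |u i| ≤ 1) :
    ∑ z : Fin d → Fin (2 * 2 ^ q + 1), ∏ i, hat (2 ^ q * (u i - gridPt z i)) = 1 := by
  have hpow : (2 : ℝ) ^ q * (1 / 2) ^ q = 1 := by rw [← mul_pow]; norm_num
  have h1 : ∀ i, ∑ z : Fin (2 * 2 ^ q + 1), hat (2 ^ q * (u i + 1) - (z : ℕ)) = 1 := by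
    intro i
    have hb := abs_le.1 (hu i)
    have hp : (0 : ℝ) < 2 ^ q := by positivity
    have := sum_hat (n := 2 * 2 ^ q) (y := 2 ^ q * (u i + 1)) (by nlinarith)
      (by push_cast; nlinarith)
    rw [Finset.sum_range] at this
    exact this
  have h2 : ∀ (z : Fin d → Fin (2 * 2 ^ q + 1)) (i : Fin d),
      hat (2 ^ q * (u i - gridPt z i)) = hat (2 ^ q * (u i + 1) - (z i : ℕ)) := by
    intro z i
    congr 1
    unfold gridPt
    linear_combination (-(z i : ℝ)) * hpow
  simp only [h2]
  have := Finset.prod_univ_sum (fun _ : Fin d => (Finset.univ : Finset (Fin (2 * 2 ^ q + 1))))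
    (fun i z => hat (2 ^ q * (u i + 1) - (z : ℕ)))
  rw [Fintype.piFinset_univ] at this
  rw [← this]
  simp [h1]

end Partition

section Approximation

lemma prod_termFactors {X : Type*} {N d s : ℕ} (q e : ℕ)
    (u : (Fin N × Fin d) ⊕ Fin N → X → ℝ) (k : Fin N) (z : Fin d → Fin (2 * 2 ^ q + 1))
    (κ : Fin (s + 1)) (J : Fin κ → Fin d) (x : X) :
    ((termFactors q e u (k, z, ⟨κ, J⟩)).map fun f => f x).prod =
      (∏ l ∈ Finset.univ.filter (· < k), coBump (2 ^ e * u (.inr l) x)) *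
        (1 - coBump (2 ^ e * u (.inr k) x)) *
        (∏ i, hat (2 ^ q * (u (.inl (k, i)) x - gridPt z i))) *
        ∏ l, clamp (2 ^ q * (u (.inl (k, J l)) x - gridPt z (J l))) := by
  simp only [termFactors, List.map_append, List.map_cons, List.map_map, Function.comp_def,
    List.prod_append, List.prod_cons, Finset.prod_map_toList]
  ring

lemma coBump_eq_zero {u : ℝ} (h : u ≤ 1 / 2) : coBump u = 0 := by
  unfold coBump
  rw [max_eq_right (by linarith : 0 ≤ 3 - 4 * u), max_eq_left (by linarith)]

lemma coBump_eq_one {u : ℝ} (h : 3 / 4 ≤ u) : coBump u = 1 := by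
  unfold coBump
  rw [max_eq_left (by linarith : 3 - 4 * u ≤ 0), max_eq_right (by linarith)]
  ring

lemma abs_lt_one_of_hat_ne_zero {t : ℝ} (h : hat t ≠ 0) : |t| < 1 := by
  by_contra hcon
  push Not at hcon
  exact h (max_eq_left (by linarith))

lemma norm_le_of_abs_le {d : ℕ} {h : ℝ} {v : EuclideanSpace ℝ (Fin d)}
    (hv : ∀ i, |v i| ≤ h) : ‖v‖ ≤ d * h := by
  have hv' : v = ∑ j, v j • EuclideanSpace.single j (1 : ℝ) := by
    have := (EuclideanSpace.basisFun (Fin d) ℝ).sum_repr v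
    simpa using this.symm
  calc ‖v‖ = ‖∑ j, v j • EuclideanSpace.single j (1 : ℝ)‖ := congrArg norm hv'
    _ ≤ ∑ j, ‖v j • EuclideanSpace.single j (1 : ℝ)‖ := norm_sum_le _ _
    _ ≤ ∑ _j : Fin d, h := Finset.sum_le_sum fun j _ => by
        rw [norm_smul]; simpa using hv j
    _ = d * h := by simp

variable {d D m N : ℕ} {M : Set (EuclideanSpace ℝ (Fin D))} {A : TangentAtlas d M m}

/-- The features of a cover. -/
noncomputable def GoodCover.front {r δ : ℝ} (C : GoodCover A N r δ) (β m' : ℕ) :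
    (Fin N × Fin d) ⊕ Fin N → M → ℝ :=
  frontFun (fun j (x : M) => (x : EuclideanSpace ℝ (Fin D)) j) (fun k j => C.pt k j)
    (fun k i j => (A.chart (C.idx k)).frame i j) β m'

lemma GoodCover.front_inl {r δ : ℝ} (C : GoodCover A N r δ) (β m' : ℕ) (k : Fin N) (i : Fin d)
    (x : M) : C.front β m' (.inl (k, i)) x =
      (A.chart (C.idx k)).proj x i - (A.chart (C.idx k)).proj (C.pt k) i := by
  have h := congrArg (fun v => v i) ((A.chart (C.idx k)).proj_sub_proj x (C.pt k))
  simp only [PiLp.sub_apply] at h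
  rw [h, TangentChart.projL_apply]
  simp [GoodCover.front, frontFun, PiLp.inner_apply, mul_comm]

lemma GoodCover.front_inr {r δ : ℝ} (C : GoodCover A N r δ) {β m' a : ℕ} (k : Fin N) (x : M)
    (hβ : ∀ j, |(x : EuclideanSpace ℝ (Fin D)) j - C.pt k j| ≤ 2 ^ β)
    (hm' : (D : ℝ) * 4 ^ (β + a + 1) ≤ 4 ^ m') :
    |2 ^ (2 * β + 2 * a) * C.front β m' (.inr k) x -
      4 ^ a * ‖(x : EuclideanSpace ℝ (Fin D)) - C.pt k‖ ^ 2| ≤ 1 / 4 := by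
  have hpow : (1 / 2 : ℝ) ^ β * 2 ^ β = 1 := by rw [← mul_pow]; norm_num
  have h4 : (2 : ℝ) ^ (2 * β + 2 * a) = 4 ^ a * (2 ^ β) ^ 2 := by
    rw [pow_add, pow_mul 2 2 a, mul_comm 2 β, pow_mul]; norm_num [mul_comm]
  have hterm : ∀ j, |(2 ^ β) ^ 2 * sqApprox m' |(1 / 2) ^ β *
      ((x : EuclideanSpace ℝ (Fin D)) j - C.pt k j)| -
        ((x : EuclideanSpace ℝ (Fin D)) j - C.pt k j) ^ 2| ≤ (2 ^ β) ^ 2 * (1 / 4) ^ m' := by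
    intro j
    set y := (x : EuclideanSpace ℝ (Fin D)) j - C.pt k j with hy
    have hv1 : |(1 / 2) ^ β * y| ≤ 1 := by
      calc |(1 / 2) ^ β * y| = (1 / 2) ^ β * |y| := by rw [abs_mul, abs_of_pos (by positivity)]
        _ ≤ (1 / 2) ^ β * 2 ^ β := by gcongr; exact hβ j
        _ = 1 := hpow
    obtain ⟨h1, -, h2⟩ := sqApprox_bounds m' (abs_nonneg _) hv1
    have hsq : |(1 / 2) ^ β * y| ^ 2 * (2 ^ β) ^ 2 = y ^ 2 := by
      rw [sq_abs]
      calc _ = ((1 / 2) ^ β * 2 ^ β) ^ 2 * y ^ 2 := by ring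
        _ = y ^ 2 := by rw [hpow]; ring
    have hp : (0 : ℝ) < (2 ^ β) ^ 2 := by positivity
    rw [← hsq, abs_le]
    constructor
    · have : (0 : ℝ) ≤ (1 / 4) ^ m' := by positivity
      nlinarith
    · nlinarith
  have hnorm : ‖(x : EuclideanSpace ℝ (Fin D)) - C.pt k‖ ^ 2 =
      ∑ j, ((x : EuclideanSpace ℝ (Fin D)) j - C.pt k j) ^ 2 := by
    rw [EuclideanSpace.norm_sq_eq]
    simp
  rw [hnorm, h4, mul_assoc, ← mul_sub, GoodCover.front, frontFun, Finset.mul_sum,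
    ← Finset.sum_sub_distrib, abs_mul, abs_of_pos (by positivity)]
  calc (4 : ℝ) ^ a * |∑ j, _| ≤ 4 ^ a * ∑ _j : Fin D, ((2 ^ β) ^ 2 * (1 / 4) ^ m') := by
        gcongr
        exact (Finset.abs_sum_le_sum_abs _ _).trans (Finset.sum_le_sum fun j _ => hterm j)
    _ = (D * 4 ^ (β + a + 1)) * (1 / 4) ^ m' / 4 := by
        rw [Finset.sum_const, Finset.card_univ, Fintype.card_fin, nsmul_eq_mul, ← pow_mul,
          mul_comm β 2, pow_mul, pow_succ, pow_add]
        ring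
    _ ≤ 4 ^ m' * (1 / 4) ^ m' / 4 := by gcongr
    _ = 1 / 4 := by rw [← mul_pow]; norm_num

/-- Linear combinations of the exact local monomials approximate Hölder functions. -/
theorem GoodCover.exists_coeff {a : ℕ} {δ : ℝ} (C : GoodCover A N ((1 / 2) ^ a) δ)
    (hδ : 4 * (1 / 2 : ℝ) ^ a ≤ δ) (hd : 1 ≤ d) {s : ℕ} {α : ℝ} (hα : 0 < α) (hα1 : α ≤ 1)
    {f : EuclideanSpace ℝ (Fin D) → ℝ} (hf : IsHolder A s α f) {β m' q : ℕ}
    (hβ : ∀ k j, ∀ x ∈ M, |x j - C.pt k j| ≤ 2 ^ β)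
    (hm' : (D : ℝ) * 4 ^ (β + a + 1) ≤ 4 ^ m') (hq : (d : ℝ) * (1 / 2) ^ q ≤ δ / 4) :
    ∃ b : TermIdx N d s (2 ^ q) → ℝ, (∀ T, |b T| ≤ 1) ∧ ∀ x : M,
      |∑ T, b T * ((termFactors q (2 * β + 2 * a) (C.front β m') T).map fun g => g x).prod - f x| ≤
        d ^ (s + 1) * ((1 / 2 : ℝ) ^ q) ^ ((s : ℝ) + α) := by
  classical
  set h : ℝ := (1 / 2) ^ q with hh
  have hh0 : 0 < h := by positivity
  have hh1 : h ≤ 1 := pow_le_one₀ (by norm_num) (by norm_num)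
  have h2h : 2 ^ q * h = 1 := by rw [hh, ← mul_pow]; norm_num
  have hr0 : (0 : ℝ) < (1 / 2) ^ a := by positivity
  set φ : Fin N → TangentChart d M := fun k => A.chart (C.idx k) with hφ
  set θ : ∀ _ : Fin N, (Fin d → Fin (2 * 2 ^ q + 1)) → EuclideanSpace ℝ (Fin d) := fun k z =>
    WithLp.toLp 2 fun i => (φ k).proj (C.pt k) i + gridPt z i with hθ
  set e := 2 * β + 2 * a with he
  set b : TermIdx N d s (2 ^ q) → ℝ := fun T =>
    if θ T.1 T.2.1 ∈ Metric.ball ((φ T.1).proj (C.pt T.1)) δ then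
      h ^ (T.2.2.1 : ℕ) * (partialDeriv T.2.2.2 (f ∘ (φ T.1).inv) (θ T.1 T.2.1) /
        ((T.2.2.1 : ℕ).factorial : ℝ)) else 0 with hb
  refine ⟨b, ?_, ?_⟩
  · rintro ⟨k, z, κ, J⟩
    simp only [hb]
    split_ifs with hmem
    · obtain ⟨x, hx, hxθ⟩ := C.ball_subset k hmem
      have h1 := hf.bound (C.idx k) κ (Nat.lt_succ_iff.1 κ.2) J x hx
      have hxθ : (φ k).proj x = θ k z := hxθ
      change |partialDeriv J (f ∘ (φ k).inv) ((φ k).proj x)| ≤ 1 at h1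
      rw [hxθ] at h1
      have hfac : (1 : ℝ) ≤ ((κ : ℕ).factorial : ℝ) := by exact_mod_cast Nat.factorial_pos _
      rw [abs_mul, abs_div, abs_of_pos (by positivity), abs_of_pos (by positivity : (0:ℝ) < ((κ : ℕ).factorial : ℝ))]
      have h2 : h ^ (κ : ℕ) ≤ 1 := pow_le_one₀ hh0.le hh1
      have h3 : |partialDeriv J (f ∘ (φ k).inv) (θ k z)| / ((κ : ℕ).factorial : ℝ) ≤ 1 :=
        (div_le_one (by positivity)).2 (h1.trans hfac)
      exact mul_le_one₀ h2 (by positivity) h3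
    · simp
  intro x
  set u := C.front β m' with hu
  set cb : Fin N → ℝ := fun k => coBump (2 ^ e * u (.inr k) x) with hcb
  set η : Fin N → ℝ := fun k => (∏ l ∈ Finset.univ.filter (· < k), cb l) * (1 - cb k) with hη
  set ht : Fin N → (Fin d → Fin (2 * 2 ^ q + 1)) → ℝ := fun k z =>
    ∏ i, hat (2 ^ q * (u (.inl (k, i)) x - gridPt z i)) with hht
  set Q : Fin N → (Fin d → Fin (2 * 2 ^ q + 1)) → ℝ := fun k z =>
    ∑ p : (Σ κ : Fin (s + 1), Fin κ → Fin d), b (k, z, p) *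
      ∏ l, clamp (2 ^ q * (u (.inl (k, p.2 l)) x - gridPt z (p.2 l))) with hQ
  set E : ℝ := d ^ (s + 1) * h ^ ((s : ℝ) + α) with hE
  have hcb01 : ∀ k, 0 ≤ cb k ∧ cb k ≤ 1 := fun k => coBump_mem _
  have hη0 : ∀ k, 0 ≤ η k := fun k =>
    mul_nonneg (Finset.prod_nonneg fun l _ => (hcb01 l).1) (by linarith [(hcb01 k).2])
  have hht0 : ∀ k z, 0 ≤ ht k z := fun k z => Finset.prod_nonneg fun i _ => (hat_mem _).1
  have hdist : ∀ k, |2 ^ e * u (.inr k) x -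
      4 ^ a * ‖(x : EuclideanSpace ℝ (Fin D)) - C.pt k‖ ^ 2| ≤ 1 / 4 := fun k =>
    C.front_inr k x (fun j => hβ k j x x.2) hm'
  have h4a : (4 : ℝ) ^ a * ((1 / 2) ^ a) ^ 2 = 1 := by
    rw [← pow_mul, mul_comm a 2, pow_mul, ← mul_pow]; norm_num
  have hnear : ∀ k, cb k ≠ 1 → ‖(x : EuclideanSpace ℝ (Fin D)) - C.pt k‖ ≤ (1 / 2) ^ a := by
    intro k hk
    by_contra hcon
    push Not at hcon
    refine hk (coBump_eq_one ?_)
    have h1 : (1 : ℝ) ≤ 4 ^ a * ‖(x : EuclideanSpace ℝ (Fin D)) - C.pt k‖ ^ 2 := by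
      calc (1 : ℝ) = 4 ^ a * ((1 / 2) ^ a) ^ 2 := h4a.symm
        _ ≤ _ := by gcongr
    linarith [(abs_le.1 (hdist k)).1]
  have hηsum : ∑ k, η k = 1 := by
    rw [hη, sum_prod_mul_one_sub cb]
    obtain ⟨k, hk⟩ := C.cover x x.2
    have : cb k = 0 := by
      refine coBump_eq_zero ?_
      have h1 : 4 ^ a * ‖(x : EuclideanSpace ℝ (Fin D)) - C.pt k‖ ^ 2 ≤ 1 / 4 := by
        calc _ ≤ (4 : ℝ) ^ a * ((1 / 2) ^ a / 2) ^ 2 := by gcongr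
          _ = 4 ^ a * ((1 / 2) ^ a) ^ 2 / 4 := by ring
          _ = 1 / 4 := by rw [h4a]
      linarith [(abs_le.1 (hdist k)).2]
    rw [Finset.prod_eq_zero (Finset.mem_univ k) this, sub_zero]
  have hproj : ∀ k i, u (.inl (k, i)) x = (φ k).proj x i - (φ k).proj (C.pt k) i := fun k i =>
    C.front_inl β m' k i x
  have hhtsum : ∀ k, cb k ≠ 1 → ∑ z, ht k z = 1 := by
    intro k hk
    refine sum_prod_hat q fun i => ?_
    rw [hproj, ← PiLp.sub_apply]
    refine (PiLp.norm_apply_le _ i).trans (((φ k).norm_proj_sub_proj_le _ _).trans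
      ((hnear k hk).trans ?_))
    exact pow_le_one₀ (by norm_num) (by norm_num)
  have hlocal : ∀ k z, cb k ≠ 1 → ht k z ≠ 0 → |Q k z - f x| ≤ E := by
    intro k z hk hz
    have hxn := hnear k hk
    have hxd : (x : EuclideanSpace ℝ (Fin D)) ∈ (φ k).dom := C.mem_dom k x x.2 hxn
    set g := f ∘ (φ k).inv with hg
    set v := (φ k).proj x - θ k z with hv
    have hvi : ∀ i, v i = u (.inl (k, i)) x - gridPt z i := by
      intro i
      rw [hproj]
      simp only [hv, hθ, PiLp.sub_apply]
      ring
    have hvq : ∀ i, |2 ^ q * v i| ≤ 1 := fun i => by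
      rw [hvi]
      exact (abs_lt_one_of_hat_ne_zero (Finset.prod_ne_zero_iff.1 hz i (Finset.mem_univ i))).le
    have hvh : ∀ i, |v i| ≤ h := fun i => by
      have h1 := hvq i
      rw [abs_mul, abs_of_pos (by positivity), ← h2h] at h1
      exact le_of_mul_le_mul_left h1 (by positivity)
    have hvn : ‖v‖ ≤ d * h := norm_le_of_abs_le hvh
    have hpp : ‖(φ k).proj x - (φ k).proj (C.pt k)‖ ≤ (1 / 2) ^ a :=
      ((φ k).norm_proj_sub_proj_le _ _).trans hxn
    have hball : ∀ t ∈ Icc (0 : ℝ) 1,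
        θ k z + t • v ∈ Metric.ball ((φ k).proj (C.pt k)) δ := by
      intro t ht
      rw [Metric.mem_ball, dist_eq_norm]
      have e1 : θ k z + t • v - (φ k).proj (C.pt k) =
          ((φ k).proj x - (φ k).proj (C.pt k)) - (1 - t) • v := by
        rw [sub_smul, one_smul, hv]; abel
      rw [e1]
      refine (norm_sub_le _ _).trans_lt ?_
      rw [norm_smul, Real.norm_of_nonneg (by linarith [ht.2])]
      have : (1 - t) * ‖v‖ ≤ 1 * (d * h) := by
        gcongr
        · linarith [ht.1]
      linarith
    have htarget : ∀ t ∈ Icc (0 : ℝ) 1, θ k z + t • v ∈ (φ k).target := fun t ht =>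
      C.ball_subset k (hball t ht)
    have hθball : θ k z ∈ Metric.ball ((φ k).proj (C.pt k)) δ := by
      simpa using hball 0 ⟨le_rfl, zero_le_one⟩
    have hosc : ∀ J : Fin s → Fin d, ∀ t ∈ Icc (0 : ℝ) 1,
        |partialDeriv J g (θ k z + t • v) - partialDeriv J g (θ k z)| ≤ d * h ^ α := by
      intro J t ht
      obtain ⟨x₁, hx₁, e1⟩ := htarget t ht
      obtain ⟨x₂, hx₂, e2⟩ := C.ball_subset k hθball
      have h1 := hf.holder (C.idx k) J x₁ hx₁ x₂ hx₂
      change |partialDeriv J g ((φ k).proj x₁) - partialDeriv J g ((φ k).proj x₂)| ≤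
        ‖(φ k).proj x₁ - (φ k).proj x₂‖ ^ α at h1
      have e2 : (φ k).proj x₂ = θ k z := e2
      rw [e1, e2, add_sub_cancel_left] at h1
      refine h1.trans ?_
      have h2 : ‖t • v‖ ≤ d * h := by
        rw [norm_smul, Real.norm_of_nonneg ht.1]
        calc t * ‖v‖ ≤ 1 * (d * h) := by gcongr; exact ht.2
          _ = d * h := one_mul _
      calc ‖t • v‖ ^ α ≤ (d * h) ^ α := Real.rpow_le_rpow (norm_nonneg _) h2 hα.le
        _ = (d : ℝ) ^ α * h ^ α := Real.mul_rpow (by positivity) hh0.le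
        _ ≤ d * h ^ α := by
            gcongr
            exact Real.rpow_le_self_of_one_le (by exact_mod_cast hd) hα1
    have htay := abs_sub_taylor_le (φ k).isOpen_target (hf.contDiffOn (C.idx k)) htarget hvh
      hh0.le hosc
    have hgx : g (θ k z + v) = f x := by
      rw [hv, add_sub_cancel, hg, Function.comp, (φ k).inv_proj hxd]
    have hQe : Q k z = ∑ κ ∈ Finset.range (s + 1), (∑ J : Fin κ → Fin d,
        partialDeriv J g (θ k z) * ∏ l, v (J l)) / (κ.factorial : ℝ) := by
      rw [Finset.sum_range]
      simp only [hQ]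
      rw [Fintype.sum_sigma]
      refine Finset.sum_congr rfl fun κ _ => ?_
      rw [Finset.sum_div]
      refine Finset.sum_congr rfl fun J _ => ?_
      simp only [hb, if_pos hθball]
      have e1 : ∀ l, clamp (2 ^ q * (u (.inl (k, J l)) x - gridPt z (J l))) =
          2 ^ q * v (J l) := fun l => by
        rw [← hvi]; exact clamp_eq_self (hvq _)
      have e2 : h ^ (κ : ℕ) * (2 ^ q) ^ (κ : ℕ) = 1 := by rw [← mul_pow, mul_comm, h2h, one_pow]
      simp only [e1, Finset.prod_mul_distrib, Finset.prod_const, Finset.card_univ,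
        Fintype.card_fin]
      linear_combination (partialDeriv J g (θ k z) / ((κ : ℕ).factorial : ℝ) *
        ∏ l, v (J l)) * e2
    change |g (θ k z + v) - ∑ κ ∈ Finset.range (s + 1), (∑ J : Fin κ → Fin d,
      partialDeriv J g (θ k z) * ∏ l, v (J l)) / (κ.factorial : ℝ)| ≤ _ at htay
    rw [hgx, ← hQe, abs_sub_comm] at htay
    refine htay.trans (le_of_eq ?_)
    rw [hE, Real.rpow_add hh0, Real.rpow_natCast]
    ring
  have hsum : ∑ T, b T * ((termFactors q e u T).map fun g => g x).prod =
      ∑ k, ∑ z, η k * ht k z * Q k z := by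
    rw [Fintype.sum_prod_type]
    refine Finset.sum_congr rfl fun k _ => ?_
    rw [Fintype.sum_prod_type]
    refine Finset.sum_congr rfl fun z _ => ?_
    simp only [hQ, Finset.mul_sum]
    refine Finset.sum_congr rfl fun p _ => ?_
    obtain ⟨κ, J⟩ := p
    rw [prod_termFactors]
    ring
  have hone : ∑ k, ∑ z, η k * ht k z = 1 := by
    rw [← hηsum]
    refine Finset.sum_congr rfl fun k _ => ?_
    rw [← Finset.mul_sum]
    by_cases hk : cb k = 1
    · simp [hη, hk]
    · rw [hhtsum k hk, mul_one]
  rw [hsum]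
  have hfx : f x = ∑ k, ∑ z, η k * ht k z * f x := by
    simp only [← Finset.sum_mul]
    rw [hone, one_mul]
  rw [hfx, ← Finset.sum_sub_distrib]
  calc |∑ k, (∑ z, η k * ht k z * Q k z - ∑ z, η k * ht k z * f x)|
      ≤ ∑ k, ∑ z, η k * ht k z * E := by
        refine (Finset.abs_sum_le_sum_abs _ _).trans (Finset.sum_le_sum fun k _ => ?_)
        rw [← Finset.sum_sub_distrib]
        refine (Finset.abs_sum_le_sum_abs _ _).trans (Finset.sum_le_sum fun z _ => ?_)
        rw [← mul_sub, abs_mul, abs_of_nonneg (mul_nonneg (hη0 k) (hht0 k z))]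
        by_cases hk : cb k = 1
        · simp [hη, hk]
        by_cases hz : ht k z = 0
        · simp [hz]
        exact mul_le_mul_of_nonneg_left (hlocal k z hk hz) (mul_nonneg (hη0 k) (hht0 k z))
    _ = E := by
        simp only [← Finset.sum_mul]
        rw [hone, one_mul]

end Approximation

section Parameters

lemma le_four_pow_ceil_log {y : ℝ} (hy : 0 < y) : y ≤ 4 ^ ⌈Real.log y⌉₊ := by
  calc y = Real.exp (Real.log y) := (Real.exp_log hy).symm
    _ ≤ Real.exp ⌈Real.log y⌉₊ := Real.exp_le_exp.2 (Nat.le_ceil _)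
    _ = Real.exp 1 ^ ⌈Real.log y⌉₊ := by rw [← Real.exp_nat_mul, mul_one]
    _ ≤ 4 ^ ⌈Real.log y⌉₊ := by
        gcongr
        linarith [Real.exp_one_lt_three]

/-- There is a precision that resolves a dimension-dependent factor. -/
lemma exists_front_precision (b : ℕ) {D : ℕ} (hD : 1 ≤ D) :
    ∃ m : ℕ, (D : ℝ) * 4 ^ b ≤ 4 ^ m ∧ (m : ℝ) ≤ b + 1 + Real.log D := by
  have hD' : (1 : ℝ) ≤ D := by exact_mod_cast hD
  refine ⟨⌈Real.log D⌉₊ + b, ?_, ?_⟩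
  · rw [pow_add]
    gcongr
    exact le_four_pow_ceil_log (by linarith)
  · have := Nat.ceil_lt_add_one (Real.log_nonneg hD')
    push_cast
    linarith

/-- There is a mesh size adapted to the target accuracy. -/
lemma exists_mesh {d s : ℕ} {c₀ α ε : ℝ} (hc₀ : 1 ≤ c₀) (hs : 1 ≤ s) (hα : 0 < α)
    (hε : 0 < ε) (hε1 : ε < 1) :
    ∃ q : ℕ, c₀ ≤ 2 ^ q ∧ c₀ * ((1 / 2 : ℝ) ^ q) ^ ((s : ℝ) + α) ≤ ε ∧
      ((2 : ℝ) ^ q) ^ d ≤ (2 * c₀) ^ d * ε ^ (-((d : ℝ) / ((s : ℝ) + α))) ∧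
      (q : ℝ) ≤ 2 * Real.log (2 * c₀) + 2 * Real.log (1 / ε) := by
  set σ : ℝ := s + α with hσ
  have hs' : (1 : ℝ) ≤ s := by exact_mod_cast hs
  have hσ1 : 1 ≤ σ := by linarith
  have hσ0 : 0 < σ := by linarith
  have hc0 : 0 < c₀ := by linarith
  set Y : ℝ := ε ^ (-(1 / σ)) with hY
  have hY1 : 1 ≤ Y := Real.one_le_rpow_of_pos_of_le_one_of_nonpos hε hε1.le
    (by rw [Left.neg_nonpos_iff]; positivity)
  have hY0 : 0 < Y := by linarith
  obtain ⟨n, hn1, hn2⟩ := exists_nat_pow_near (show 1 ≤ c₀ * Y by nlinarith)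
    (show (1 : ℝ) < 2 by norm_num)
  have hle : (2 : ℝ) ^ (n + 1) ≤ 2 * c₀ * Y := by rw [pow_succ]; linarith
  refine ⟨n + 1, ?_, ?_, ?_, ?_⟩
  · nlinarith
  · have h1 : (1 / 2 : ℝ) ^ (n + 1) ≤ (c₀ * Y)⁻¹ := by
      rw [one_div, inv_pow]
      exact inv_anti₀ (by positivity) hn2.le
    have h2 : ((c₀ * Y)⁻¹) ^ σ = (c₀ ^ σ)⁻¹ * ε := by
      rw [Real.inv_rpow (by positivity), Real.mul_rpow hc0.le hY0.le, mul_inv, hY,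
        ← Real.rpow_mul hε.le, neg_mul, one_div_mul_cancel hσ0.ne', Real.rpow_neg_one, inv_inv]
    calc c₀ * ((1 / 2 : ℝ) ^ (n + 1)) ^ σ ≤ c₀ * ((c₀ * Y)⁻¹) ^ σ := by gcongr
      _ = c₀ * (c₀ ^ σ)⁻¹ * ε := by rw [h2]; ring
      _ ≤ 1 * ε := by
          gcongr
          rw [← div_eq_mul_inv, div_le_one (by positivity)]
          exact Real.self_le_rpow_of_one_le hc₀ hσ1
      _ = ε := one_mul _
  · calc ((2 : ℝ) ^ (n + 1)) ^ d ≤ (2 * c₀ * Y) ^ d := by gcongr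
      _ = (2 * c₀) ^ d * Y ^ d := mul_pow _ _ _
      _ = _ := by
          rw [hY, ← Real.rpow_natCast (ε ^ _) d, ← Real.rpow_mul hε.le]
          congr 2
          ring
  · have h1 := Real.log_le_log (by positivity) hle
    rw [Real.log_pow, Real.log_mul (by positivity) hY0.ne', hY, Real.log_rpow hε] at h1
    have hl : 0 ≤ -Real.log ε := by linarith [Real.log_nonpos hε.le hε1.le]
    have h2 : -(1 / σ) * Real.log ε ≤ -Real.log ε := by
      have : 1 / σ ≤ 1 := (div_le_one hσ0).2 hσ1
      nlinarith
    have h3 : (1 / 2 : ℝ) ≤ Real.log 2 := by linarith [Real.log_two_gt_d9]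
    have h4 : ((n + 1 : ℕ) : ℝ) * (1 / 2) ≤ ((n + 1 : ℕ) : ℝ) * Real.log 2 := by gcongr
    rw [one_div ε, Real.log_inv]
    linarith

/-- There is a multiplication precision adapted to the target accuracy. -/
lemma exists_product_precision {d : ℕ} {c ε : ℝ} (hc : 1 ≤ c) (hε : 0 < ε) (hε1 : ε < 1) :
    ∃ m : ℕ, c * (1 / ε) ^ d * (1 / 4) ^ m ≤ ε ∧
      (m : ℝ) ≤ Real.log c + 1 + (d + 1) * Real.log (1 / ε) := by
  have h1 : 1 ≤ 1 / ε := (one_le_div hε).2 hε1.le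
  have hY : 1 ≤ c * (1 / ε) ^ (d + 1) := one_le_mul_of_one_le_of_one_le hc (one_le_pow₀ h1)
  refine ⟨⌈Real.log (c * (1 / ε) ^ (d + 1))⌉₊, ?_, ?_⟩
  · set m := ⌈Real.log (c * (1 / ε) ^ (d + 1))⌉₊
    have h2 : c * (1 / ε) ^ (d + 1) ≤ 4 ^ m := le_four_pow_ceil_log (by linarith)
    calc c * (1 / ε) ^ d * (1 / 4) ^ m
        = c * (1 / ε) ^ (d + 1) * (1 / 4) ^ m * ε := by
          rw [pow_succ]; field_simp
      _ ≤ 4 ^ m * (1 / 4) ^ m * ε := by gcongr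
      _ = ε := by rw [← mul_pow]; norm_num
  · have h2 := Nat.ceil_lt_add_one (Real.log_nonneg hY)
    rw [Real.log_mul (by positivity) (by positivity), Real.log_pow] at h2
    rw [Real.log_mul (by positivity) (by positivity), Real.log_pow]
    push_cast at h2 ⊢
    linarith

lemma rpow_neg_div_le {d s : ℕ} {α ε : ℝ} (hs : 1 ≤ s) (hα : 0 < α) (hε : 0 < ε) (hε1 : ε < 1) :
    ε ^ (-((d : ℝ) / ((s : ℝ) + α))) ≤ (1 / ε) ^ d := by
  have hs' : (1 : ℝ) ≤ s := by exact_mod_cast hs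
  rw [Real.rpow_neg hε.le, one_div, inv_pow]
  refine inv_anti₀ (by positivity) ?_
  rw [← Real.rpow_natCast]
  refine Real.rpow_le_rpow_of_exponent_ge hε hε1.le ?_
  exact div_le_self (by positivity) (by linarith)

lemma mul_log_le_of_rpow {d s D : ℕ} {α ε : ℝ} (hs : 1 ≤ s) (hα : 0 < α) (hε : 0 < ε)
    (hε1 : ε < 1) (hD : 1 ≤ D) :
    ε ^ (-((d : ℝ) / ((s : ℝ) + α))) * Real.log D ≤
      D * Real.log D + d * (ε ^ (-((d : ℝ) / ((s : ℝ) + α))) * Real.log (1 / ε)) := by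
  have hE := rpow_neg_div_le (d := d) hs hα hε hε1
  set E := ε ^ (-((d : ℝ) / ((s : ℝ) + α))) with hEdef
  have hE0 : 0 < E := by positivity
  have hD' : (1 : ℝ) ≤ D := by exact_mod_cast hD
  have hl : 0 ≤ Real.log (1 / ε) := Real.log_nonneg ((one_le_div hε).2 hε1.le)
  have hlD := Real.log_nonneg hD'
  rcases le_total E D with h | h
  · have : 0 ≤ d * (E * Real.log (1 / ε)) := by positivity
    nlinarith
  · have h1 : Real.log D ≤ d * Real.log (1 / ε) := by
      rw [← Real.log_pow]
      exact Real.log_le_log (by linarith) (h.trans hE)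
    have : 0 ≤ D * Real.log D := by positivity
    nlinarith

lemma card_termIdx_le (N d s R : ℕ) (hR : 1 ≤ R) :
    (Fintype.card (TermIdx N d s R) : ℝ) ≤ N * 3 ^ d * (∑ κ ∈ Finset.range (s + 1), d ^ κ) * R ^ d := by
  have h : Fintype.card (TermIdx N d s R) =
      N * ((2 * R + 1) ^ d * ∑ κ ∈ Finset.range (s + 1), d ^ κ) := by
    simp [TermIdx, Finset.sum_range]
  rw [h]
  have h1 : ((2 * R + 1 : ℕ) : ℝ) ^ d ≤ (3 * R) ^ d := by
    gcongr
    have : 2 * R + 1 ≤ 3 * R := by omega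
    exact_mod_cast this
  push_cast at h1 ⊢
  calc (N : ℝ) * ((2 * R + 1) ^ d * ∑ κ ∈ Finset.range (s + 1), (d : ℝ) ^ κ)
      ≤ N * ((3 * R) ^ d * ∑ κ ∈ Finset.range (s + 1), (d : ℝ) ^ κ) := by gcongr
    _ = _ := by rw [mul_pow]; ring

end Parameters

section Dimension

variable {d D m : ℕ} {M : Set (EuclideanSpace ℝ (Fin D))}

/-- A closed manifold of positive dimension does not fit into the real line. -/
lemma TangentAtlas.two_le_dim (A : TangentAtlas d M m) (hd : 1 ≤ d) (hM : IsCompact M)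
    (hne : M.Nonempty) : 2 ≤ D := by
  by_contra hD
  have hD0 : D ≠ 0 := by
    rintro rfl
    obtain ⟨x, hx⟩ := hne
    obtain ⟨i, -⟩ := mem_iUnion.1 (A.cover hx)
    have h1 := (A.chart i).frame_orthonormal.1 ⟨0, hd⟩
    rw [Subsingleton.elim ((A.chart i).frame ⟨0, hd⟩) 0, norm_zero] at h1
    exact zero_ne_one h1
  obtain rfl : D = 1 := by omega
  obtain ⟨x, hx, hmax⟩ := hM.exists_isMaxOn hne
    (f := fun x : EuclideanSpace ℝ (Fin 1) => x 0) (by fun_prop)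
  obtain ⟨i, hi⟩ := mem_iUnion.1 (A.cover hx)
  set φ := A.chart i
  set v := φ.frame ⟨0, hd⟩ with hv
  have hv0 : v 0 ≠ 0 := by
    intro h0
    have h1 := φ.frame_orthonormal.1 ⟨0, hd⟩
    rw [← hv, show v = 0 by ext j; rw [Subsingleton.elim j 0]; exact h0, norm_zero] at h1
    exact zero_ne_one h1
  set w := EuclideanSpace.single (⟨0, hd⟩ : Fin d) (1 : ℝ) with hw
  have hcont : Continuous fun t : ℝ => φ.proj x + (t * v 0) • w := by fun_prop
  have hev : ∀ᶠ t in 𝓝 (0 : ℝ), φ.proj x + (t * v 0) • w ∈ φ.target :=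
    hcont.tendsto 0 (φ.isOpen_target.mem_nhds (by simpa using φ.proj_mem_target hi))
  obtain ⟨t, ht, ht0⟩ := (Eventually.and (hev.filter_mono nhdsWithin_le_nhds)
    (self_mem_nhdsWithin (s := Ioi (0 : ℝ)))).exists
  obtain ⟨y, hy, hyt⟩ := ht
  have hyM : y ∈ M := by
    obtain ⟨O, -, hO⟩ := φ.dom_open
    rw [hO] at hy
    exact hy.1
  have h1 := congrArg (fun w => w ⟨0, hd⟩) hyt
  simp only [PiLp.add_apply, PiLp.smul_apply, hw, smul_eq_mul, PiLp.single_apply, if_true,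
    mul_one] at h1
  have h2 : (y 0 - x 0) * v 0 = t * v 0 := by
    have e1 : φ.proj y ⟨0, hd⟩ - φ.proj x ⟨0, hd⟩ = (y 0 - x 0) * v 0 := by
      simp only [TangentChart.proj, PiLp.inner_apply, Finset.univ_unique, Finset.sum_singleton]
      simp [← hv]
      ring
    linarith
  have h3 := mul_right_cancel₀ hv0 h2
  have h4 : y 0 ≤ x 0 := hmax hyM
  have h5 : 0 < t := ht0
  linarith

end Dimension

section Assembly

lemma GoodCover.exists_coeff_prodApprox {d D m N : ℕ} {M : Set (EuclideanSpace ℝ (Fin D))}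
    {A : TangentAtlas d M m} {a : ℕ} {δ : ℝ} (G : GoodCover A N ((1 / 2) ^ a) δ)
    (hδ : 4 * (1 / 2 : ℝ) ^ a ≤ δ) (hd : 1 ≤ d) {s : ℕ} {α : ℝ} (hα : 0 < α) (hα1 : α ≤ 1)
    {f : EuclideanSpace ℝ (Fin D) → ℝ} (hf : IsHolder A s α f) {β m₀ m₁ q : ℕ} {ε : ℝ}
    (hβ : ∀ k j, ∀ x ∈ M, |x j - G.pt k j| ≤ 2 ^ β)
    (hm₀ : (D : ℝ) * 4 ^ (β + a + 1) ≤ 4 ^ m₀) (hq : (d : ℝ) * (1 / 2) ^ q ≤ δ / 4)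
    (hqε : (d : ℝ) ^ (s + 1) * ((1 / 2 : ℝ) ^ q) ^ ((s : ℝ) + α) ≤ ε / 2)
    (hm₁ : Fintype.card (TermIdx N d s (2 ^ q)) * (((N + 1 + d + s : ℕ) : ℝ) * (1 / 4) ^ m₁) ≤
      ε / 2) :
    ∃ b : TermIdx N d s (2 ^ q) → ℝ, (∀ T, |b T| ≤ 1) ∧ ∀ x : M,
      |∑ T, b T * prodApprox m₁
        ((termFactors q (2 * β + 2 * a) (G.front β m₀) T).map fun g => g x) - f x| ≤ ε := by
  obtain ⟨b, hb, hbf⟩ := G.exists_coeff hδ hd hα hα1 hf hβ hm₀ hq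
  refine ⟨b, hb, fun x => ?_⟩
  set F := termFactors q (2 * β + 2 * a) (G.front β m₀) with hF
  have hterm : ∀ T, |b T * prodApprox m₁ ((F T).map fun g => g x) -
      b T * ((F T).map fun g => g x).prod| ≤ ((N + 1 + d + s : ℕ) : ℝ) * (1 / 4) ^ m₁ := by
    intro T
    rw [← mul_sub, abs_mul]
    have h1 := (prodApprox_bounds m₁ ((F T).map fun g => g x) (by
      simp only [List.mem_map]
      rintro _ ⟨g, hg, rfl⟩
      exact (comp_termFactors (le_refl 4) q _ (G.front β m₀) T g hg).2 _)).2
    rw [List.length_map] at h1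
    have h2 : ((F T).length : ℝ) ≤ (N + 1 + d + s : ℕ) := by
      exact_mod_cast length_termFactors_le q _ (G.front β m₀) T
    calc _ ≤ 1 * (((F T).length : ℝ) * (1 / 4) ^ m₁) :=
          mul_le_mul (hb T) h1 (abs_nonneg _) zero_le_one
      _ ≤ _ := by rw [one_mul]; gcongr
  have hsum : |∑ T, b T * prodApprox m₁ ((F T).map fun g => g x) -
      ∑ T, b T * ((F T).map fun g => g x).prod| ≤ ε / 2 := by
    rw [← Finset.sum_sub_distrib]
    refine (Finset.abs_sum_le_sum_abs _ _).trans
      ((Finset.sum_le_sum fun T _ => hterm T).trans ?_)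
    rwa [Finset.sum_const, Finset.card_univ, nsmul_eq_mul]
  calc _ ≤ _ := abs_sub_le _ _ _
    _ ≤ ε / 2 + ε / 2 := add_le_add hsum ((hbf x).trans hqε)
    _ = ε := by ring

set_option maxHeartbeats 1000000 in
/-- The approximation theorem for fixed values of the parameters. -/
theorem exists_const_approx (d s : ℕ) (τ B S Λ₀ : ℝ) : ∃ c : ℝ,
    ∀ (D : ℕ) (M : Set (EuclideanSpace ℝ (Fin D))),
      1 ≤ d → IsCompact M → 0 < B → (∀ x ∈ M, ∀ j, |x j| ≤ B) →
      0 < τ → reach M = ENNReal.ofReal τ →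
    ∀ (m : ℕ) (A : TangentAtlas d M m) (ρ : Fin m → EuclideanSpace ℝ (Fin D) → ℝ)
      (Λ : Fin m → ℝ) (α : ℝ),
      IsPartitionOfUnity A ρ → 1 ≤ s → DerivBound A ρ s Λ → 0 < α → α ≤ 1 →
      surfaceArea d M = S → ∑ i, Λ i = Λ₀ →
    ∀ κ : ℝ, 4 ≤ κ → B ≤ κ → ∀ ε : ℝ, 0 < ε → ε < 1 →
    ∃ (L p K : ℕ) (hidden : List ℕ),
      (L : ℝ) ≤ c * (Real.log (1 / ε) + Real.log D) ∧
      (p : ℝ) ≤ c * (ε ^ (-((d : ℝ) / ((s : ℝ) + α))) + D) ∧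
      (K : ℝ) ≤ c ^ 2 * (1 + d) * (ε ^ (-((d : ℝ) / ((s : ℝ) + α))) * Real.log (1 / ε) +
        D * Real.log (1 / ε) + D * Real.log D) ∧
      hidden.sum ≤ K ∧
      ∀ f : EuclideanSpace ℝ (Fin D) → ℝ, IsHolder A s α f →
        ∃ Φ : ReLUNet D, Φ.hiddenWidths = hidden ∧ Φ.InClass κ L p K ∧
          ∀ x ∈ M, |Φ.eval (fun j => x j) - f x| ≤ ε := by
  by_cases hτ : 0 < τ
  swap
  · exact ⟨0, fun _ _ _ _ _ _ h => absurd h hτ⟩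
  by_cases hd : 1 ≤ d
  swap
  · exact ⟨0, fun _ _ h => absurd h hd⟩
  obtain ⟨N, a, δ, hδ, hδa, hcover⟩ := exists_goodCover d hd τ S Λ₀ hτ
  obtain ⟨β, hβ⟩ := pow_unbounded_of_one_lt (2 * B) (show (1 : ℝ) < 2 by norm_num)
  set n : ℕ := N + 1 + d + s with hn
  set e : ℕ := 2 * β + 2 * a with he
  set c₀ : ℝ := 2 * d ^ (s + 1) + 4 * d / δ + 1 with hc₀
  have hc₀1 : 1 ≤ c₀ := by
    have : 0 ≤ 2 * (d : ℝ) ^ (s + 1) + 4 * d / δ := by positivity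
    linarith
  -- the number of local monomials is at most `C ε ^ (-d / (s + α))`
  set C : ℝ := N * 3 ^ d * (∑ κ ∈ Finset.range (s + 1), (d : ℝ) ^ κ) * (2 * c₀) ^ d with hC
  have hC0 : 0 ≤ C := by positivity
  set c₁ : ℝ := 2 * C * n + 1 with hc₁
  have hc₁1 : 1 ≤ c₁ := by
    have : 0 ≤ 2 * C * n := by positivity
    linarith
  set K₀ : ℝ := (β + a + 1) + 1 + 2 * Real.log (2 * c₀) + e + n * (Real.log c₁ + 6) + 14 with hK₀
  have hlc₀ : 0 ≤ Real.log (2 * c₀) := Real.log_nonneg (by linarith)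
  have hlc₁ : 0 ≤ Real.log c₁ := Real.log_nonneg hc₁1
  have hK₀0 : 0 ≤ K₀ := by positivity
  set P := prodCost (factorCost N d) n with hP
  set c : ℝ := 2 * K₀ + (2 + n * (d + 1)) + (frontCost N d + C * P + 1) with hc
  have hc0 : 0 ≤ c := by positivity
  refine ⟨c, ?_⟩
  intro D M _ hM hB hMB _ hreach m A ρ Λ α hρ hs hΛ hα hα1 hS hΛ₀ κ hκ hBκ ε hε hε1
  obtain ⟨G⟩ := hcover D m M A ρ s Λ hM hreach hρ hs hΛ hS hΛ₀
  have hD := A.two_le_dim hd hM (nonempty_of_reach hreach)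
  have hD1 : 1 ≤ D := by omega
  obtain ⟨m₀, hm₀, hm₀l⟩ := exists_front_precision (β + a + 1) hD1
  obtain ⟨q, hq, hqε, hqd, hql⟩ := exists_mesh (d := d) hc₀1 hs hα hε hε1
  obtain ⟨m₁, hm₁, hm₁l⟩ := exists_product_precision (d := d) hc₁1 hε hε1
  set E := ε ^ (-((d : ℝ) / ((s : ℝ) + α))) with hE
  have hE0 : 0 < E := by positivity
  set ℓ := Real.log (1 / ε) with hℓ
  set lD := Real.log D with hlD
  have hℓ0 : 0 ≤ ℓ := Real.log_nonneg ((one_le_div hε).2 hε1.le)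
  have hlD0 : 1 / 2 ≤ lD := by
    have h1 : Real.log 2 ≤ lD := Real.log_le_log (by norm_num) (by exact_mod_cast hD)
    linarith [Real.log_two_gt_d9]
  have hcard : (Fintype.card (TermIdx N d s (2 ^ q)) : ℝ) ≤ C * E := by
    refine (card_termIdx_le N d s (2 ^ q) Nat.one_le_two_pow).trans ?_
    push_cast
    calc _ ≤ N * 3 ^ d * (∑ κ ∈ Finset.range (s + 1), (d : ℝ) ^ κ) * ((2 * c₀) ^ d * E) := by
          gcongr
      _ = C * E := by rw [hC]; ring
  have hdist : ∀ k j, ∀ x ∈ M, |x j - G.pt k j| ≤ 2 ^ β := by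
    intro k j x hx
    have h1 := hMB x hx j
    have h2 := hMB _ (G.pt_mem k) j
    exact (abs_sub _ _).trans (by linarith)
  set w := frontCost N d * D + Fintype.card (TermIdx N d s (2 ^ q)) * P with hw
  obtain ⟨hidden, hlen, hle, hnet⟩ := exists_net_terms hκ hD1
    (fun j (x : M) => (x : EuclideanSpace ℝ (Fin D)) j) (fun k j => G.pt k j)
    (fun k i j => (A.chart (G.idx k)).frame i j) s β m₀ e q m₁ w
    (fun k j => (hMB _ (G.pt_mem k) j).trans hBκ)
    (fun k i j => by
      have h1 := PiLp.norm_apply_le ((A.chart (G.idx k)).frame i) j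
      rw [(A.chart (G.idx k)).frame_orthonormal.1 i] at h1
      exact h1)
    (fun k j x => hdist k j x x.2) (Nat.le_add_right _ _) (Nat.le_add_left _ _)
  set L := m₀ + q + e + n * (m₁ + 5) + 14 with hL
  have hLle : (L : ℝ) ≤ c * (ℓ + lD) := by
    have h1 : (L : ℝ) ≤ K₀ + 2 * ℓ + lD + n * (d + 1) * ℓ := by
      have h2 : (n : ℝ) * (m₁ + 5) ≤ n * (Real.log c₁ + 1 + (d + 1) * ℓ + 5) := by gcongr
      rw [hL, hK₀]
      push_cast at hm₀l ⊢
      linarith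
    have h3 : K₀ ≤ 2 * K₀ * (ℓ + lD) := by nlinarith
    have h4 : 2 * ℓ + lD + n * (d + 1) * ℓ ≤ (2 + n * (d + 1)) * (ℓ + lD) := by
      have : 0 ≤ n * (d + 1) * lD := by positivity
      linarith
    have h5 : 0 ≤ (frontCost N d + C * P + 1) * (ℓ + lD) := by positivity
    rw [hc]
    linarith
  have hple : ((w + D : ℕ) : ℝ) ≤ c * (E + D) := by
    have h1 : (Fintype.card (TermIdx N d s (2 ^ q)) : ℝ) * P ≤ C * E * P := by gcongr
    have h2 : 0 ≤ (2 * K₀ + (2 + n * (d + 1))) * (E + D) := by positivity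
    have h3 : 0 ≤ (frontCost N d + 1) * E := by positivity
    have h4 : 0 ≤ C * P * D := by positivity
    rw [hc, hw]
    push_cast
    linarith
  have hEl : E * lD ≤ D * lD + d * (E * ℓ) := mul_log_le_of_rpow hs hα hε hε1 hD1
  refine ⟨L, w + D, L * (w + D), hidden, hLle, hple, ?_, ?_, ?_⟩
  · push_cast at hple ⊢
    calc (L : ℝ) * (w + D) ≤ c * (ℓ + lD) * (c * (E + D)) :=
          mul_le_mul hLle hple (by positivity) (by positivity)
      _ = c ^ 2 * (E * ℓ + D * ℓ + D * lD + E * lD) := by ring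
      _ ≤ c ^ 2 * ((1 + d) * (E * ℓ + D * ℓ + D * lD)) := by
          refine mul_le_mul_of_nonneg_left ?_ (sq_nonneg c)
          have h1 : 0 ≤ (d : ℝ) * (D * ℓ) := by positivity
          have h2 : D * lD ≤ d * (D * lD) :=
            le_mul_of_one_le_left (by positivity) (by exact_mod_cast hd)
          linarith
      _ = _ := by ring
  · calc hidden.sum ≤ hidden.length • w := List.sum_le_card_nsmul _ _ hle
      _ ≤ L * (w + D) := by
          rw [smul_eq_mul, hlen]
          exact Nat.mul_le_mul (Nat.le_succ (m₀ + q + e + n * (m₁ + 5) + 13)) (Nat.le_add_right _ _)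
  intro f hf
  have hq' : (d : ℝ) * (1 / 2) ^ q ≤ δ / 4 := by
    have h1 : 4 * d / δ ≤ (2 : ℝ) ^ q := by
      refine le_trans ?_ hq
      have : 0 ≤ 2 * (d : ℝ) ^ (s + 1) := by positivity
      linarith
    rw [div_le_iff₀ hδ] at h1
    rw [one_div, inv_pow, ← div_eq_mul_inv, div_le_iff₀ (by positivity)]
    linarith
  have hqε' : (d : ℝ) ^ (s + 1) * ((1 / 2 : ℝ) ^ q) ^ ((s : ℝ) + α) ≤ ε / 2 := by
    have h3 : 2 * (d : ℝ) ^ (s + 1) ≤ c₀ := by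
      have : 0 ≤ 4 * d / δ := by positivity
      linarith
    have h4 : 2 * (d : ℝ) ^ (s + 1) * ((1 / 2 : ℝ) ^ q) ^ ((s : ℝ) + α) ≤ ε :=
      le_trans (mul_le_mul_of_nonneg_right h3 (by positivity)) hqε
    linarith
  have hm₁' : Fintype.card (TermIdx N d s (2 ^ q)) * ((n : ℝ) * (1 / 4) ^ m₁) ≤ ε / 2 := by
    have h1 : C * E ≤ C * (1 / ε) ^ d :=
      mul_le_mul_of_nonneg_left (rpow_neg_div_le hs hα hε hε1) hC0
    calc _ ≤ C * (1 / ε) ^ d * (n * (1 / 4) ^ m₁) :=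
          mul_le_mul_of_nonneg_right (hcard.trans h1) (by positivity)
      _ = (2 * C * n) * ((1 / ε) ^ d * (1 / 4) ^ m₁) / 2 := by ring
      _ ≤ c₁ * ((1 / ε) ^ d * (1 / 4) ^ m₁) / 2 := by
          have : 2 * C * n ≤ c₁ := by linarith
          gcongr
      _ ≤ ε / 2 := by linarith
  obtain ⟨b, hb, hbf⟩ := G.exists_coeff_prodApprox hδa hd hα hα1 hf hdist hm₀ hq' hqε' hm₁'
  obtain ⟨Φ, hΦ1, hΦ2, hΦ3, hΦ4, hΦ5⟩ := hnet b hb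
  refine ⟨Φ, hΦ1, ⟨hΦ2, Nat.le_add_left _ _, ?_, hΦ3, ?_⟩, fun x hx => ?_⟩
  · rw [hΦ1]
    exact fun v hv => (hle v hv).trans (Nat.le_add_right _ _)
  · exact hΦ4.trans (Nat.mul_le_mul le_rfl (Nat.le_add_right _ _))
  · have h1 := hbf ⟨x, hx⟩
    have h2 := hΦ5 ⟨x, hx⟩
    simp only at h2
    rw [h2]
    exact h1

end Assembly

end ManifoldReLU

theorem mainTheorem1 :
    -- `c₁, c₂, c₃` are functions of `d, s, τ, B`, the surface area and the derivative bound of the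
    -- partition of unity; `c₄` is a function of the derivative bound only
    ∃ (c₁ c₂ c₃ : ℕ → ℕ → ℝ → ℝ → ℝ → ℝ → ℝ) (c₄ : ℝ → ℝ),
      ∀ (d D : ℕ) (M : Set (EuclideanSpace ℝ (Fin D))) (τ B : ℝ),
        1 ≤ d → IsCompact M → ManifoldReLU.IsSmoothSubmanifold d M →
        0 < B → (∀ x ∈ M, ∀ j, |x j| ≤ B) →
        0 < τ → ManifoldReLU.reach M = ENNReal.ofReal τ →
      ∀ (m : ℕ) (A : ManifoldReLU.TangentAtlas d M m)
        (ρ : Fin m → EuclideanSpace ℝ (Fin D) → ℝ) (s : ℕ) (Λ : Fin m → ℝ) (α : ℝ),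
        ManifoldReLU.IsPartitionOfUnity A ρ → 1 ≤ s → ManifoldReLU.DerivBound A ρ s Λ →
        0 < α → α ≤ 1 →
      ∀ ε : ℝ, 0 < ε → ε < 1 →
      ∃ (L p K : ℕ) (hidden : List ℕ),
        (L : ℝ) ≤ c₁ d s τ B (ManifoldReLU.surfaceArea d M) (∑ i, Λ i) *
          (Real.log (1 / ε) + Real.log D) ∧
        (p : ℝ) ≤ c₂ d s τ B (ManifoldReLU.surfaceArea d M) (∑ i, Λ i) *
          (ε ^ (-((d : ℝ) / ((s : ℝ) + α))) + D) ∧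
        (K : ℝ) ≤ c₃ d s τ B (ManifoldReLU.surfaceArea d M) (∑ i, Λ i) *
          (ε ^ (-((d : ℝ) / ((s : ℝ) + α))) * Real.log (1 / ε) + D * Real.log (1 / ε) +
            D * Real.log D) ∧
        hidden.sum ≤ K ∧
        ∀ f : EuclideanSpace ℝ (Fin D) → ℝ, ManifoldReLU.IsHolder A s α f →
          ∃ Φ : ManifoldReLU.ReLUNet D,
            Φ.hiddenWidths = hidden ∧
            Φ.InClass (c₄ (∑ i, Λ i) * max 1 (max B (max (τ ^ 2) √(d : ℝ)))) L p K ∧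
            ∀ x ∈ M, |Φ.eval (fun j => x j) - f x| ≤ ε := by
  choose c hc using ManifoldReLU.exists_const_approx
  refine ⟨c, c, fun d s τ B S Λ₀ => c d s τ B S Λ₀ ^ 2 * (1 + d), fun _ => 4, ?_⟩
  intro d D M τ B hd hM _ hB hMB hτ hreach m A ρ s Λ α hρ hs hΛ hα hα1 ε hε hε1
  have h1 : B ≤ max 1 (max B (max (τ ^ 2) √(d : ℝ))) := le_max_of_le_right (le_max_left _ _)
  have h2 : 1 ≤ max 1 (max B (max (τ ^ 2) √(d : ℝ))) := le_max_left _ _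
  exact hc d s τ B _ _ D M hd hM hB hMB hτ hreach m A ρ Λ α hρ hs hΛ hα hα1 rfl rfl _
    (by linarith) (by linarith) ε hε hε1
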